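/- **Definitions.** For a lattice $L\subset\mathbb R^n$, the smoothing parameter $\eta(L)=\eta_{1/2}(L)$ is the unique $s>0$ with $\sum_{y\in L^*}e^{-\pi\|sy\|^2}=3/2$, and $\mu(L)$ is the covering radius. Put $$\eta^{\circ}_\mu(L)=\sup_{R\in\mathbb R^{n\times n}\ \text{non-singular}}\frac{\mu(RL)}{\sqrt{\operatorname{tr}(R^{T}R)}},$$ and let $C^{(\mu,\circ)}_\eta(n)$ be the smallest number $C$ such that $\eta(L)\le C\,\eta^\circ_\mu(L)$ for every $n$-dimensional lattice $L\subset\mathbb R^n$. $\gamma$-$\mathrm{GapSPP}_{1/2}$: given a basis of a full-rank lattice $L\subset\mathbb R^n$ ($n\ge1$) and $s>0$, decide whether $\eta(L)<s$ (YES) or $\eta(L)\ge\gamma(n)\,s$ (NO). A random vector $X\in\mathbb R^n$ is $s$-subgaussian if $\Pr[|\langle X,\theta\rangle|\ge t]\le 2e^{-(t/s)^2/2}$ for all unit vectors $\theta$ and all $t\ge 0$. A (randomized) oracle solves $\mathrm{DSGS}^{m}_{\sigma}$ if, given a basis of a full-rank lattice $L\subset\mathbb R^n$, a shift $t\in\mathbb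 R^n$ and a parameter $s>0$ with $s\ge\sigma(L)$, it outputs $m(n)$ independent samples from some $s$-subgaussian distribution supported on $L+t$; its behaviour is arbitrary on all other queries (in particular when $s<\sigma(L)$). Inputs are rational and are encoded by integers in binary over a common denominator (oracle answers are written over the denominator of the query). Running times are bit complexity (a random access machine with logarithmic cost) and are measured in the length of the input and of the oracle's answer. **Theorem.** There are absolute constants $K>0$ and $c\in\mathbb N$ and a randomized polynomial-time reduction, making a single oracle query, such that for every function $\alpha=\alpha(n)\ge1$ it reduces $K\alpha C^{(\mu,\circ)}_\eta(n)$-$\mathrm{GapSPP}_{1/2}$ to $\mathrm{DSGS}^{cn}_{\alpha\eta}$. Precisely: given the integer $\lceil\alpha(n)\rceil$ and a $\mathrm{GapSPP}$ input $(L,s)$, the reduction, run with any oracle that solves $\mathrm{DSGS}^{cn}_{\alpha\eta}$, accepts with probability at least $1-e^{-n}$ if $\eta(L)<s$, and rejects with probability at least $1/2$ if $\eta(L)\ge K\,\alpha(n)\,C^{(\mu,\circ)}_\eta(n)\,s$. -/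

import Mathlib

open scoped ENNReal

/-! ### Lattices in Euclidean space and the smoothing parameter -/

/-- `ℝⁿ` with the Euclidean norm. -/
abbrev RSpace (n : ℕ) : Type := EuclideanSpace ℝ (Fin n)

/-- The dual lattice `{y ∈ span L : ⟨y, x⟩ ∈ ℤ for all x ∈ L}`. -/
def dualLattice {n : ℕ} (L : Submodule ℤ (RSpace n)) : Set (RSpace n) :=
  {y | y ∈ Submodule.span ℝ (L : Set (RSpace n)) ∧ ∀ x ∈ L, ∃ k : ℤ, inner ℝ y x = (k : ℝ)}

/-- The smoothing parameter `η_ε(L)`: the unique `s > 0` with `∑_{y ∈ L*} exp(-π ‖s y‖²) = 1 + ε`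
(written as the infimum of the set consisting of this `s`). -/
noncomputable def smoothingParam {n : ℕ} (ε : ℝ) (L : Submodule ℤ (RSpace n)) : ℝ :=
  sInf {s : ℝ | 0 < s ∧
    HasSum (fun y : dualLattice L => Real.exp (-Real.pi * ‖s • (y : RSpace n)‖ ^ 2)) (1 + ε)}

/-- The covering radius `μ(L) = inf {r ≥ 0 : span L ⊆ L + r B₂}`. -/
noncomputable def coveringRadius {n : ℕ} (L : Submodule ℤ (RSpace n)) : ℝ :=
  sInf {r : ℝ | 0 ≤ r ∧
    ∀ x ∈ Submodule.span ℝ (L : Set (RSpace n)), ∃ y ∈ L, ‖x - y‖ ≤ r}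

/-- The image `R L` of a lattice under a matrix. -/
noncomputable def imageLattice {n : ℕ} (R : Matrix (Fin n) (Fin n) ℝ)
    (L : Submodule ℤ (RSpace n)) : Submodule ℤ (RSpace n) :=
  L.map ((Matrix.toEuclideanLin R).restrictScalars ℤ)

/-- `η_μ^∘(L) = sup {μ(R L) / (tr (Rᵀ R))^{1/2} : R non-singular}`. -/
noncomputable def etaMuCirc {n : ℕ} (L : Submodule ℤ (RSpace n)) : ℝ≥0∞ :=
  ⨆ (R : Matrix (Fin n) (Fin n) ℝ) (_ : R.det ≠ 0),
    ENNReal.ofReal (coveringRadius (imageLattice R L) / Real.sqrt (R.transpose * R).trace)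

/-- `C_η^{(μ,∘)}(n)`: the smallest `C` such that `η(L) ≤ C · η_μ^∘(L)` for every `n`-dimensional
lattice `L ⊂ ℝⁿ`, where `η = η_{1/2}`. -/
noncomputable def weakConst (n : ℕ) : ℝ≥0∞ :=
  sInf {C : ℝ≥0∞ | ∀ (L : Submodule ℤ (RSpace n)) [DiscreteTopology L] [IsZLattice ℝ L],
    ENNReal.ofReal (smoothingParam (1 / 2) L) ≤ C * etaMuCirc L}

/-! ### Polynomial-time computation

Programs work on finitely many integer arrays of unbounded length (array `k` holds an integer at
each index in `ℤ`, initially `0` outside of the input).  The cost is logarithmic: evaluating an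
expression costs, at each of its nodes, one plus the bit length of the value at that node. -/

/-- Bit length of an integer, with its sign. -/
def bitLen (z : ℤ) : ℕ := Nat.size z.natAbs + 1

/-- Bit size of a sequence of integers. -/
def bitSize (l : List ℤ) : ℕ := (l.map bitLen).sum

/-- Memory: `σ k i` is the content of cell `i` of array `k`. -/
abbrev Memory : Type := ℕ → ℤ → ℤ

/-- Integer expressions; `cell k e` is the content of array `k` at the index given by `e`. -/
inductive Expr : Type
  | const (z : ℤ) : Expr
  | cell (k : ℕ) (e : Expr) : Expr
  | add (e f : Expr) : Expr
  | sub (e f : Expr) : Expr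
  | mul (e f : Expr) : Expr
  | div (e f : Expr) : Expr

/-- Value of an expression (`div` is integer division with non-negative remainder). -/
def Expr.val (σ : Memory) : Expr → ℤ
  | .const z => z
  | .cell k e => σ k (e.val σ)
  | .add e f => e.val σ + f.val σ
  | .sub e f => e.val σ - f.val σ
  | .mul e f => e.val σ * f.val σ
  | .div e f => e.val σ / f.val σ

/-- Cost of evaluating an expression. -/
def Expr.cost (σ : Memory) : Expr → ℕ
  | .const z => 1 + bitLen z
  | .cell k e => 1 + bitLen (σ k (e.val σ)) + e.cost σ
  | .add e f => 1 + bitLen (e.val σ + f.val σ) + e.cost σ + f.cost σ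
  | .sub e f => 1 + bitLen (e.val σ - f.val σ) + e.cost σ + f.cost σ
  | .mul e f => 1 + bitLen (e.val σ * f.val σ) + e.cost σ + f.cost σ
  | .div e f => 1 + bitLen (e.val σ / f.val σ) + e.cost σ + f.cost σ

/-- Programs; `assign k i e` is `array k [i] := e`, and conditions are of the form `0 < e`. -/
inductive Prog : Type
  | skip : Prog
  | assign (k : ℕ) (i e : Expr) : Prog
  | seq (p q : Prog) : Prog
  | ite (e : Expr) (p q : Prog) : Prog
  | while (e : Expr) (p : Prog) : Prog

/-- The memory after writing `z` into cell `i` of array `k`. -/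
def Memory.write (σ : Memory) (k : ℕ) (i z : ℤ) : Memory :=
  fun k' i' => if k' = k ∧ i' = i then z else σ k' i'

/-- `Prog.Run p σ t τ`: started in memory `σ`, the program `p` halts in memory `τ` at total
cost `t`. -/
inductive Prog.Run : Prog → Memory → ℕ → Memory → Prop
  | skip (σ : Memory) : Prog.Run .skip σ 1 σ
  | assign (k : ℕ) (i e : Expr) (σ : Memory) :
      Prog.Run (.assign k i e) σ (1 + i.cost σ + e.cost σ) (σ.write k (i.val σ) (e.val σ))
  | seq {p q : Prog} {σ τ υ : Memory} {t u : ℕ} :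
      Prog.Run p σ t τ → Prog.Run q τ u υ → Prog.Run (.seq p q) σ (1 + t + u) υ
  | ite_true {e : Expr} {p q : Prog} {σ τ : Memory} {t : ℕ} :
      0 < e.val σ → Prog.Run p σ t τ → Prog.Run (.ite e p q) σ (1 + e.cost σ + t) τ
  | ite_false {e : Expr} {p q : Prog} {σ τ : Memory} {t : ℕ} :
      e.val σ ≤ 0 → Prog.Run q σ t τ → Prog.Run (.ite e p q) σ (1 + e.cost σ + t) τ
  | while_true {e : Expr} {p : Prog} {σ τ υ : Memory} {t u : ℕ} :
      0 < e.val σ → Prog.Run p σ t τ → Prog.Run (.while e p) τ u υ →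
      Prog.Run (.while e p) σ (1 + e.cost σ + t + u) υ
  | while_false {e : Expr} {p : Prog} {σ : Memory} :
      e.val σ ≤ 0 → Prog.Run (.while e p) σ (1 + e.cost σ) σ

/-- A list stored in an array: entries at `0, 1, …`, the length at index `-1`. -/
def arrayOfList (l : List ℤ) : ℤ → ℤ :=
  fun i => if 0 ≤ i then l.getD i.toNat 0 else if i = -1 then (l.length : ℤ) else 0

/-- The list stored in an array. -/
def listOfArray (a : ℤ → ℤ) : List ℤ := (List.range (a (-1)).toNat).map fun i : ℕ => a (i : ℤ)

/-- Initial memory: the `k`-th input is in array `k`. -/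
def inputMemory (inputs : List (List ℤ)) : Memory := fun k => arrayOfList (inputs.getD k [])

/-- On the given inputs, the program `p` halts with `out` in array `0`, at a cost (including that
of writing down `out`) of at most `T`. -/
def ComputesWithin (p : Prog) (inputs : List (List ℤ)) (T : ℕ) (out : List ℤ) : Prop :=
  ∃ (t : ℕ) (τ : Memory), Prog.Run p (inputMemory inputs) t τ ∧
    listOfArray (τ 0) = out ∧ t + bitSize out ≤ T

/-- `f` is computable in time polynomial in the total bit size of the inputs, for inputs in `D`. -/
def PolyTimeComputableOn (D : Set (List (List ℤ))) (f : List (List ℤ) → List ℤ) : Prop :=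
  ∃ (p : Prog) (T : Polynomial ℕ), ∀ inputs ∈ D,
    ComputesWithin p inputs (T.eval (inputs.map bitSize).sum) (f inputs)

/-! ### Randomized reductions with an oracle -/

/-- A randomized oracle: each query is answered according to a distribution. -/
abbrev Oracle : Type := List ℤ → PMF (List ℤ)

/-- A randomized reduction that queries the oracle once: on input `x` it flips `coins (bitSize x)`
fair coins, forms a query from `x` and the coins, and accepts or rejects depending on `x`, the coins
and the answer. -/
structure Reduction where
  coins : Polynomial ℕ
  query : List ℤ → List ℤ → List ℤ
  decide : List ℤ → List ℤ → List ℤ → Bool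

/-- Coin flips as a sequence of zeros and ones. -/
def coinWords {k : ℕ} (b : Fin k → Bool) : List ℤ := List.ofFn fun i => if b i then 1 else 0

/-- The reduction runs in polynomial time on the inputs in `X`: the query is computable in
polynomial time, and so is the final decision (the oracle's answer, which is an arbitrary sequence
of integers, counts as part of the input of the latter). -/
def Reduction.PolyTime (R : Reduction) (X : Set (List ℤ)) : Prop :=
  PolyTimeComputableOn
    {l | ∃ x ∈ X, ∃ b : Fin (R.coins.eval (bitSize x)) → Bool, l = [x, coinWords b]}
    (fun l => R.query (l.getD 0 []) (l.getD 1 [])) ∧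
  PolyTimeComputableOn
    {l | ∃ x ∈ X, ∃ b : Fin (R.coins.eval (bitSize x)) → Bool, ∃ a : List ℤ,
      l = [x, coinWords b, a]}
    (fun l => if R.decide (l.getD 0 []) (l.getD 1 []) (l.getD 2 []) then [1] else [0])

/-- The distribution of the outcome (`true` for accept) on input `x` with oracle `O`. -/
noncomputable def Reduction.outcome (R : Reduction) (O : Oracle) (x : List ℤ) : PMF Bool :=
  (PMF.uniformOfFintype (Fin (R.coins.eval (bitSize x)) → Bool)).bind fun b =>
    (O (R.query x (coinWords b))).map (R.decide x (coinWords b))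

/-! ### The lattice problems -/

/-- A basis `B = basis / den` (the basis vectors are the columns) of a full-rank lattice in `ℝⁿ`,
`n ≥ 1`, and a number `s = num / den > 0`: rational data over a common denominator. -/
structure LatticeInput where
  n : ℕ
  n_pos : 0 < n
  den : ℕ
  den_pos : 0 < den
  num : ℕ
  num_pos : 0 < num
  basis : Matrix (Fin n) (Fin n) ℤ
  basis_det : basis.det ≠ 0

/-- The vector `y / den` of `ℝⁿ`. -/
noncomputable def LatticeInput.point (I : LatticeInput) (y : Fin I.n → ℤ) : RSpace I.n :=
  WithLp.toLp 2 fun i => (y i : ℝ) / (I.den : ℝ)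

/-- The lattice generated by the columns of `B`. -/
noncomputable def LatticeInput.lattice (I : LatticeInput) : Submodule ℤ (RSpace I.n) :=
  Submodule.span ℤ (Set.range fun j => I.point fun i => I.basis i j)

/-- The number `s`. -/
noncomputable def LatticeInput.s (I : LatticeInput) : ℝ := (I.num : ℝ) / (I.den : ℝ)

/-- Encoding by integers (the matrix is listed row by row). -/
def LatticeInput.words (I : LatticeInput) : List ℤ :=
  [(I.n : ℤ), (I.den : ℤ), (I.num : ℤ)] ++
    (List.ofFn fun i => List.ofFn fun j => I.basis i j).flatten

/-- YES instances of `GapSPP_ε`: `η_ε(L) < s`. -/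
def GapSPPYes (ε : ℝ) (I : LatticeInput) : Prop := smoothingParam ε I.lattice < I.s

/-- NO instances of `γ-GapSPP_ε`: `η_ε(L) ≥ γ(n) s`. -/
def GapSPPNo (γ : ℕ → ℝ≥0∞) (ε : ℝ) (I : LatticeInput) : Prop :=
  γ I.n * ENNReal.ofReal I.s ≤ ENNReal.ofReal (smoothingParam ε I.lattice)

/-- A random vector of `ℝⁿ` with (discrete) distribution `ν` is `s`-subgaussian: all of its
one-dimensional marginals have tails `Pr[|⟨X, θ⟩| ≥ t] ≤ 2 exp(-(t/s)²/2)`. -/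
def IsSubgaussian {n : ℕ} (ν : PMF (RSpace n)) (s : ℝ) : Prop :=
  ∀ θ : RSpace n, ‖θ‖ = 1 → ∀ t : ℝ, 0 ≤ t →
    ν.toOuterMeasure {x | t ≤ |inner ℝ x θ|} ≤ ENNReal.ofReal (2 * Real.exp (-(t / s) ^ 2 / 2))

/-- The distribution of `m` independent samples from `ν`. -/
noncomputable def iidSamples {A : Type} (ν : PMF A) : ℕ → PMF (List A)
  | 0 => PMF.pure []
  | m + 1 => ν.bind fun x => (iidSamples ν m).map fun l => x :: l

/-- Input of the discrete subgaussian sampling problem: a basis, a parameter `s > 0`, and a shift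
`t = shift / den`. -/
structure DSGSInput extends LatticeInput where
  shift : Fin n → ℤ

/-- Encoding by integers. -/
def DSGSInput.words (q : DSGSInput) : List ℤ := q.toLatticeInput.words ++ List.ofFn q.shift

/-- The oracle `O` solves `DSGS^m_σ`: on input a basis of `L`, a shift `t` and `s ≥ σ(L)`, it outputs
`m(n)` independent samples of an `s`-subgaussian distribution on `L + t`.  The elements of `L + t`
have denominator `den`, so the oracle writes down their numerators.  Its behaviour on other queries
is arbitrary. -/
def SolvesDSGS (m : ℕ → ℕ) (σ : (n : ℕ) → Submodule ℤ (RSpace n) → ℝ) (O : Oracle) : Prop :=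
  ∀ q : DSGSInput, σ q.n q.lattice ≤ q.s →
    ∃ ν : PMF (Fin q.n → ℤ),
      (∀ y ∈ ν.support, q.point y - q.point q.shift ∈ q.lattice) ∧
      IsSubgaussian (ν.map q.point) q.s ∧
      O q.words = (iidSamples ν (m q.n)).map fun l => l.flatMap List.ofFn

/-- Input of the reduction: a `GapSPP` instance preceded by an integer parameter. -/
def paramWords (a : ℕ) (I : LatticeInput) : List ℤ := (a : ℤ) :: I.words

/-! Write L for the lattice with basis B / den, and let b be a vector of coins. The reduction looks
at vectors B w / den with w ≡ b mod 2, that is, at a coset of 2L; halved, it is the coset of L which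
the oracle is asked to sample. It accepts if n such vectors x_r pass the test Σ ⟨x_r, θ⟩² ≤ T ‖θ‖²
for all θ, with T of order n (α s)².

Soundness. For a NO instance the definition of `weakConst` supplies a non-singular R for which μ(RL)
is large against the Frobenius norm of R (`exists_matrix_of_weakConst_mul_le`), and up to a factor
of three the covering radius is witnessed by half a lattice vector p / 2 (`exists_half_far`). Let p
have coefficients u. If b + b' ≡ u mod 2, short vectors in both the classes of b and b' would
average to a vector that is short and congruent to p / 2 modulo RL. So one of the two classes has
only long vectors (`Spp.parity_far`), which happens for at least half of the coins. On such a class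
acceptance is impossible: summing the test over the rows of R gives Σ ‖R x_r‖² ≤ T tr(RᵀR), while
every term on the left is large (`Spp.le_of_accepts`). Nothing about the oracle enters, only that
class and test are verified.

Completeness. For a YES instance the oracle must deliver subgaussian samples, and n independent ones
pass the test with probability at least 1 - e⁻ⁿ (`iidSamples_sumSq`). Instead of a net on the
sphere, the proof averages exp(Σ ⟨x_r, θ⟩² / 4s²) over the unit ball: a direction of large value
forces large values on a ball of radius 1/4.

Computation. Two devices keep the programs elementary. To verify membership without solving linear
systems, the query uses the perturbed matrix 2hB + 1 with a huge h. A sample is then 2h(Bw) + w, and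
w and Bw are its low and high digits (`Spp.abs_lt_half`, `Spp.high_eq`). The perturbation at most
doubles the smoothing parameter (`Spp.smoothingParam_queryInput_le`), and soundness only sees the
exact vectors Bw of the original lattice. To compare the largest eigenvalue of the Gram matrix VᵀV
with T, the trace of its n-th power is compared with Tⁿ; this loses at most a factor of two, since n
≤ 2ⁿ. All quantities are then tables of sums, so a single loop scheme, `tabulate`, and its running
time bound `PolyRun.tabulate` cover both programs. -/

/-! ### A cost calculus for programs -/

/-- All cells of a memory have fewer than `F` bits. -/
def Memory.Below (σ : Memory) (F : ℕ) : Prop := ∀ k i, (σ k i).natAbs < 2 ^ F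

theorem bitLen_le_of_natAbs_lt {z : ℤ} {F : ℕ} (h : z.natAbs < 2 ^ F) : bitLen z ≤ F + 1 := by
  have := Nat.size_le.2 h
  unfold bitLen; omega

theorem natAbs_lt_two_pow_bitLen (z : ℤ) : z.natAbs < 2 ^ bitLen z :=
  (Nat.lt_size_self _).trans_le (Nat.pow_le_pow_right two_pos (Nat.le_succ _))

theorem natAbs_add_lt {y z : ℤ} {F G : ℕ} (hy : y.natAbs < 2 ^ F) (hz : z.natAbs < 2 ^ G) :
    (y + z).natAbs < 2 ^ (F + G + 1) := by
  have h1 : 2 ^ F ≤ 2 ^ (F + G) := Nat.pow_le_pow_right two_pos (by omega)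
  have h2 : 2 ^ G ≤ 2 ^ (F + G) := Nat.pow_le_pow_right two_pos (by omega)
  have h3 := Int.natAbs_add_le y z
  rw [pow_succ]; omega

theorem natAbs_sub_lt {y z : ℤ} {F G : ℕ} (hy : y.natAbs < 2 ^ F) (hz : z.natAbs < 2 ^ G) :
    (y - z).natAbs < 2 ^ (F + G + 1) := by
  rw [sub_eq_add_neg]
  exact natAbs_add_lt hy (by rwa [Int.natAbs_neg])

theorem natAbs_mul_lt {y z : ℤ} {F G : ℕ} (hy : y.natAbs < 2 ^ F) (hz : z.natAbs < 2 ^ G) :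
    (y * z).natAbs < 2 ^ (F + G) := by
  rw [Int.natAbs_mul, pow_add]
  exact Nat.mul_lt_mul'' hy hz

theorem natAbs_div_lt {y : ℤ} {F : ℕ} (hy : y.natAbs < 2 ^ F) (z : ℤ) :
    (y / z).natAbs < 2 ^ F :=
  (Int.natAbs_ediv_le_natAbs y z).trans_lt hy

/-- A bound for the bit length of the value of an expression. -/
noncomputable def Expr.bits : Expr → Polynomial ℕ
  | .const z => .C (bitLen z)
  | .cell _ _ => .X
  | .add e f => e.bits + f.bits + 1
  | .sub e f => e.bits + f.bits + 1
  | .mul e f => e.bits + f.bits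
  | .div e _ => e.bits

/-- An expression is a fixed syntax tree, so its value has a number of bits polynomial in the cell
size. A quotient is never longer than its numerator, also when the divisor is zero. -/
theorem Expr.natAbs_val_lt {σ : Memory} {F : ℕ} (hσ : σ.Below F) (e : Expr) :
    (e.val σ).natAbs < 2 ^ (e.bits.eval F) := by
  induction e with
  | const z => simpa [Expr.val, Expr.bits] using natAbs_lt_two_pow_bitLen z
  | cell k e _ => simpa [Expr.val, Expr.bits] using hσ _ _
  | add e f he hf => simpa [Expr.val, Expr.bits] using natAbs_add_lt he hf
  | sub e f he hf => simpa [Expr.val, Expr.bits] using natAbs_sub_lt he hf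
  | mul e f he hf => simpa [Expr.val, Expr.bits] using natAbs_mul_lt he hf
  | div e f he hf => simpa [Expr.val, Expr.bits] using natAbs_div_lt he _

/-- A bound for the cost of evaluating an expression. -/
noncomputable def Expr.costBound : Expr → Polynomial ℕ
  | .const z => (Expr.const z).bits + 2
  | .cell k e => (Expr.cell k e).bits + 2 + e.costBound
  | .add e f => (Expr.add e f).bits + 2 + e.costBound + f.costBound
  | .sub e f => (Expr.sub e f).bits + 2 + e.costBound + f.costBound
  | .mul e f => (Expr.mul e f).bits + 2 + e.costBound + f.costBound
  | .div e f => (Expr.div e f).bits + 2 + e.costBound + f.costBound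

theorem Expr.cost_le {σ : Memory} {F : ℕ} (hσ : σ.Below F) (e : Expr) :
    e.cost σ ≤ e.costBound.eval F := by
  induction e with
  | const z =>
    have := bitLen_le_of_natAbs_lt (Expr.natAbs_val_lt hσ (.const z))
    simp only [Expr.val] at this
    simp only [Expr.cost, Expr.costBound, Polynomial.eval_add, Polynomial.eval_ofNat]; omega
  | cell k e he =>
    have := bitLen_le_of_natAbs_lt (Expr.natAbs_val_lt hσ (.cell k e))
    simp only [Expr.val] at this
    simp only [Expr.cost, Expr.costBound, Polynomial.eval_add, Polynomial.eval_ofNat]; omega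
  | add e f he hf =>
    have := bitLen_le_of_natAbs_lt (Expr.natAbs_val_lt hσ (.add e f))
    simp only [Expr.val] at this
    simp only [Expr.cost, Expr.costBound, Polynomial.eval_add, Polynomial.eval_ofNat]; omega
  | sub e f he hf =>
    have := bitLen_le_of_natAbs_lt (Expr.natAbs_val_lt hσ (.sub e f))
    simp only [Expr.val] at this
    simp only [Expr.cost, Expr.costBound, Polynomial.eval_add, Polynomial.eval_ofNat]; omega
  | mul e f he hf =>
    have := bitLen_le_of_natAbs_lt (Expr.natAbs_val_lt hσ (.mul e f))
    simp only [Expr.val] at this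
    simp only [Expr.cost, Expr.costBound, Polynomial.eval_add, Polynomial.eval_ofNat]; omega
  | div e f he hf =>
    have := bitLen_le_of_natAbs_lt (Expr.natAbs_val_lt hσ (.div e f))
    simp only [Expr.val] at this
    simp only [Expr.cost, Expr.costBound, Polynomial.eval_add, Polynomial.eval_ofNat]; omega

/-! ### Families of bounded size -/

section Bounds

variable {ι κ : Type} {D : Set ι} {sz : ι → ℕ}

/-- The integers `g d`, `d ∈ D`, have a number of bits polynomial in the size of `d`. -/
def LogBdd (D : Set ι) (sz : ι → ℕ) (g : ι → ℤ) : Prop :=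
  ∃ T : Polynomial ℕ, ∀ d ∈ D, (g d).natAbs < 2 ^ T.eval (sz d)

/-- The numbers `C d`, `d ∈ D`, are polynomially bounded in the size of `d`. -/
def SizeBdd (D : Set ι) (sz : ι → ℕ) (C : ι → ℕ) : Prop :=
  ∃ T : Polynomial ℕ, ∀ d ∈ D, C d ≤ T.eval (sz d)

theorem SizeBdd.const (c : ℕ) : SizeBdd D sz fun _ => c := ⟨.C c, fun d _ => by simp⟩

theorem SizeBdd.add {f g : ι → ℕ} (hf : SizeBdd D sz f) (hg : SizeBdd D sz g) :
    SizeBdd D sz fun d => f d + g d := by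
  obtain ⟨S, hS⟩ := hf
  obtain ⟨T, hT⟩ := hg
  exact ⟨S + T, fun d hd => by simpa using add_le_add (hS d hd) (hT d hd)⟩

theorem SizeBdd.mul {f g : ι → ℕ} (hf : SizeBdd D sz f) (hg : SizeBdd D sz g) :
    SizeBdd D sz fun d => f d * g d := by
  obtain ⟨S, hS⟩ := hf
  obtain ⟨T, hT⟩ := hg
  exact ⟨S * T, fun d hd => by simpa using Nat.mul_le_mul (hS d hd) (hT d hd)⟩

theorem LogBdd.congr {f g : ι → ℤ} (hf : LogBdd D sz f) (h : ∀ d ∈ D, g d = f d) :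
    LogBdd D sz g := by
  obtain ⟨S, hS⟩ := hf
  exact ⟨S, fun d hd => h d hd ▸ hS d hd⟩

theorem LogBdd.const (c : ℤ) : LogBdd D sz fun _ => c :=
  ⟨.C (bitLen c), fun d _ => by simpa using natAbs_lt_two_pow_bitLen c⟩

theorem LogBdd.add {f g : ι → ℤ} (hf : LogBdd D sz f) (hg : LogBdd D sz g) :
    LogBdd D sz fun d => f d + g d := by
  obtain ⟨S, hS⟩ := hf
  obtain ⟨T, hT⟩ := hg
  exact ⟨S + T + 1, fun d hd => by simpa using natAbs_add_lt (hS d hd) (hT d hd)⟩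

theorem LogBdd.sub {f g : ι → ℤ} (hf : LogBdd D sz f) (hg : LogBdd D sz g) :
    LogBdd D sz fun d => f d - g d := by
  obtain ⟨S, hS⟩ := hf
  obtain ⟨T, hT⟩ := hg
  exact ⟨S + T + 1, fun d hd => by simpa using natAbs_sub_lt (hS d hd) (hT d hd)⟩

theorem LogBdd.mul {f g : ι → ℤ} (hf : LogBdd D sz f) (hg : LogBdd D sz g) :
    LogBdd D sz fun d => f d * g d := by
  obtain ⟨S, hS⟩ := hf
  obtain ⟨T, hT⟩ := hg
  exact ⟨S + T, fun d hd => by simpa using natAbs_mul_lt (hS d hd) (hT d hd)⟩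

theorem LogBdd.div {f : ι → ℤ} (hf : LogBdd D sz f) (g : ι → ℤ) :
    LogBdd D sz fun d => f d / g d := by
  obtain ⟨S, hS⟩ := hf
  exact ⟨S, fun d hd => natAbs_div_lt (hS d hd) _⟩

theorem LogBdd.pow {f : ι → ℤ} (hf : LogBdd D sz f) {C : ι → ℕ} (hC : SizeBdd D sz C) :
    LogBdd D sz fun d => f d ^ C d := by
  obtain ⟨S, hS⟩ := hf
  obtain ⟨T, hT⟩ := hC
  refine ⟨S * T + 1, fun d hd => ?_⟩
  have h : (f d).natAbs ≤ 2 ^ S.eval (sz d) := (hS d hd).le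
  rw [Int.natAbs_pow]
  calc (f d).natAbs ^ C d ≤ (2 ^ S.eval (sz d)) ^ C d := Nat.pow_le_pow_left h _
    _ ≤ (2 ^ S.eval (sz d)) ^ T.eval (sz d) := Nat.pow_le_pow_right (by positivity) (hT d hd)
    _ < _ := by
      rw [← pow_mul]
      exact Nat.pow_lt_pow_right (by norm_num) (by simp)

theorem LogBdd.of_size {C : ι → ℕ} (hC : SizeBdd D sz C) : LogBdd D sz fun d => (C d : ℤ) := by
  obtain ⟨T, hT⟩ := hC
  exact ⟨T, fun d hd => by
    simpa using (hT d hd).trans_lt (Nat.lt_two_pow_self)⟩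

theorem natAbs_sum_range_le (f : ℕ → ℤ) {M : ℕ} {n : ℕ} (h : ∀ j < n, (f j).natAbs ≤ M) :
    (∑ j ∈ Finset.range n, f j).natAbs ≤ n * M := by
  refine (Int.natAbs_sum_le _ _).trans ?_
  have := Finset.sum_le_card_nsmul (Finset.range n) (fun j => (f j).natAbs) M
    fun j hj => h j (Finset.mem_range.1 hj)
  simpa using this

/-- Uniformity in the summation index is expressed as boundedness of a family over pairs (d, j), so
that the closure properties above apply to the summands as well. -/
theorem LogBdd.sum {C : ι → ℕ} (hC : SizeBdd D sz C) {f : ι → ℕ → ℤ}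
    (hf : LogBdd {p : ι × ℕ | p.1 ∈ D ∧ p.2 < C p.1} (fun p => sz p.1) fun p => f p.1 p.2) :
    LogBdd D sz fun d => ∑ j ∈ Finset.range (C d), f d j := by
  obtain ⟨S, hS⟩ := hf
  obtain ⟨T, hT⟩ := hC
  refine ⟨T + S, fun d hd => ?_⟩
  rw [Polynomial.eval_add, pow_add]
  calc _ ≤ C d * 2 ^ S.eval (sz d) :=
        natAbs_sum_range_le _ fun j hj => (hS (d, j) ⟨hd, hj⟩).le
    _ < _ := Nat.mul_lt_mul_of_pos_right ((hT d hd).trans_lt Nat.lt_two_pow_self) (by positivity)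

/-- All cells of the memories `A d` have polynomially many bits. -/
def MemBdd (D : Set ι) (sz : ι → ℕ) (A : ι → Memory) : Prop :=
  ∃ T : Polynomial ℕ, ∀ d ∈ D, (A d).Below (T.eval (sz d))

theorem MemBdd.cell {A : ι → Memory} (hA : MemBdd D sz A) {E : Set κ} {sz' : κ → ℕ} (φ : κ → ι)
    (hE : ∀ p ∈ E, φ p ∈ D ∧ sz' p = sz (φ p)) (k : κ → ℕ) (i : κ → ℤ) :
    LogBdd E sz' fun p => A (φ p) (k p) (i p) := by
  obtain ⟨S, hS⟩ := hA
  exact ⟨S, fun d hd => by rw [(hE d hd).2]; exact hS _ (hE _ hd).1 _ _⟩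

theorem Memory.Below.mono {σ : Memory} {F G : ℕ} (h : σ.Below F) (hFG : F ≤ G) : σ.Below G :=
  fun k i => (h k i).trans_le (Nat.pow_le_pow_right two_pos hFG)

theorem MemBdd.write {A : ι → Memory} (hA : MemBdd D sz A) (k : ℕ) (i : ι → ℤ) {z : ι → ℤ}
    (hz : LogBdd D sz z) : MemBdd D sz fun d => (A d).write k (i d) (z d) := by
  obtain ⟨S, hS⟩ := hA
  obtain ⟨T, hT⟩ := hz
  refine ⟨S + T, fun d hd k' i' => ?_⟩
  rw [Polynomial.eval_add]
  simp only [Memory.write]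
  split_ifs
  · exact (hT d hd).trans_le (Nat.pow_le_pow_right two_pos (by omega))
  · exact (hS d hd _ _).trans_le (Nat.pow_le_pow_right two_pos (by omega))

/-- `p` transforms the memory `A d` into `B d` in polynomial time. -/
def PolyRun (D : Set ι) (sz : ι → ℕ) (A : ι → Memory) (p : Prog) (B : ι → Memory) : Prop :=
  ∃ T : Polynomial ℕ, ∀ d ∈ D, ∃ t ≤ T.eval (sz d), Prog.Run p (A d) t (B d)

theorem PolyRun.seq {A B C : ι → Memory} {p q : Prog} (hp : PolyRun D sz A p B)
    (hq : PolyRun D sz B q C) : PolyRun D sz A (.seq p q) C := by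
  obtain ⟨S, hS⟩ := hp
  obtain ⟨T, hT⟩ := hq
  refine ⟨1 + S + T, fun d hd => ?_⟩
  obtain ⟨t, ht, h1⟩ := hS d hd
  obtain ⟨u, hu, h2⟩ := hT d hd
  exact ⟨_, by simp; omega, .seq h1 h2⟩

theorem PolyRun.assign {A : ι → Memory} (hA : MemBdd D sz A) {k : ℕ} {i e : Expr}
    {iv ev : ι → ℤ} (hi : ∀ d ∈ D, i.val (A d) = iv d) (he : ∀ d ∈ D, e.val (A d) = ev d) :
    PolyRun D sz A (.assign k i e) fun d => (A d).write k (iv d) (ev d) := by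
  obtain ⟨S, hS⟩ := hA
  refine ⟨1 + i.costBound.comp S + e.costBound.comp S, fun d hd => ?_⟩
  have hr := Prog.Run.assign k i e (A d)
  rw [hi d hd, he d hd] at hr
  refine ⟨_, ?_, hr⟩
  have h1 := Expr.cost_le (hS d hd) i
  have h2 := Expr.cost_le (hS d hd) e
  simp only [Polynomial.eval_add, Polynomial.eval_comp, Polynomial.eval_one]
  omega

theorem PolyRun.ite_assign {A : ι → Memory} (hA : MemBdd D sz A) {c : Expr} {k : ℕ} {i e f : Expr}
    {iv cv ev fv : ι → ℤ} (hc : ∀ d ∈ D, c.val (A d) = cv d) (hi : ∀ d ∈ D, i.val (A d) = iv d)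
    (he : ∀ d ∈ D, e.val (A d) = ev d) (hf : ∀ d ∈ D, f.val (A d) = fv d) :
    PolyRun D sz A (.ite c (.assign k i e) (.assign k i f))
      fun d => (A d).write k (iv d) (if 0 < cv d then ev d else fv d) := by
  obtain ⟨U, hU⟩ := PolyRun.assign (k := k) hA hi he
  obtain ⟨V, hV⟩ := PolyRun.assign (k := k) hA hi hf
  obtain ⟨S, hS⟩ := hA
  refine ⟨1 + c.costBound.comp S + U + V, fun d hd => ?_⟩
  have h1 := Expr.cost_le (hS d hd) c
  dsimp only
  split_ifs with h
  · obtain ⟨t, ht, hr⟩ := hU d hd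
    exact ⟨_, by simp [Polynomial.eval_comp]; omega, .ite_true (by rwa [hc d hd]) hr⟩
  · obtain ⟨t, ht, hr⟩ := hV d hd
    exact ⟨_, by simp [Polynomial.eval_comp]; omega, .ite_false (by rw [hc d hd]; omega) hr⟩

end Bounds

/-! ### Filling tables -/

/-- The array that holds `z` in cell `0`. -/
def single (z : ℤ) : ℤ → ℤ := fun i => if i = 0 then z else 0

@[simp] theorem single_zero (z : ℤ) : single z 0 = z := rfl

/-- The memory with the three registers used by loops (arrays `4`, `5`, `6`) set. -/
def Memory.regs (σ : Memory) (x j acc : ℤ) : Memory := fun k =>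
  if k = 4 then single x else if k = 5 then single j else if k = 6 then single acc else σ k

/-- The memory with `g 0, …, g (x - 1)` written into the cells `off, …, off + x - 1` of
array `k`. -/
def Memory.fill (σ : Memory) (k : ℕ) (off : ℤ) (g : ℕ → ℤ) (x : ℕ) : Memory := fun k' i =>
  if k' = k ∧ off ≤ i ∧ i < off + x then g (i - off).toNat else σ k' i

theorem Memory.fill_zero (σ : Memory) (k : ℕ) (off : ℤ) (g : ℕ → ℤ) : σ.fill k off g 0 = σ := by
  funext k' i
  have : ¬ (k' = k ∧ off ≤ i ∧ i < off + (0 : ℕ)) := by push_cast; omega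
  simp only [Memory.fill, if_neg this]

theorem Memory.write_fill (σ : Memory) (k : ℕ) (off : ℤ) (g : ℕ → ℤ) (x : ℕ) :
    (σ.fill k off g x).write k (off + x) (g x) = σ.fill k off g (x + 1) := by
  funext k' i
  unfold Memory.write Memory.fill
  by_cases h : k' = k ∧ i = off + x
  · have h' : k' = k ∧ off ≤ i ∧ i < off + (x + 1 : ℕ) := by push_cast; omega
    rw [if_pos h, if_pos h', h.2]
    simp
  · rw [if_neg h]
    by_cases h2 : k' = k ∧ off ≤ i ∧ i < off + x
    · have h' : k' = k ∧ off ≤ i ∧ i < off + (x + 1 : ℕ) := by push_cast; omega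
      rw [if_pos h2, if_pos h']
    · have h' : ¬ (k' = k ∧ off ≤ i ∧ i < off + (x + 1 : ℕ)) := by push_cast; omega
      rw [if_neg h2, if_neg h']

theorem Memory.write_regs (σ : Memory) {k : ℕ} (h4 : k ≠ 4) (h5 : k ≠ 5) (h6 : k ≠ 6)
    (i z x j acc : ℤ) : (σ.regs x j acc).write k i z = (σ.write k i z).regs x j acc := by
  funext k' i'
  unfold Memory.write Memory.regs
  by_cases hk : k' = k
  · subst hk; simp [h4, h5, h6]
  · simp [hk]

theorem Memory.write_regs_four (σ : Memory) (z x j acc : ℤ) :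
    (σ.regs x j acc).write 4 0 z = σ.regs z j acc := by
  funext k' i'
  unfold Memory.write Memory.regs single
  by_cases hk : k' = 4
  · subst hk; by_cases hi : i' = 0 <;> simp [hi]
  · simp [hk]

theorem Memory.write_regs_five (σ : Memory) (z x j acc : ℤ) :
    (σ.regs x j acc).write 5 0 z = σ.regs x z acc := by
  funext k' i'
  unfold Memory.write Memory.regs single
  by_cases hk : k' = 5
  · subst hk; by_cases hi : i' = 0 <;> simp [hi]
  · simp [hk]

theorem Memory.write_regs_six (σ : Memory) (z x j acc : ℤ) :
    (σ.regs x j acc).write 6 0 z = σ.regs x j z := by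
  funext k' i'
  unfold Memory.write Memory.regs single
  by_cases hk : k' = 6
  · subst hk; by_cases hi : i' = 0 <;> simp [hi]
  · simp [hk]

theorem Memory.Below.regs {σ : Memory} {F : ℕ} (h : σ.Below F) {x j acc : ℤ}
    (hx : x.natAbs < 2 ^ F) (hj : j.natAbs < 2 ^ F) (ha : acc.natAbs < 2 ^ F) :
    (σ.regs x j acc).Below F := by
  intro k i
  simp only [Memory.regs, single, ite_apply]
  have h0 : (0 : ℤ).natAbs < 2 ^ F := by simp
  split_ifs <;> first | assumption | exact h k i

/-- The content of cell `0` of an array. -/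
def Expr.reg (k : ℕ) : Expr := .cell k (.const 0)

/-- The inner loop: add up `body` for `j < cj`. -/
def sumLoop (cj body : Expr) : Prog :=
  .while (.sub cj (.reg 5)) (.seq (.assign 6 (.const 0) (.add (.reg 6) body))
    (.assign 5 (.const 0) (.add (.reg 5) (.const 1))))

/-- One round of the outer loop: compute `init + ∑_{j < cj} body` and write it into cell `idx`
of array `k`. -/
def tabRound (k : ℕ) (idx cj init body : Expr) : Prog :=
  .seq (.assign 6 (.const 0) init) (.seq (sumLoop cj body) (.seq (.assign 5 (.const 0) (.const 0))
    (.seq (.assign k idx (.reg 6)) (.seq (.assign 6 (.const 0) (.const 0))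
      (.assign 4 (.const 0) (.add (.reg 4) (.const 1)))))))

/-- For `x < cx`, write `init + ∑_{j < cj} body` into cell `idx` of array `k`. -/
def tabulate (k : ℕ) (idx cx cj init body : Expr) : Prog :=
  .seq (.while (.sub cx (.reg 4)) (tabRound k idx cj init body)) (.assign 4 (.const 0) (.const 0))

/-- Induction on the number m of remaining rounds, with the partial sum in array 6 and the counter
in array 5 as invariant. `hF'` is about the state in the middle of a round, when the sum has been
updated but the counter has not. -/
theorem sumLoop_run {σ : Memory} {cj body : Expr} {x : ℤ} {C F : ℕ} {ini : ℤ} {b : ℕ → ℤ}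
    (hcj : ∀ j acc : ℤ, cj.val (σ.regs x j acc) = C)
    (hb : ∀ j : ℕ, j < C → ∀ acc : ℤ, body.val (σ.regs x j acc) = b j)
    (hF : ∀ j ≤ C, (σ.regs x j (ini + ∑ l ∈ Finset.range j, b l)).Below F)
    (hF' : ∀ j < C, (σ.regs x j (ini + ∑ l ∈ Finset.range (j + 1), b l)).Below F)
    (m j : ℕ) (hm : j + m = C) :
    ∃ t ≤ (m + 1) * (20 + (Expr.sub cj (.reg 5)).costBound.eval F +
        (Expr.add (.reg 6) body).costBound.eval F +
        (Expr.add (.reg 5) (.const 1)).costBound.eval F),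
      Prog.Run (sumLoop cj body) (σ.regs x j (ini + ∑ l ∈ Finset.range j, b l)) t
        (σ.regs x C (ini + ∑ l ∈ Finset.range C, b l)) := by
  induction m generalizing j with
  | zero =>
    obtain rfl : j = C := by omega
    refine ⟨_, ?_, .while_false ?_⟩
    · have := Expr.cost_le (hF j le_rfl) (.sub cj (.reg 5))
      nlinarith
    · simp [Expr.val, hcj, Expr.reg, Memory.regs]
  | succ m ih =>
    have hj : j < C := by omega
    obtain ⟨t, ht, hr⟩ := ih (j + 1) (by omega)
    have c1 := Expr.cost_le (hF j hj.le) (.sub cj (.reg 5))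
    have c2 := Expr.cost_le (hF j hj.le) (.add (.reg 6) body)
    have c3 := Expr.cost_le (hF' j hj) (.add (.reg 5) (.const 1))
    have r1 := Prog.Run.assign 6 (.const 0) (.add (.reg 6) body)
      (σ.regs x j (ini + ∑ l ∈ Finset.range j, b l))
    have e1 : (Expr.add (.reg 6) body).val (σ.regs x j (ini + ∑ l ∈ Finset.range j, b l)) =
        ini + ∑ l ∈ Finset.range (j + 1), b l := by
      rw [Expr.val, hb j hj, Finset.sum_range_succ, ← add_assoc]; rfl
    rw [e1, Expr.val, Memory.write_regs_six] at r1
    have r2 := Prog.Run.assign 5 (.const 0) (.add (.reg 5) (.const 1))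
      (σ.regs x j (ini + ∑ l ∈ Finset.range (j + 1), b l))
    have e2 : (Expr.add (.reg 5) (.const 1)).val
        (σ.regs x j (ini + ∑ l ∈ Finset.range (j + 1), b l)) = ((j + 1 : ℕ) : ℤ) := by
      simp [Expr.val, Expr.reg, Memory.regs]
    rw [e2, Expr.val, Memory.write_regs_five] at r2
    refine ⟨_, ?_, .while_true ?_ (.seq r1 r2) hr⟩
    · have : (Expr.const 0).cost (σ.regs x j (ini + ∑ l ∈ Finset.range j, b l)) = 2 := by
        simp [Expr.cost, bitLen]
      have : (Expr.const 0).cost (σ.regs x j (ini + ∑ l ∈ Finset.range (j + 1), b l)) = 2 := by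
        simp [Expr.cost, bitLen]
      rw [add_mul _ 1]
      omega
    · simp [Expr.val, hcj, Expr.reg, Memory.regs]; omega

/-- The cost of one round, when all cells have at most `F` bits and the inner loop has `C`
rounds. -/
noncomputable def roundBound (idx cj init body : Expr) (F C : ℕ) : ℕ :=
  40 + init.costBound.eval F + (C + 1) * (20 + (Expr.sub cj (.reg 5)).costBound.eval F +
        (Expr.add (.reg 6) body).costBound.eval F +
        (Expr.add (.reg 5) (.const 1)).costBound.eval F) + idx.costBound.eval F +
    (Expr.reg 6).costBound.eval F + (Expr.add (.reg 4) (.const 1)).costBound.eval F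

theorem tabRound_run {σ : Memory} {k : ℕ} (h4 : k ≠ 4) (h5 : k ≠ 5) (h6 : k ≠ 6)
    {idx cj init body : Expr} {x C F : ℕ} {i z ini : ℤ} {b : ℕ → ℤ}
    (hidx : ∀ acc : ℤ, idx.val (σ.regs x 0 acc) = i) (hini : init.val (σ.regs x 0 0) = ini)
    (hcj : ∀ j acc : ℤ, cj.val (σ.regs x j acc) = C)
    (hb : ∀ j : ℕ, j < C → ∀ acc : ℤ, body.val (σ.regs x j acc) = b j)
    (hz : z = ini + ∑ j ∈ Finset.range C, b j)
    (hσ : σ.Below F) (hzF : z.natAbs < 2 ^ F) (hC : C < 2 ^ F) (hx : x < 2 ^ F)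
    (hF : ∀ j ≤ C, (ini + ∑ l ∈ Finset.range j, b l).natAbs < 2 ^ F) :
    ∃ t ≤ roundBound idx cj init body F C,
      Prog.Run (tabRound k idx cj init body) (σ.regs x 0 0) t
        ((σ.write k i z).regs (x + 1 : ℕ) 0 0) := by
  have h0 : (0 : ℤ).natAbs < 2 ^ F := by simp
  have hxn : (x : ℤ).natAbs < 2 ^ F := by simpa
  have B0 : (σ.regs x 0 0).Below F := hσ.regs hxn h0 h0
  obtain ⟨t, ht, hr⟩ := sumLoop_run (F := F) (ini := ini) hcj hb
    (fun j hj => hσ.regs hxn (by simpa using hj.trans_lt hC) (hF j hj))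
    (fun j hj => hσ.regs hxn (by simpa using hj.trans hC) (hF _ hj)) C 0 (by simp)
  rw [← hz] at hr
  simp only [Finset.range_zero, Finset.sum_empty, add_zero, Nat.cast_zero] at hr
  have r1 := Prog.Run.assign 6 (.const 0) init (σ.regs x 0 0)
  rw [hini, Expr.val, Memory.write_regs_six] at r1
  have r3 := Prog.Run.assign 5 (.const 0) (.const 0) (σ.regs x C z)
  rw [Expr.val, Memory.write_regs_five] at r3
  have r4 := Prog.Run.assign k idx (.reg 6) (σ.regs x 0 z)
  have e4 : (Expr.reg 6).val (σ.regs x 0 z) = z := by simp [Expr.val, Expr.reg, Memory.regs]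
  rw [hidx, e4, Memory.write_regs _ h4 h5 h6] at r4
  have hσ' : (σ.write k i z).Below F := by
    intro k' i'
    unfold Memory.write
    split_ifs
    exacts [hzF, hσ _ _]
  have r5 := Prog.Run.assign 6 (.const 0) (.const 0) ((σ.write k i z).regs x 0 z)
  rw [Expr.val, Memory.write_regs_six] at r5
  have r6 := Prog.Run.assign 4 (.const 0) (.add (.reg 4) (.const 1)) ((σ.write k i z).regs x 0 0)
  have e6 : (Expr.add (.reg 4) (.const 1)).val ((σ.write k i z).regs x 0 0) = (x + 1 : ℕ) := by
    simp [Expr.val, Expr.reg, Memory.regs]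
  rw [e6, Expr.val, Memory.write_regs_four] at r6
  refine ⟨_, ?_, .seq r1 (.seq hr (.seq r3 (.seq r4 (.seq r5 r6))))⟩
  have c0 : ∀ τ, (Expr.const 0).cost τ = 2 := fun τ => by simp [Expr.cost, bitLen]
  have c1 := Expr.cost_le B0 init
  have c4 := Expr.cost_le (hσ.regs hxn h0 hzF) idx
  have c4' := Expr.cost_le (hσ.regs hxn h0 hzF) (.reg 6)
  have c6 := Expr.cost_le (hσ'.regs hxn h0 h0) (.add (.reg 4) (.const 1))
  simp only [c0, roundBound]
  omega

/-- The expressions are evaluated in the partially filled memory, which allows recurrences that read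
the table under construction. By `hreg` the loop registers are zero at the start; they are zero
again at the end, so the memory changes only in the filled cells. -/
theorem tabulate_run {σ : Memory} {k : ℕ} (h4 : k ≠ 4) (h5 : k ≠ 5) (h6 : k ≠ 6)
    (hreg : σ.regs 0 0 0 = σ)
    {idx cx cj init body : Expr} {Cx C F : ℕ} {off : ℤ} {g ini : ℕ → ℤ} {b : ℕ → ℕ → ℤ}
    (hcx : ∀ x ≤ Cx, cx.val ((σ.fill k off g x).regs x 0 0) = Cx)
    (hidx : ∀ x < Cx, ∀ acc : ℤ, idx.val ((σ.fill k off g x).regs x 0 acc) = off + x)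
    (hini : ∀ x < Cx, init.val ((σ.fill k off g x).regs x 0 0) = ini x)
    (hcj : ∀ x < Cx, ∀ j acc : ℤ, cj.val ((σ.fill k off g x).regs x j acc) = C)
    (hb : ∀ x < Cx, ∀ j : ℕ, j < C → ∀ acc : ℤ,
      body.val ((σ.fill k off g x).regs x j acc) = b x j)
    (hg : ∀ x < Cx, g x = ini x + ∑ j ∈ Finset.range C, b x j)
    (hσ : σ.Below F) (hgF : ∀ x < Cx, (g x).natAbs < 2 ^ F) (hC : C < 2 ^ F) (hCx : Cx < 2 ^ F)
    (hF : ∀ x < Cx, ∀ j ≤ C, (ini x + ∑ l ∈ Finset.range j, b x l).natAbs < 2 ^ F) :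
    ∃ t ≤ 20 + (Cx + 1) * (2 + (Expr.sub cx (.reg 4)).costBound.eval F +
        roundBound idx cj init body F C),
      Prog.Run (tabulate k idx cx cj init body) σ t (σ.fill k off g Cx) := by
  have h0 : (0 : ℤ).natAbs < 2 ^ F := by simp
  have hB : ∀ x ≤ Cx, (σ.fill k off g x).Below F := by
    intro x hx k' i
    unfold Memory.fill
    split_ifs with h
    · exact hgF _ (by omega)
    · exact hσ _ _
  have key : ∀ m x : ℕ, x + m = Cx → ∃ t ≤ (m + 1) * (2 + (Expr.sub cx (.reg 4)).costBound.eval F +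
        roundBound idx cj init body F C),
      Prog.Run (.while (.sub cx (.reg 4)) (tabRound k idx cj init body))
        ((σ.fill k off g x).regs x 0 0) t ((σ.fill k off g Cx).regs Cx 0 0) := by
    intro m
    induction m with
    | zero =>
      intro x hx
      obtain rfl : x = Cx := by omega
      refine ⟨_, ?_, .while_false ?_⟩
      · have := Expr.cost_le ((hB x le_rfl).regs ((Int.natAbs_natCast x).symm ▸ hCx) h0 h0) (.sub cx (.reg 4))
        nlinarith
      · simp [Expr.val, hcx x le_rfl, Expr.reg, Memory.regs]
    | succ m ih =>
      intro x hx
      have hxC : x < Cx := by omega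
      obtain ⟨t, ht, hr⟩ := tabRound_run h4 h5 h6 (hidx x hxC) (hini x hxC) (hcj x hxC) (hb x hxC)
        (hg x hxC) (hB x hxC.le) (hgF x hxC) hC (hxC.trans hCx) (hF x hxC)
      obtain ⟨u, hu, hr'⟩ := ih (x + 1) (by omega)
      rw [Memory.write_fill] at hr
      refine ⟨_, ?_, .while_true ?_ hr hr'⟩
      · have := Expr.cost_le ((hB x hxC.le).regs ((Int.natAbs_natCast x).symm ▸ hxC.trans hCx) h0 h0)
          (.sub cx (.reg 4))
        rw [add_mul _ 1]
        omega
      · simp [Expr.val, hcx x hxC.le, Expr.reg, Memory.regs]; omega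
  obtain ⟨t, ht, hr⟩ := key Cx 0 (by simp)
  rw [Memory.fill_zero, Nat.cast_zero, hreg] at hr
  have r := Prog.Run.assign 4 (.const 0) (.const 0) ((σ.fill k off g Cx).regs Cx 0 0)
  rw [Expr.val, Memory.write_regs_four] at r
  have e : (σ.fill k off g Cx).regs 0 0 0 = σ.fill k off g Cx := by
    funext k' i
    have := congr_fun (congr_fun hreg k') i
    unfold Memory.fill Memory.regs at *
    by_cases hk : k' = k
    · subst hk; simp [h4, h5, h6]
    · simp only [hk, false_and, if_false]
      exact this
  rw [e] at r
  refine ⟨_, ?_, .seq hr r⟩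
  have c0 : ∀ τ, (Expr.const 0).cost τ = 2 := fun τ => by simp [Expr.cost, bitLen]
  simp only [c0]
  omega

/-! ### Polynomial running time of table filling -/

section Tables

variable {ι : Type} {D : Set ι} {sz : ι → ℕ}

theorem MemBdd.fill {A : ι → Memory} (hA : MemBdd D sz A) (k : ℕ) (off : ι → ℤ) {C : ι → ℕ}
    {g : ι → ℕ → ℤ}
    (hg : LogBdd {p : ι × ℕ | p.1 ∈ D ∧ p.2 < C p.1} (fun p => sz p.1) fun p => g p.1 p.2) :
    MemBdd D sz fun d => (A d).fill k (off d) (g d) (C d) := by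
  obtain ⟨S, hS⟩ := hA
  obtain ⟨T, hT⟩ := hg
  refine ⟨S + T, fun d hd k' i' => ?_⟩
  rw [Polynomial.eval_add]
  simp only [Memory.fill]
  split_ifs with h
  · exact (hT (d, (i' - off d).toNat) ⟨hd, by dsimp only; omega⟩).trans_le
      (Nat.pow_le_pow_right two_pos (by dsimp only; omega))
  · exact (hS d hd _ _).trans_le (Nat.pow_le_pow_right two_pos (by omega))

/-- Partial sums need no size hypothesis, since `Expr.bits` bounds `init` and `body` in terms of the
cells they read. The entries of the table do need one, `hgB`: a recurrence reading its own table
could otherwise multiply the number of bits in every round. -/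
theorem PolyRun.tabulate {A : ι → Memory} (hA : MemBdd D sz A) {k : ℕ}
    (hk : k ≠ 4 ∧ k ≠ 5 ∧ k ≠ 6)
    (hreg : ∀ d ∈ D, (A d).regs 0 0 0 = A d)
    {idx cx cj init body : Expr} {Cx C : ι → ℕ} {off : ι → ℤ} {g ini : ι → ℕ → ℤ}
    {b : ι → ℕ → ℕ → ℤ}
    (hCx : SizeBdd D sz Cx) (hC : SizeBdd D sz C)
    (hcx : ∀ d ∈ D, ∀ x ≤ Cx d, cx.val (((A d).fill k (off d) (g d) x).regs x 0 0) = Cx d)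
    (hidx : ∀ d ∈ D, ∀ x < Cx d, ∀ acc : ℤ,
      idx.val (((A d).fill k (off d) (g d) x).regs x 0 acc) = off d + x)
    (hini : ∀ d ∈ D, ∀ x < Cx d, init.val (((A d).fill k (off d) (g d) x).regs x 0 0) = ini d x)
    (hcj : ∀ d ∈ D, ∀ x < Cx d, ∀ j acc : ℤ,
      cj.val (((A d).fill k (off d) (g d) x).regs x j acc) = C d)
    (hb : ∀ d ∈ D, ∀ x < Cx d, ∀ j < C d, ∀ acc : ℤ,
      body.val (((A d).fill k (off d) (g d) x).regs x j acc) = b d x j)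
    (hg : ∀ d ∈ D, ∀ x < Cx d, g d x = ini d x + ∑ j ∈ Finset.range (C d), b d x j)
    (hgB : LogBdd {p : ι × ℕ | p.1 ∈ D ∧ p.2 < Cx p.1} (fun p => sz p.1) fun p => g p.1 p.2) :
    PolyRun D sz A (tabulate k idx cx cj init body)
      fun d => (A d).fill k (off d) (g d) (Cx d) := by
  obtain ⟨S, hS⟩ := hA
  obtain ⟨T, hT⟩ := hgB
  obtain ⟨U, hU⟩ := hCx
  obtain ⟨V, hV⟩ := hC
  set F₀ : Polynomial ℕ := S + T + U + V with hF₀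
  -- F₀ bounds the cells and the counters. Accumulators are larger: a sum of fewer than 2 ^ V
  -- summands costs V extra bits.
  set F : Polynomial ℕ := F₀ + init.bits.comp F₀ + V + body.bits.comp F₀ + 1 with hF
  set P : Polynomial ℕ := 20 + (U + 1) * (2 + (Expr.sub cx (.reg 4)).costBound.comp F +
    (40 + init.costBound.comp F + (V + 1) * (20 + (Expr.sub cj (.reg 5)).costBound.comp F +
        (Expr.add (.reg 6) body).costBound.comp F +
        (Expr.add (.reg 5) (.const 1)).costBound.comp F) + idx.costBound.comp F +
    (Expr.reg 6).costBound.comp F + (Expr.add (.reg 4) (.const 1)).costBound.comp F)) with hP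
  refine ⟨P, fun d hd => ?_⟩
  have pw : ∀ {a c : ℕ}, a ≤ c → 2 ^ a ≤ 2 ^ c := fun h => Nat.pow_le_pow_right two_pos h
  have e₀ : F₀.eval (sz d) = S.eval (sz d) + T.eval (sz d) + U.eval (sz d) + V.eval (sz d) := by
    simp [hF₀]
  have e : F.eval (sz d) = F₀.eval (sz d) + init.bits.eval (F₀.eval (sz d)) + V.eval (sz d) +
    body.bits.eval (F₀.eval (sz d)) + 1 := by simp [hF, Polynomial.eval_comp]
  have hgF : ∀ x < Cx d, (g d x).natAbs < 2 ^ F₀.eval (sz d) := fun x hx =>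
    (hT (d, x) ⟨hd, hx⟩).trans_le (pw (by dsimp only; omega))
  have hCF : C d < 2 ^ F₀.eval (sz d) :=
    (hV d hd).trans_lt (Nat.lt_two_pow_self.trans_le (pw (by omega)))
  have hCxF : Cx d < 2 ^ F₀.eval (sz d) :=
    (hU d hd).trans_lt (Nat.lt_two_pow_self.trans_le (pw (by omega)))
  have hσ : (A d).Below (F₀.eval (sz d)) := (hS d hd).mono (by omega)
  have hfill : ∀ x ≤ Cx d, ((A d).fill k (off d) (g d) x).Below (F₀.eval (sz d)) := by
    intro x hx k' i
    unfold Memory.fill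
    split_ifs with h
    · exact hgF _ (by omega)
    · exact hσ _ _
  have h0 : (0 : ℤ).natAbs < 2 ^ F₀.eval (sz d) := by simp
  have h01 : F₀.eval (sz d) ≤ F.eval (sz d) := by omega
  have hacc : ∀ x < Cx d, ∀ j ≤ C d,
      (ini d x + ∑ l ∈ Finset.range j, b d x l).natAbs < 2 ^ F.eval (sz d) := by
    intro x hx j hj
    have hxF : (x : ℤ).natAbs < 2 ^ F₀.eval (sz d) := by simpa using hx.trans hCxF
    have b1 := Expr.natAbs_val_lt ((hfill x hx.le).regs hxF h0 h0) init
    rw [hini d hd x hx] at b1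
    have b2 : (∑ l ∈ Finset.range j, b d x l).natAbs <
        2 ^ (V.eval (sz d) + body.bits.eval (F₀.eval (sz d))) := by
      rw [pow_add]
      calc _ ≤ j * 2 ^ body.bits.eval (F₀.eval (sz d)) := by
            refine natAbs_sum_range_le _ fun l hl => ?_
            have hlF : (l : ℤ).natAbs < 2 ^ F₀.eval (sz d) := by
              simpa using (hl.trans_le hj).trans hCF
            have := Expr.natAbs_val_lt ((hfill x hx.le).regs hxF hlF h0) body
            rw [hb d hd x hx l (hl.trans_le hj)] at this
            exact this.le
        _ < _ := Nat.mul_lt_mul_of_pos_right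
          ((hj.trans (hV d hd)).trans_lt Nat.lt_two_pow_self) (by positivity)
    exact (natAbs_add_lt b1 b2).trans_le (pw (by omega))
  obtain ⟨t, ht, hr⟩ := tabulate_run (F := F.eval (sz d)) hk.1 hk.2.1 hk.2.2 (hreg d hd)
    (hcx d hd) (hidx d hd) (hini d hd) (hcj d hd) (hb d hd) (hg d hd) (hσ.mono h01)
    (fun x hx => (hgF x hx).trans_le (pw h01)) (hCF.trans_le (pw h01)) (hCxF.trans_le (pw h01)) hacc
  refine ⟨t, ht.trans ?_, hr⟩
  simp only [hP, Polynomial.eval_add, Polynomial.eval_mul, Polynomial.eval_comp,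
    Polynomial.eval_ofNat, Polynomial.eval_one, roundBound]
  gcongr
  · exact hU d hd
  · exact hV d hd

end Tables

/-! ### Reading memory -/

@[simp] theorem arrayOfList_natCast (l : List ℤ) (i : ℕ) : arrayOfList l (i : ℤ) = l.getD i 0 := by
  simp [arrayOfList]

@[simp] theorem Expr.val_const (σ : Memory) (z : ℤ) : (Expr.const z).val σ = z := rfl
@[simp] theorem Expr.val_cell (σ : Memory) (k : ℕ) (e : Expr) :
    (Expr.cell k e).val σ = σ k (e.val σ) := rfl
@[simp] theorem Expr.val_reg (σ : Memory) (k : ℕ) : (Expr.reg k).val σ = σ k 0 := rfl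
@[simp] theorem Expr.val_add (σ : Memory) (e f : Expr) :
    (Expr.add e f).val σ = e.val σ + f.val σ := rfl
@[simp] theorem Expr.val_sub (σ : Memory) (e f : Expr) :
    (Expr.sub e f).val σ = e.val σ - f.val σ := rfl
@[simp] theorem Expr.val_mul (σ : Memory) (e f : Expr) :
    (Expr.mul e f).val σ = e.val σ * f.val σ := rfl
@[simp] theorem Expr.val_div (σ : Memory) (e f : Expr) :
    (Expr.div e f).val σ = e.val σ / f.val σ := rfl

/-- The remainder of an integer division. -/
def Expr.mod (e f : Expr) : Expr := .sub e (.mul f (.div e f))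

@[simp] theorem Expr.val_mod (σ : Memory) (e f : Expr) :
    (Expr.mod e f).val σ = e.val σ % f.val σ := by
  rw [Int.emod_def]; rfl

theorem Memory.regs_ne (σ : Memory) (x j acc : ℤ) {k : ℕ} (hk : k ≠ 4 ∧ k ≠ 5 ∧ k ≠ 6) :
    σ.regs x j acc k = σ k := by
  simp [Memory.regs, hk]

@[simp] theorem Memory.regs_four (σ : Memory) (x j acc : ℤ) : σ.regs x j acc 4 0 = x := rfl
@[simp] theorem Memory.regs_five (σ : Memory) (x j acc : ℤ) : σ.regs x j acc 5 0 = j := rfl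

theorem Memory.fill_ne (σ : Memory) {k k' : ℕ} (h : k' ≠ k) (off : ℤ) (g : ℕ → ℤ) (x : ℕ) :
    σ.fill k off g x k' = σ k' := by
  funext i; simp [Memory.fill, h]

theorem Memory.fill_add (σ : Memory) (k : ℕ) (off : ℤ) (g : ℕ → ℤ) {i x : ℕ} (h : i < x) :
    σ.fill k off g x k (off + i) = g i := by
  have : k = k ∧ off ≤ off + (i : ℤ) ∧ off + (i : ℤ) < off + x := by omega
  exact (if_pos this).trans (by simp)

theorem Memory.fill_cast (σ : Memory) (k : ℕ) (g : ℕ → ℤ) {i x : ℕ} (h : i < x) :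
    σ.fill k 0 g x k i = g i := by
  simpa using σ.fill_add k 0 g h

theorem Memory.fill_of_lt (σ : Memory) (k : ℕ) (off : ℤ) (g : ℕ → ℤ) {i : ℤ} (x : ℕ)
    (h : i < off) : σ.fill k off g x k i = σ k i := by
  have : ¬ (k = k ∧ off ≤ i ∧ i < off + x) := by omega
  exact if_neg this

theorem Memory.write_ne (σ : Memory) {k k' : ℕ} (h : k' ≠ k) (i z : ℤ) :
    σ.write k i z k' = σ k' := by
  funext i'; simp [Memory.write, h]

@[simp] theorem Memory.write_same (σ : Memory) (k : ℕ) (i z : ℤ) : σ.write k i z k i = z := by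
  simp [Memory.write]

theorem Memory.write_same_ne (σ : Memory) (k : ℕ) {i i' : ℤ} (h : i' ≠ i) (z : ℤ) :
    σ.write k i z k i' = σ k i' := by
  simp [Memory.write, h]

theorem Memory.regs_write {σ : Memory} (h : σ.regs 0 0 0 = σ) {k : ℕ}
    (hk : k ≠ 4 ∧ k ≠ 5 ∧ k ≠ 6) (i z : ℤ) : (σ.write k i z).regs 0 0 0 = σ.write k i z := by
  rw [← Memory.write_regs _ hk.1 hk.2.1 hk.2.2, h]

theorem Memory.regs_fill {σ : Memory} (h : σ.regs 0 0 0 = σ) {k : ℕ}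
    (hk : k ≠ 4 ∧ k ≠ 5 ∧ k ≠ 6) (off : ℤ) (g : ℕ → ℤ) (x : ℕ) :
    (σ.fill k off g x).regs 0 0 0 = σ.fill k off g x := by
  induction x with
  | zero => simpa [Memory.fill_zero] using h
  | succ x ih => rw [← Memory.write_fill]; exact Memory.regs_write ih hk _ _

/-! ### The quantities computed by the reduction -/

namespace Spp

/-- The dimension, read off from the input words `a, n, den, num, B`. -/
def dim (x : List ℤ) : ℕ := (x.getD 1 0).toNat

/-- The entries of the matrix, row by row. -/
def entry (x : List ℤ) (i : ℕ) : ℤ := x.getD (4 + i) 0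

/-- An upper bound for the integers in the input. -/
def size (x : List ℤ) : ℤ :=
  512 + dim x + x.getD 0 0 + x.getD 3 0 + ∑ i ∈ Finset.range (dim x * dim x), entry x i * entry x i

/-- Half the factor by which the lattice is scaled before it is perturbed. -/
def half (x : List ℤ) : ℤ := size x ^ (8 * dim x)

/-- The entries of the identity matrix, row by row. -/
def delta (n i : ℕ) : ℤ := if i / n = i % n then 1 else 0

/-- The matrix of the query. -/
def queryEntry (x : List ℤ) (i : ℕ) : ℤ := 4 * half x * entry x i + 2 * delta (dim x) i

/-- The shift of the query. -/
def queryShift (x b : List ℤ) (i : ℕ) : ℤ :=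
  b.getD i 0 + ∑ j ∈ Finset.range (dim x), 2 * half x * entry x (i * dim x + j) * b.getD j 0

/-- The query. -/
def query (x b : List ℤ) : List ℤ :=
  [(dim x : ℤ), 4 * half x * x.getD 2 0, 8 * half x * x.getD 3 0 * x.getD 0 0] ++
    (List.range (dim x * dim x)).map (queryEntry x) ++ (List.range (dim x)).map (queryShift x b)

/-- The higher digits of the answer. -/
def high (x y : List ℤ) (i : ℕ) : ℤ := (y.getD i 0 + half x) / (2 * half x)

/-- The lower digits of the answer. -/
def low (x y : List ℤ) (i : ℕ) : ℤ := y.getD i 0 - 2 * half x * high x y i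

/-- The deviation of the higher digits from the image of the lower digits. -/
def defect (x y : List ℤ) (i : ℕ) : ℤ :=
  - high x y i + ∑ j ∈ Finset.range (dim x),
    entry x (i % dim x * dim x + j) * low x y (i / dim x * dim x + j)

/-- The sum of the squares of all deviations. -/
def bad (x b y : List ℤ) : ℤ :=
  ∑ i ∈ Finset.range (dim x * dim x), (defect x y i * defect x y i +
    (low x y i - b.getD (i % dim x) 0) % 2 * ((low x y i - b.getD (i % dim x) 0) % 2))

/-- The Gram matrix of the higher digits. -/
def gram (x y : List ℤ) (i : ℕ) : ℤ :=
  ∑ r ∈ Finset.range (dim x), high x y (r * dim x + i / dim x) * high x y (r * dim x + i % dim x)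

/-- Powers of a matrix. -/
def matPow (n : ℕ) (S : ℕ → ℤ) : ℕ → ℕ → ℕ → ℤ
  | 0, i, j => if i = j then 1 else 0
  | k + 1, i, j => ∑ l ∈ Finset.range n, matPow n S k i l * S (l * n + j)

/-- The trace of a power of the Gram matrix. -/
def tracePow (x y : List ℤ) : ℤ :=
  ∑ i ∈ Finset.range (dim x), matPow (dim x) (gram x y) (dim x) i i

/-- The threshold for the eigenvalues of the Gram matrix. -/
def bound (x : List ℤ) : ℤ :=
  10000 * dim x * (x.getD 0 0 * x.getD 0 0) * (x.getD 3 0 * x.getD 3 0)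

/-- The decision. -/
def accepts (x b y : List ℤ) : Bool :=
  decide (bad x b y ≤ 0 ∧ tracePow x y ≤ bound x ^ dim x)

/-- The diagonal positions of an n × n matrix listed by rows are the multiples of n + 1. So the
identity matrix can be written by one division, without branching. -/
theorem delta_eq {n i : ℕ} (hi : i < n * n) :
    (1 : ℤ) / (1 + (i : ℤ) % ((n : ℤ) + 1)) = delta n i := by
  have hn : 0 < n := Nat.pos_of_ne_zero (by rintro rfl; simp at hi)
  have hq : i / n < n := Nat.div_lt_of_lt_mul hi
  have hr : i % n < n := Nat.mod_lt _ hn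
  have hi' : n * (i / n) + i % n = i := Nat.div_add_mod i n
  have key : ∃ m : ℕ, i % (n + 1) = m ∧ (m = 0 ↔ i / n = i % n) := by
    refine ⟨_, rfl, ?_⟩
    generalize i / n = q at *
    generalize i % n = r at *
    -- Modulo n + 1 the index nq + r is congruent to r - q, and |r - q| < n.
    rcases le_or_gt q r with h | h
    · have : i = (r - q) + (n + 1) * q := by
        rw [add_one_mul]; omega
      rw [this, Nat.add_mul_mod_self_left, Nat.mod_eq_of_lt (by omega)]
      omega
    · obtain ⟨p, hp⟩ : ∃ p, q = p + 1 := ⟨q - 1, by omega⟩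
      have : i = (n - p + r) + (n + 1) * p := by
        rw [← hi', hp]
        have : p ≤ n := by omega
        zify [this]; ring
      rw [this, Nat.add_mul_mod_self_left, Nat.mod_eq_of_lt (by omega)]
      omega
  obtain ⟨m, hm, hm'⟩ := key
  have : (i : ℤ) % ((n : ℤ) + 1) = m := by exact_mod_cast hm
  rw [this, delta]
  split_ifs with h
  · rw [hm'.2 h]; norm_num
  · have : m ≠ 0 := fun h' => h (hm'.1 h')
    exact Int.ediv_eq_zero_of_lt (by norm_num) (by omega)

/-! ### Sizes -/

/-- The inputs of the programs: the words of a lattice problem, coins, and an answer. -/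
abbrev Data : Type := List ℤ × List ℤ × List ℤ

/-- The total size of the inputs. -/
def dataSize (d : Data) : ℕ := bitSize d.1 + bitSize d.2.1 + bitSize d.2.2

/-- The inputs that start with the words of a lattice problem. -/
def domain : Set Data := {d | ∃ (a : ℕ) (I : LatticeInput), 1 ≤ a ∧ d.1 = paramWords a I}

theorem length_flatten_ofFn {n m : ℕ} (f : Fin n → Fin m → ℤ) :
    (List.ofFn fun i => List.ofFn fun j => f i j).flatten.length = n * m := by
  simp [List.length_flatten, List.map_ofFn, Function.comp_def]

theorem length_le_bitSize (l : List ℤ) : l.length ≤ bitSize l := by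
  induction l with
  | nil => simp
  | cons a l ih =>
    simp only [bitSize, List.map_cons, List.sum_cons, List.length_cons, bitLen] at *
    omega

theorem getD_lt_two_pow_bitSize (l : List ℤ) (i : ℕ) : (l.getD i 0).natAbs < 2 ^ bitSize l := by
  induction l generalizing i with
  | nil => simp
  | cons a l ih =>
    have h : bitSize (a :: l) = bitLen a + bitSize l := by simp [bitSize]
    rw [h]
    cases i with
    | zero =>
      exact (natAbs_lt_two_pow_bitLen a).trans_le (Nat.pow_le_pow_right two_pos (by omega))
    | succ i =>
      simp only [List.getD_cons_succ]
      exact (ih i).trans_le (Nat.pow_le_pow_right two_pos (by omega))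

theorem dim_paramWords (a : ℕ) (I : LatticeInput) : dim (paramWords a I) = I.n := by
  simp [dim, paramWords, LatticeInput.words]

theorem length_paramWords (a : ℕ) (I : LatticeInput) :
    (paramWords a I).length = 4 + I.n * I.n := by
  have := length_flatten_ofFn fun i j => I.basis i j
  simp only [paramWords, LatticeInput.words, List.length_cons, List.length_append,
    List.length_nil]
  omega

/-- The dimension is written in binary, but all n² entries are listed and each costs at least one
bit. Hence loops of length polynomial in n are affordable. -/
theorem dim_sq_le {d : Data} (hd : d ∈ domain) : dim d.1 * dim d.1 ≤ dataSize d := by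
  obtain ⟨a, I, -, h⟩ := hd
  have := length_le_bitSize d.1
  rw [h, length_paramWords, ← dim_paramWords a, ← h] at this
  unfold dataSize; omega

theorem dim_pos {d : Data} (hd : d ∈ domain) : 0 < dim d.1 := by
  obtain ⟨a, I, -, h⟩ := hd
  rw [h, dim_paramWords]; exact I.n_pos

theorem getD_one {d : Data} (hd : d ∈ domain) : d.1.getD 1 0 = dim d.1 := by
  obtain ⟨a, I, -, h⟩ := hd
  rw [h, dim_paramWords]; simp [paramWords, LatticeInput.words]

theorem sizeBdd_dim : SizeBdd domain dataSize fun d => dim d.1 :=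
  ⟨.X, fun d hd => by
    simpa using (Nat.le_mul_of_pos_left _ (dim_pos hd)).trans (dim_sq_le hd)⟩

section

variable {κ : Type} {E : Set κ} {sz' : κ → ℕ} {φ : κ → Data}

/-- The map φ forgets auxiliary indices, such as the position in a table; bounds in this form remain
available under a sum or inside a table. -/
theorem logBdd_fst (hE : ∀ p ∈ E, φ p ∈ domain ∧ sz' p = dataSize (φ p)) (i : κ → ℕ) :
    LogBdd E sz' fun p => (φ p).1.getD (i p) 0 :=
  ⟨.X, fun p hp => (getD_lt_two_pow_bitSize _ _).trans_le (Nat.pow_le_pow_right two_pos (by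
    rw [(hE p hp).2]; simp [dataSize]; omega))⟩

theorem logBdd_snd (hE : ∀ p ∈ E, φ p ∈ domain ∧ sz' p = dataSize (φ p)) (i : κ → ℕ) :
    LogBdd E sz' fun p => (φ p).2.1.getD (i p) 0 :=
  ⟨.X, fun p hp => (getD_lt_two_pow_bitSize _ _).trans_le (Nat.pow_le_pow_right two_pos (by
    rw [(hE p hp).2]; simp [dataSize]; omega))⟩

theorem logBdd_trd (hE : ∀ p ∈ E, φ p ∈ domain ∧ sz' p = dataSize (φ p)) (i : κ → ℕ) :
    LogBdd E sz' fun p => (φ p).2.2.getD (i p) 0 :=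
  ⟨.X, fun p hp => (getD_lt_two_pow_bitSize _ _).trans_le (Nat.pow_le_pow_right two_pos (by
    rw [(hE p hp).2]; simp [dataSize]))⟩

theorem logBdd_entry (hE : ∀ p ∈ E, φ p ∈ domain ∧ sz' p = dataSize (φ p)) (i : κ → ℕ) :
    LogBdd E sz' fun p => entry (φ p).1 (i p) := logBdd_fst hE _

theorem sizeBdd_dim' (hE : ∀ p ∈ E, φ p ∈ domain ∧ sz' p = dataSize (φ p)) :
    SizeBdd E sz' fun p => dim (φ p).1 := by
  obtain ⟨T, hT⟩ := sizeBdd_dim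
  exact ⟨T, fun p hp => (hE p hp).2 ▸ hT _ (hE p hp).1⟩

theorem logBdd_size (hE : ∀ p ∈ E, φ p ∈ domain ∧ sz' p = dataSize (φ p)) :
    LogBdd E sz' fun p => size (φ p).1 := by
  refine ((((LogBdd.const 512).add (.of_size (sizeBdd_dim' hE))).add (logBdd_fst hE _)).add
    (logBdd_fst hE _)).add (.sum ((sizeBdd_dim' hE).mul (sizeBdd_dim' hE)) ?_)
  have hE' : ∀ p ∈ {p : κ × ℕ | p.1 ∈ E ∧ p.2 < dim (φ p.1).1 * dim (φ p.1).1},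
      φ p.1 ∈ domain ∧ sz' p.1 = dataSize (φ p.1) := fun p hp => hE _ hp.1
  exact (logBdd_entry hE' _).mul (logBdd_entry hE' _)

theorem logBdd_half (hE : ∀ p ∈ E, φ p ∈ domain ∧ sz' p = dataSize (φ p)) :
    LogBdd E sz' fun p => half (φ p).1 :=
  (logBdd_size hE).pow ((SizeBdd.const 8).mul (sizeBdd_dim' hE))

theorem logBdd_delta (n i : κ → ℕ) : LogBdd E sz' fun p => delta (n p) (i p) :=
  ⟨1, fun p _ => by simp only [delta]; split_ifs <;> simp⟩

theorem logBdd_queryEntry (hE : ∀ p ∈ E, φ p ∈ domain ∧ sz' p = dataSize (φ p)) (i : κ → ℕ) :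
    LogBdd E sz' fun p => queryEntry (φ p).1 (i p) :=
  (((LogBdd.const 4).mul (logBdd_half hE)).mul (logBdd_entry hE _)).add
    ((LogBdd.const 2).mul (logBdd_delta _ _))

theorem logBdd_queryShift (hE : ∀ p ∈ E, φ p ∈ domain ∧ sz' p = dataSize (φ p)) (i : κ → ℕ) :
    LogBdd E sz' fun p => queryShift (φ p).1 (φ p).2.1 (i p) := by
  refine (logBdd_snd hE _).add (.sum (sizeBdd_dim' hE) ?_)
  have hE' : ∀ p ∈ {p : κ × ℕ | p.1 ∈ E ∧ p.2 < dim (φ p.1).1},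
      φ p.1 ∈ domain ∧ sz' p.1 = dataSize (φ p.1) := fun p hp => hE _ hp.1
  exact (((LogBdd.const 2).mul (logBdd_half hE')).mul (logBdd_entry hE' _)).mul (logBdd_snd hE' _)

theorem logBdd_high (hE : ∀ p ∈ E, φ p ∈ domain ∧ sz' p = dataSize (φ p)) (i : κ → ℕ) :
    LogBdd E sz' fun p => high (φ p).1 (φ p).2.2 (i p) :=
  ((logBdd_trd hE _).add (logBdd_half hE)).div _

theorem logBdd_low (hE : ∀ p ∈ E, φ p ∈ domain ∧ sz' p = dataSize (φ p)) (i : κ → ℕ) :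
    LogBdd E sz' fun p => low (φ p).1 (φ p).2.2 (i p) :=
  (logBdd_trd hE _).sub (((LogBdd.const 2).mul (logBdd_half hE)).mul (logBdd_high hE _))

theorem logBdd_defect (hE : ∀ p ∈ E, φ p ∈ domain ∧ sz' p = dataSize (φ p)) (i : κ → ℕ) :
    LogBdd E sz' fun p => defect (φ p).1 (φ p).2.2 (i p) := by
  refine (((LogBdd.const 0).sub (logBdd_high hE i)).congr fun p _ => by simp).add
    (.sum (sizeBdd_dim' hE) ?_)
  have hE' : ∀ p ∈ {p : κ × ℕ | p.1 ∈ E ∧ p.2 < dim (φ p.1).1},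
      φ p.1 ∈ domain ∧ sz' p.1 = dataSize (φ p.1) := fun p hp => hE _ hp.1
  exact (logBdd_entry hE' _).mul (logBdd_low hE' _)

theorem logBdd_bad (hE : ∀ p ∈ E, φ p ∈ domain ∧ sz' p = dataSize (φ p)) :
    LogBdd E sz' fun p => bad (φ p).1 (φ p).2.1 (φ p).2.2 := by
  refine .sum ((sizeBdd_dim' hE).mul (sizeBdd_dim' hE)) ?_
  have hE' : ∀ p ∈ {p : κ × ℕ | p.1 ∈ E ∧ p.2 < dim (φ p.1).1 * dim (φ p.1).1},
      φ p.1 ∈ domain ∧ sz' p.1 = dataSize (φ p.1) := fun p hp => hE _ hp.1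
  have h2 : LogBdd {p : κ × ℕ | p.1 ∈ E ∧ p.2 < dim (φ p.1).1 * dim (φ p.1).1}
      (fun p => sz' p.1) fun p => (low (φ p.1).1 (φ p.1).2.2 p.2 -
        (φ p.1).2.1.getD (p.2 % dim (φ p.1).1) 0) % 2 :=
    ⟨1, fun p _ => by simp only [Polynomial.eval_one]; omega⟩
  exact ((logBdd_defect hE' _).mul (logBdd_defect hE' _)).add (h2.mul h2)

theorem logBdd_gram (hE : ∀ p ∈ E, φ p ∈ domain ∧ sz' p = dataSize (φ p)) (i : κ → ℕ) :
    LogBdd E sz' fun p => gram (φ p).1 (φ p).2.2 (i p) := by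
  refine .sum (sizeBdd_dim' hE) ?_
  have hE' : ∀ p ∈ {p : κ × ℕ | p.1 ∈ E ∧ p.2 < dim (φ p.1).1},
      φ p.1 ∈ domain ∧ sz' p.1 = dataSize (φ p.1) := fun p hp => hE _ hp.1
  exact (logBdd_high hE' _).mul (logBdd_high hE' _)

theorem natAbs_matPow_le {n : ℕ} {S : ℕ → ℤ} {M : ℕ} (hS : ∀ i, (S i).natAbs ≤ M) (k i j : ℕ) :
    (matPow n S k i j).natAbs ≤ (n * M) ^ k := by
  induction k generalizing i j with
  | zero => unfold matPow; split_ifs <;> simp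
  | succ k ih =>
    rw [matPow, pow_succ]
    refine (natAbs_sum_range_le (M := (n * M) ^ k * M) _ fun l _ => ?_).trans (by nlinarith)
    rw [Int.natAbs_mul]
    exact Nat.mul_le_mul (ih _ _) (hS _)

theorem logBdd_matPow (hE : ∀ p ∈ E, φ p ∈ domain ∧ sz' p = dataSize (φ p)) {k : κ → ℕ}
    (hk : SizeBdd E sz' k) (i j : κ → ℕ) :
    LogBdd E sz' fun p => matPow (dim (φ p).1) (gram (φ p).1 (φ p).2.2) (k p) (i p) (j p) := by
  -- The second component is unrestricted, because the bound for powers of a matrix asks for a bound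
  -- on the Gram entries at every index.
  have hE' : ∀ p ∈ {p : κ × ℕ | p.1 ∈ E}, φ p.1 ∈ domain ∧ sz' p.1 = dataSize (φ p.1) :=
    fun p hp => hE _ hp
  obtain ⟨S, hS⟩ := logBdd_gram hE' (fun p => p.2)
  obtain ⟨T, hT⟩ := hk
  obtain ⟨U, hU⟩ := sizeBdd_dim' hE
  refine ⟨(U + S) * T + 1, fun p hp => ?_⟩
  have hM : ∀ i, (gram (φ p).1 (φ p).2.2 i).natAbs ≤ 2 ^ S.eval (sz' p) :=
    fun i => (hS (p, i) hp).le
  refine (natAbs_matPow_le hM _ _ _).trans_lt ?_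
  simp only [Polynomial.eval_add, Polynomial.eval_mul, Polynomial.eval_one]
  calc _ ≤ (2 ^ (U.eval (sz' p) + S.eval (sz' p))) ^ (k p) := by
        rw [pow_add]
        exact Nat.pow_le_pow_left (Nat.mul_le_mul_right _ ((hU p hp).trans
          Nat.lt_two_pow_self.le)) _
    _ ≤ (2 ^ (U.eval (sz' p) + S.eval (sz' p))) ^ T.eval (sz' p) :=
        Nat.pow_le_pow_right (by positivity) (hT p hp)
    _ < _ := by
      rw [← pow_mul]
      exact Nat.pow_lt_pow_right (by norm_num) (by omega)

theorem logBdd_tracePow (hE : ∀ p ∈ E, φ p ∈ domain ∧ sz' p = dataSize (φ p)) :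
    LogBdd E sz' fun p => tracePow (φ p).1 (φ p).2.2 := by
  refine .sum (sizeBdd_dim' hE) ?_
  have hE' : ∀ p ∈ {p : κ × ℕ | p.1 ∈ E ∧ p.2 < dim (φ p.1).1},
      φ p.1 ∈ domain ∧ sz' p.1 = dataSize (φ p.1) := fun p hp => hE _ hp.1
  exact logBdd_matPow hE' (sizeBdd_dim' hE') _ _

theorem logBdd_bound (hE : ∀ p ∈ E, φ p ∈ domain ∧ sz' p = dataSize (φ p)) :
    LogBdd E sz' fun p => bound (φ p).1 :=
  (((LogBdd.const 10000).mul (.of_size (sizeBdd_dim' hE))).mul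
    ((logBdd_fst hE _).mul (logBdd_fst hE _))).mul ((logBdd_fst hE _).mul (logBdd_fst hE _))

end

end Spp

namespace Spp

/-! ### The common part of the programs -/

/-- The initial memory. -/
def mem₀ (d : Data) : Memory := inputMemory [d.1, d.2.1, d.2.2]

/-- The memory after the dimension has been copied. -/
def mem₁ (d : Data) : Memory := (mem₀ d).write 3 0 (dim d.1)

/-- The memory after `size` has been computed. -/
def mem₂ (d : Data) : Memory := (mem₁ d).fill 7 0 (fun _ => size d.1) 1

/-- The memory after the table of powers has been started. -/
def mem₃ (d : Data) : Memory := (mem₂ d).write 8 0 1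

/-- The memory after the table of powers has been filled. -/
def mem₄ (d : Data) : Memory := (mem₃ d).fill 8 1 (fun x => size d.1 ^ (x + 1)) (8 * dim d.1)

/-- The memory after `half` has been computed. -/
def mem₅ (d : Data) : Memory := (mem₄ d).write 9 0 (half d.1)

/-- Matrix entries as expressions. -/
def entryExpr (i : Expr) : Expr := .cell 0 (.add (.const 4) i)

/-- The common part of the programs. -/
def setup : Prog :=
  .seq (.assign 3 (.const 0) (.cell 0 (.const 1)))
  (.seq (tabulate 7 (.const 0) (.const 1) (.mul (.reg 3) (.reg 3))
    (.add (.add (.add (.const 512) (.reg 3)) (.cell 0 (.const 0))) (.cell 0 (.const 3)))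
    (.mul (entryExpr (.reg 5)) (entryExpr (.reg 5))))
  (.seq (.assign 8 (.const 0) (.const 1))
  (.seq (tabulate 8 (.add (.const 1) (.reg 4)) (.mul (.const 8) (.reg 3)) (.const 0)
    (.mul (.cell 8 (.reg 4)) (.reg 7)) (.const 0))
  (.assign 9 (.const 0) (.cell 8 (.mul (.const 8) (.reg 3)))))))

theorem hE_self : ∀ p ∈ domain, id p ∈ domain ∧ dataSize p = dataSize (id p) :=
  fun _ hp => ⟨hp, rfl⟩

theorem hE_prod {Q : Data × ℕ → Prop} : ∀ p ∈ {p : Data × ℕ | p.1 ∈ domain ∧ Q p},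
    p.1 ∈ domain ∧ dataSize p.1 = dataSize p.1 := fun _ hp => ⟨hp.1, rfl⟩

theorem arrayOfList_getD_lt (l : List ℤ) (i : ℤ) : (arrayOfList l i).natAbs < 2 ^ bitSize l := by
  unfold arrayOfList
  split_ifs
  · exact getD_lt_two_pow_bitSize _ _
  · simpa using (length_le_bitSize l).trans_lt Nat.lt_two_pow_self
  · simp

theorem memBdd₀ : MemBdd domain dataSize mem₀ := by
  refine ⟨.X, fun d _ k i => ?_⟩
  rw [Polynomial.eval_X]
  have pw : ∀ {a c : ℕ}, a ≤ c → 2 ^ a ≤ 2 ^ c := fun h => Nat.pow_le_pow_right two_pos h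
  match k with
  | 0 => exact (arrayOfList_getD_lt _ _).trans_le (pw (by simp [dataSize]; omega))
  | 1 => exact (arrayOfList_getD_lt _ _).trans_le (pw (by simp [dataSize]; omega))
  | 2 => exact (arrayOfList_getD_lt _ _).trans_le (pw (by simp [dataSize]))
  | k + 3 => exact (arrayOfList_getD_lt _ _).trans_le (pw (by simp [bitSize]))

theorem regs₀ (d : Data) : (mem₀ d).regs 0 0 0 = mem₀ d := by
  funext k i
  have h : ∀ k, 3 ≤ k → mem₀ d k i = 0 := by
    intro k hk
    obtain ⟨m, rfl⟩ := Nat.exists_eq_add_of_le' hk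
    simp [mem₀, inputMemory, arrayOfList]
  by_cases hk : k = 4 ∨ k = 5 ∨ k = 6
  · rw [h k (by omega)]
    rcases hk with rfl | rfl | rfl <;> simp [Memory.regs, single]
  · rw [Memory.regs_ne _ _ _ _ (by omega)]

theorem regs₁ (d : Data) : (mem₁ d).regs 0 0 0 = mem₁ d := Memory.regs_write (regs₀ d) (by decide) _ _
theorem regs₂ (d : Data) : (mem₂ d).regs 0 0 0 = mem₂ d :=
  Memory.regs_fill (regs₁ d) (by decide) _ _ _
theorem regs₃ (d : Data) : (mem₃ d).regs 0 0 0 = mem₃ d := Memory.regs_write (regs₂ d) (by decide) _ _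
theorem regs₄ (d : Data) : (mem₄ d).regs 0 0 0 = mem₄ d :=
  Memory.regs_fill (regs₃ d) (by decide) _ _ _
theorem regs₅ (d : Data) : (mem₅ d).regs 0 0 0 = mem₅ d := Memory.regs_write (regs₄ d) (by decide) _ _

theorem mem₀_zero (d : Data) : mem₀ d 0 = arrayOfList d.1 := rfl
theorem mem₀_one (d : Data) : mem₀ d 1 = arrayOfList d.2.1 := rfl
theorem mem₀_two (d : Data) : mem₀ d 2 = arrayOfList d.2.2 := rfl

theorem mem₂_zero (d : Data) : mem₂ d 0 = arrayOfList d.1 := by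
  simp [mem₂, mem₁, Memory.fill_ne, Memory.write_ne, mem₀_zero]
theorem mem₂_three (d : Data) : mem₂ d 3 0 = dim d.1 := by
  simp [mem₂, mem₁, Memory.fill_ne]
theorem mem₂_seven (d : Data) : mem₂ d 7 0 = size d.1 :=
  (mem₁ d).fill_cast 7 (fun _ => size d.1) (i := 0) (x := 1) one_pos

theorem mem₅_zero (d : Data) : mem₅ d 0 = arrayOfList d.1 := by
  simp [mem₅, mem₄, mem₃, Memory.fill_ne, Memory.write_ne, mem₂_zero]
theorem mem₅_one (d : Data) : mem₅ d 1 = arrayOfList d.2.1 := by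
  simp [mem₅, mem₄, mem₃, mem₂, mem₁, Memory.fill_ne, Memory.write_ne, mem₀_one]
theorem mem₅_two (d : Data) : mem₅ d 2 = arrayOfList d.2.2 := by
  simp [mem₅, mem₄, mem₃, mem₂, mem₁, Memory.fill_ne, Memory.write_ne, mem₀_two]
theorem mem₅_three (d : Data) : mem₅ d 3 0 = dim d.1 := by
  simp [mem₅, mem₄, mem₃, Memory.fill_ne, Memory.write_ne, mem₂_three]
theorem mem₅_nine (d : Data) : mem₅ d 9 0 = half d.1 := by
  simp [mem₅]

theorem arrayOfList_of_eq (l : List ℤ) {i : ℤ} {m : ℕ} (h : i = m) :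
    arrayOfList l i = l.getD m 0 := by rw [h, arrayOfList_natCast]

theorem arrayOfList_entry (l : List ℤ) {i : ℤ} {m : ℕ} (h : i = m) :
    arrayOfList l (4 + i) = entry l m := by
  rw [h, entry]; exact arrayOfList_of_eq _ (by push_cast; ring)

theorem memBdd₁ : MemBdd domain dataSize mem₁ := memBdd₀.write 3 _ (.of_size sizeBdd_dim)
theorem memBdd₂ : MemBdd domain dataSize mem₂ := memBdd₁.fill 7 _ (logBdd_size hE_prod)
theorem memBdd₃ : MemBdd domain dataSize mem₃ := memBdd₂.write 8 _ (.const 1)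

theorem logBdd_powers : LogBdd {p : Data × ℕ | p.1 ∈ domain ∧ p.2 < 8 * dim p.1.1}
    (fun p => dataSize p.1) fun p => size p.1.1 ^ (p.2 + 1) := by
  refine (logBdd_size hE_prod).pow ?_
  obtain ⟨T, hT⟩ := sizeBdd_dim
  exact ⟨8 * T, fun p hp => by
    have : dim p.1.1 ≤ _ := hT _ hp.1
    have := hp.2
    simp only [Polynomial.eval_mul, Polynomial.eval_ofNat]; omega⟩

theorem memBdd₄ : MemBdd domain dataSize mem₄ := memBdd₃.fill 8 _ logBdd_powers
theorem memBdd₅ : MemBdd domain dataSize mem₅ := memBdd₄.write 9 _ (logBdd_half hE_self)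

theorem setup_run : PolyRun domain dataSize mem₀ setup mem₅ := by
  have s1 : PolyRun domain dataSize mem₀ (.assign 3 (.const 0) (.cell 0 (.const 1))) mem₁ :=
    .assign memBdd₀ (fun d _ => rfl) fun d hd => by
      rw [← getD_one hd]; exact arrayOfList_of_eq (m := 1) _ rfl
  have s3 : PolyRun domain dataSize mem₂ (.assign 8 (.const 0) (.const 1)) mem₃ :=
    .assign memBdd₂ (fun d _ => rfl) fun d _ => rfl
  have s5 : PolyRun domain dataSize mem₄ (.assign 9 (.const 0) (.cell 8 (.mul (.const 8) (.reg 3))))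
      mem₅ := by
    refine .assign memBdd₄ (fun d _ => rfl) fun d hd => ?_
    have h3 : mem₄ d 3 0 = dim d.1 := by
      simp [mem₄, mem₃, Memory.fill_ne, Memory.write_ne, mem₂_three]
    have hn := dim_pos hd
    have := (mem₃ d).fill_add 8 1 (fun x => size d.1 ^ (x + 1)) (i := 8 * dim d.1 - 1)
      (x := 8 * dim d.1) (by omega)
    simp only [Expr.val_cell, Expr.val_mul, Expr.val_const, Expr.val_reg, h3]
    rw [half, show 8 * dim d.1 = (8 * dim d.1 - 1) + 1 by omega, ← this, mem₄]
    congr 1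
    omega
  refine s1.seq (PolyRun.seq (B := mem₂) ?_ (s3.seq (PolyRun.seq (B := mem₄) ?_ s5)))
  -- A single sum is a table with one cell.
  · refine .tabulate
      (init := .add (.add (.add (.const 512) (.reg 3)) (.cell 0 (.const 0))) (.cell 0 (.const 3)))
      (body := .mul (entryExpr (.reg 5)) (entryExpr (.reg 5)))
      (ini := fun d _ => 512 + dim d.1 + d.1.getD 0 0 + d.1.getD 3 0)
      (b := fun d _ j => entry d.1 j * entry d.1 j) (C := fun d => dim d.1 * dim d.1)
      memBdd₁ (by decide) (fun d _ => regs₁ d) (.const 1) (sizeBdd_dim.mul sizeBdd_dim)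
      ?_ ?_ ?_ ?_ ?_ ?_ (logBdd_size hE_prod)
    · intros; simp
    · intros; simp; omega
    · intro d hd x hx
      have h0 : arrayOfList d.1 0 = d.1.getD 0 0 := arrayOfList_natCast _ 0
      have h3 : arrayOfList d.1 3 = d.1.getD 3 0 := arrayOfList_natCast _ 3
      simp [mem₁, Memory.regs_ne, Memory.fill_ne, Memory.write_ne, mem₀_zero, h0, h3]
    · intros; simp [mem₁, Memory.regs_ne, Memory.fill_ne]
    · intro d hd x hx j hj acc
      have := arrayOfList_entry d.1 (i := j) rfl
      simp [entryExpr, mem₁, Memory.regs_ne, Memory.fill_ne, Memory.write_ne, mem₀_zero, this]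
    · intros; rfl
  -- Cell x + 1 is cell x times `size`; the offset 1 leaves room for the zeroth power.
  · refine .tabulate
      (init := .mul (.cell 8 (.reg 4)) (.reg 7)) (body := .const 0)
      (ini := fun d x => size d.1 ^ (x + 1)) (b := fun d _ j => 0) (C := fun _ => 0)
      memBdd₃ (by decide) (fun d _ => regs₃ d) ((SizeBdd.const 8).mul sizeBdd_dim) (.const 0)
      ?_ ?_ ?_ ?_ ?_ ?_ logBdd_powers
    · intros; simp [mem₃, Memory.regs_ne, Memory.fill_ne, Memory.write_ne, mem₂_three]
    · intros; simp
    · intro d hd x hx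
      have h7 : (mem₃ d) 7 0 = size d.1 := by simp [mem₃, Memory.write_ne, mem₂_seven]
      have h8 : ((mem₃ d).fill 8 1 (fun x => size d.1 ^ (x + 1)) x) 8 x = size d.1 ^ x := by
        cases x with
        | zero => rw [Memory.fill_of_lt _ _ _ _ _ (by norm_num)]; simp [mem₃]
        | succ x =>
          have := (mem₃ d).fill_add 8 1 (fun x => size d.1 ^ (x + 1)) (Nat.lt_succ_self x)
          rw [← this]; congr 1; push_cast; ring
      simp only [Expr.val_mul, Expr.val_cell, Expr.val_reg, Memory.regs_four]
      rw [Memory.regs_ne _ _ _ _ (by decide), Memory.regs_ne _ _ _ _ (by decide), h8,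
        Memory.fill_ne _ (by decide), h7, pow_succ]
    · intros; simp
    · intros; simp
    · intros; simp

/-! ### The query -/

/-- The memory after the head of the query has been computed. -/
def qmem₁ (d : Data) : Memory := (((mem₅ d).write 12 0 (dim d.1)).write 12 1
  (4 * half d.1 * d.1.getD 2 0)).write 12 2 (8 * half d.1 * d.1.getD 3 0 * d.1.getD 0 0)

/-- The memory after the matrix of the query has been computed. -/
def qmem₂ (d : Data) : Memory := (qmem₁ d).fill 12 3 (queryEntry d.1) (dim d.1 * dim d.1)

/-- The memory after the shift of the query has been computed. -/
def qmem₃ (d : Data) : Memory :=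
  (qmem₂ d).fill 12 (3 + dim d.1 * dim d.1) (queryShift d.1 d.2.1) (dim d.1)

/-- The memory after the query has been copied. -/
def qmem₄ (d : Data) : Memory :=
  (qmem₃ d).fill 0 0 (fun x => qmem₃ d 12 x) (5 * (dim d.1 * dim d.1))

/-- The final memory of the query program. -/
def qmem₅ (d : Data) : Memory := (qmem₄ d).write 0 (-1) (3 + dim d.1 * dim d.1 + dim d.1)

/-- The program that computes the query. -/
def queryProg : Prog :=
  .seq setup
  (.seq (.assign 12 (.const 0) (.reg 3))
  (.seq (.assign 12 (.const 1) (.mul (.mul (.const 4) (.reg 9)) (.cell 0 (.const 2))))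
  (.seq (.assign 12 (.const 2)
    (.mul (.mul (.mul (.const 8) (.reg 9)) (.cell 0 (.const 3))) (.cell 0 (.const 0))))
  (.seq (tabulate 12 (.add (.const 3) (.reg 4)) (.mul (.reg 3) (.reg 3)) (.const 0)
    (.add (.mul (.mul (.const 4) (.reg 9)) (entryExpr (.reg 4))) (.mul (.const 2) (.div (.const 1)
      (.add (.const 1) (.mod (.reg 4) (.add (.reg 3) (.const 1))))))) (.const 0))
  (.seq (tabulate 12 (.add (.add (.const 3) (.mul (.reg 3) (.reg 3))) (.reg 4)) (.reg 3) (.reg 3)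
    (.cell 1 (.reg 4)) (.mul (.mul (.mul (.const 2) (.reg 9))
      (entryExpr (.add (.mul (.reg 4) (.reg 3)) (.reg 5)))) (.cell 1 (.reg 5))))
  (.seq (tabulate 0 (.reg 4) (.mul (.const 5) (.mul (.reg 3) (.reg 3))) (.const 0)
    (.cell 12 (.reg 4)) (.const 0))
  (.assign 0 (.const (-1)) (.add (.add (.const 3) (.mul (.reg 3) (.reg 3))) (.reg 3)))))))))

theorem memBdd_q₁ : MemBdd domain dataSize qmem₁ :=
  ((memBdd₅.write 12 (fun _ => 0) (.of_size sizeBdd_dim)).write 12 (fun _ => 1)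
    (((LogBdd.const 4).mul (logBdd_half hE_self)).mul (logBdd_fst hE_self _))).write 12
    (fun _ => 2) ((((LogBdd.const 8).mul (logBdd_half hE_self)).mul (logBdd_fst hE_self _)).mul
      (logBdd_fst hE_self _))
theorem memBdd_q₂ : MemBdd domain dataSize qmem₂ :=
  memBdd_q₁.fill 12 _ (logBdd_queryEntry hE_prod _)
theorem memBdd_q₃ : MemBdd domain dataSize qmem₃ :=
  memBdd_q₂.fill 12 _ (logBdd_queryShift hE_prod _)
theorem memBdd_q₄ : MemBdd domain dataSize qmem₄ :=
  memBdd_q₃.fill 0 _ (memBdd_q₃.cell _ hE_prod (fun _ => 12) fun p => (p.2 : ℤ))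
theorem memBdd_q₅ : MemBdd domain dataSize qmem₅ :=
  memBdd_q₄.write 0 _ (((LogBdd.const 3).add
    (.mul (.of_size sizeBdd_dim) (.of_size sizeBdd_dim))).add (.of_size sizeBdd_dim))

theorem regs_q₁ (d : Data) : (qmem₁ d).regs 0 0 0 = qmem₁ d :=
  Memory.regs_write (Memory.regs_write (Memory.regs_write (regs₅ d) (by decide) _ _)
    (by decide) _ _) (by decide) _ _
theorem regs_q₂ (d : Data) : (qmem₂ d).regs 0 0 0 = qmem₂ d :=
  Memory.regs_fill (regs_q₁ d) (by decide) _ _ _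
theorem regs_q₃ (d : Data) : (qmem₃ d).regs 0 0 0 = qmem₃ d :=
  Memory.regs_fill (regs_q₂ d) (by decide) _ _ _

theorem qmem₁_ne (d : Data) {k : ℕ} (h : k ≠ 12) : qmem₁ d k = mem₅ d k := by
  simp [qmem₁, Memory.write_ne, h]
theorem qmem₂_ne (d : Data) {k : ℕ} (h : k ≠ 12) : qmem₂ d k = mem₅ d k := by
  rw [qmem₂, Memory.fill_ne _ h, qmem₁_ne d h]
theorem qmem₃_ne (d : Data) {k : ℕ} (h : k ≠ 12) : qmem₃ d k = mem₅ d k := by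
  rw [qmem₃, Memory.fill_ne _ h, qmem₂_ne d h]

theorem queryProg_run : PolyRun domain dataSize mem₀ queryProg qmem₅ := by
  have h0 : ∀ d : Data, arrayOfList d.1 0 = d.1.getD 0 0 := fun d => arrayOfList_natCast _ 0
  have h2 : ∀ d : Data, arrayOfList d.1 2 = d.1.getD 2 0 := fun d => arrayOfList_natCast _ 2
  have h3 : ∀ d : Data, arrayOfList d.1 3 = d.1.getD 3 0 := fun d => arrayOfList_natCast _ 3
  have B1 := memBdd₅.write 12 (fun _ => 0) (.of_size sizeBdd_dim)
  have B2 := B1.write 12 (fun _ => 1)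
    (((LogBdd.const 4).mul (logBdd_half hE_self)).mul (logBdd_fst hE_self (fun _ => 2)))
  have s1 := PolyRun.assign (k := 12) (i := .const 0) (e := .reg 3) memBdd₅ (iv := fun _ => 0)
    (fun d _ => rfl) fun d _ => mem₅_three d
  have s2 := PolyRun.assign (k := 12) (i := .const 1)
    (e := .mul (.mul (.const 4) (.reg 9)) (.cell 0 (.const 2))) B1 (iv := fun _ => 1)
    (ev := fun d => 4 * half d.1 * d.1.getD 2 0) (fun d _ => rfl) fun d _ => by
      simp only [Expr.val_mul, Expr.val_const, Expr.val_cell, Expr.val_reg]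
      rw [Memory.write_ne _ (by decide), Memory.write_ne _ (by decide), mem₅_nine, mem₅_zero, h2]
  have s3 := PolyRun.assign (k := 12) (i := .const 2)
    (e := .mul (.mul (.mul (.const 8) (.reg 9)) (.cell 0 (.const 3))) (.cell 0 (.const 0))) B2
    (iv := fun _ => 2) (ev := fun d => 8 * half d.1 * d.1.getD 3 0 * d.1.getD 0 0)
    (fun d _ => rfl) fun d _ => by
      simp only [Expr.val_mul, Expr.val_const, Expr.val_cell, Expr.val_reg, id]
      rw [Memory.write_ne _ (by decide), Memory.write_ne _ (by decide),
        Memory.write_ne _ (by decide), Memory.write_ne _ (by decide), mem₅_nine, mem₅_zero, h3, h0]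
  have s7 : PolyRun domain dataSize qmem₄ (.assign 0 (.const (-1))
      (.add (.add (.const 3) (.mul (.reg 3) (.reg 3))) (.reg 3))) qmem₅ := by
    refine .assign memBdd_q₄ (fun d _ => rfl) fun d _ => ?_
    simp [qmem₄, qmem₃_ne, Memory.fill_ne, mem₅_three]
  refine setup_run.seq (s1.seq (s2.seq (s3.seq (PolyRun.seq (B := qmem₂) ?_
    (PolyRun.seq (B := qmem₃) ?_ (PolyRun.seq (B := qmem₄) ?_ s7))))))
  · refine .tabulate
      (init := .add (.mul (.mul (.const 4) (.reg 9)) (entryExpr (.reg 4)))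
        (.mul (.const 2) (.div (.const 1)
          (.add (.const 1) (.mod (.reg 4) (.add (.reg 3) (.const 1)))))))
      (body := .const 0) (ini := fun d x => queryEntry d.1 x) (b := fun d _ j => 0)
      (C := fun _ => 0) memBdd_q₁ (by decide) (fun d _ => regs_q₁ d) (sizeBdd_dim.mul sizeBdd_dim)
      (.const 0) ?_ ?_ ?_ ?_ ?_ ?_ (logBdd_queryEntry hE_prod _)
    · intros; simp [qmem₁_ne, Memory.regs_ne, Memory.fill_ne, mem₅_three]
    · intros; simp
    · intro d hd x hx
      have := arrayOfList_entry d.1 (i := x) rfl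
      simp [entryExpr, qmem₁_ne, Memory.regs_ne, Memory.fill_ne, mem₅_three, mem₅_nine, mem₅_zero,
        this, delta_eq hx, queryEntry]
    · intros; simp
    · intros; simp
    · intros; simp
  · refine .tabulate
      (init := .cell 1 (.reg 4))
      (body := .mul (.mul (.mul (.const 2) (.reg 9))
        (entryExpr (.add (.mul (.reg 4) (.reg 3)) (.reg 5)))) (.cell 1 (.reg 5)))
      (ini := fun d x => d.2.1.getD x 0)
      (b := fun d x j => 2 * half d.1 * entry d.1 (x * dim d.1 + j) * d.2.1.getD j 0)
      (C := fun d => dim d.1) memBdd_q₂ (by decide) (fun d _ => regs_q₂ d) sizeBdd_dim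
      sizeBdd_dim ?_ ?_ ?_ ?_ ?_ ?_ (logBdd_queryShift hE_prod _)
    · intros; simp [qmem₂_ne, Memory.regs_ne, Memory.fill_ne, mem₅_three]
    · intros; simp [qmem₂_ne, Memory.regs_ne, Memory.fill_ne, mem₅_three]
    · intros; simp [qmem₂_ne, Memory.regs_ne, Memory.fill_ne, mem₅_one]
    · intros; simp [qmem₂_ne, Memory.regs_ne, Memory.fill_ne, mem₅_three]
    · intro d hd x hx j hj acc
      have := arrayOfList_entry d.1 (i := x * dim d.1 + j) (m := x * dim d.1 + j) (by push_cast; rfl)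
      simp [entryExpr, qmem₂_ne, Memory.regs_ne, Memory.fill_ne, mem₅_three, mem₅_nine, mem₅_zero,
        mem₅_one, this]
    · intros; rfl
  -- The copy may overwrite the input, which is no longer read. Its length 5n² covers the 3 + n² + n
  -- words of the query because n ≥ 1; the excess lies beyond the length recorded in cell -1.
  · refine .tabulate
      (init := .cell 12 (.reg 4))
      (body := .const 0) (ini := fun d x => qmem₃ d 12 x) (b := fun d x j => 0)
      (C := fun d => 0) memBdd_q₃ (by decide) (fun d _ => regs_q₃ d)
      ((SizeBdd.const 5).mul (sizeBdd_dim.mul sizeBdd_dim))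
      (.const 0) ?_ ?_ ?_ ?_ ?_ ?_
      (memBdd_q₃.cell _ hE_prod (fun _ => 12) fun p => (p.2 : ℤ))
    · intros; simp [qmem₃_ne, Memory.regs_ne, Memory.fill_ne, mem₅_three]
    · intros; simp
    · intros; simp [Memory.regs_ne, Memory.fill_ne]
    · intros; simp
    · intros; simp
    · intros; simp

theorem listOfArray_qmem₅ {d : Data} (hd : d ∈ domain) :
    listOfArray (qmem₅ d 0) = query d.1 d.2.1 := by
  have hn := dim_pos hd
  have hnn : dim d.1 ≤ dim d.1 * dim d.1 := Nat.le_mul_of_pos_left _ hn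
  have hlen : (qmem₅ d 0 (-1)).toNat = 3 + dim d.1 * dim d.1 + dim d.1 := by
    rw [qmem₅, Memory.write_same]; exact_mod_cast Int.toNat_natCast _
  have hcell : ∀ i < 3 + dim d.1 * dim d.1 + dim d.1, qmem₅ d 0 i = qmem₃ d 12 i := by
    intro i hi
    rw [qmem₅, Memory.write_same_ne _ _ (by omega), qmem₄]
    exact (qmem₃ d).fill_cast 0 (fun x => qmem₃ d 12 x) (by omega)
  have h12 : ∀ i < 3, qmem₃ d 12 (i : ℕ) = qmem₁ d 12 (i : ℕ) := by
    intro i hi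
    rw [qmem₃, Memory.fill_of_lt _ _ _ _ _ (by omega), qmem₂, Memory.fill_of_lt _ _ _ _ _ (by omega)]
  rw [listOfArray, hlen, query, List.range_add, List.range_add, List.map_append, List.map_append,
    List.map_map, List.map_map]
  congr 1
  · congr 1
    · have e0 := (hcell 0 (by omega)).trans (h12 0 (by omega))
      have e1 := (hcell 1 (by omega)).trans (h12 1 (by omega))
      have e2 := (hcell 2 (by omega)).trans (h12 2 (by omega))
      have : List.range 3 = [0, 1, 2] := rfl
      rw [this]
      simp only [List.map_cons, List.map_nil, e0, e1, e2]
      simp [qmem₁, Memory.write]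
    · refine List.map_congr_left fun i hi => ?_
      have hi := List.mem_range.1 hi
      simp only [Function.comp_apply]
      rw [hcell _ (by omega), qmem₃, Memory.fill_of_lt _ _ _ _ _ (by push_cast; omega)]
      have := (qmem₁ d).fill_add 12 3 (queryEntry d.1) hi
      rw [← this, qmem₂]; norm_cast
  · refine List.map_congr_left fun i hi => ?_
    have hi := List.mem_range.1 hi
    simp only [Function.comp_apply]
    rw [hcell _ (by omega)]
    have := (qmem₂ d).fill_add 12 (3 + dim d.1 * dim d.1) (queryShift d.1 d.2.1) hi
    rw [← this, qmem₃]; norm_cast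

theorem bitSize_map_range_le {a : ℤ → ℤ} {F : ℕ} (h : ∀ i, (a i).natAbs < 2 ^ F) :
    bitSize (listOfArray a) ≤ (a (-1)).toNat * (F + 1) := by
  have := List.sum_le_card_nsmul ((listOfArray a).map bitLen) (F + 1) fun x hx => by
    obtain ⟨z, hz, rfl⟩ := List.mem_map.1 hx
    obtain ⟨i, -, rfl⟩ := List.mem_map.1 hz
    exact bitLen_le_of_natAbs_lt (h _)
  simpa [bitSize, listOfArray] using this

theorem polyTime_query {D : Set (List (List ℤ))} {f : List (List ℤ) → List ℤ}
    (hD : ∀ l ∈ D, ∃ d ∈ domain, l = [d.1, d.2.1] ∧ d.2.2 = [] ∧ f l = query d.1 d.2.1) :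
    PolyTimeComputableOn D f := by
  obtain ⟨T, hT⟩ := queryProg_run
  obtain ⟨S, hS⟩ := memBdd_q₅
  obtain ⟨U, hU⟩ := ((SizeBdd.const 3).add (sizeBdd_dim.mul sizeBdd_dim)).add sizeBdd_dim
  refine ⟨queryProg, T + U * (S + 1), fun l hl => ?_⟩
  obtain ⟨d, hd, rfl, hy, hf⟩ := hD l hl
  have hsz : ([d.1, d.2.1].map bitSize).sum = dataSize d := by simp [dataSize, hy, bitSize]
  have hmem : inputMemory [d.1, d.2.1] = mem₀ d := by
    funext k
    match k with
    | 0 => rfl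
    | 1 => rfl
    | 2 => simp [mem₀, inputMemory, hy]
    | k + 3 => rfl
  obtain ⟨t, ht, hr⟩ := hT d hd
  refine ⟨t, _, hmem ▸ hr, (listOfArray_qmem₅ hd).trans hf.symm, ?_⟩
  rw [hf, ← listOfArray_qmem₅ hd, hsz]
  simp only [Polynomial.eval_add, Polynomial.eval_mul, Polynomial.eval_one]
  refine add_le_add ht ((bitSize_map_range_le (hS d hd 0)).trans (Nat.mul_le_mul_right _ ?_))
  have : (qmem₅ d 0 (-1)).toNat = 3 + dim d.1 * dim d.1 + dim d.1 := by
    rw [qmem₅, Memory.write_same]; exact_mod_cast Int.toNat_natCast _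
  rw [this]; exact hU d hd

end Spp

namespace Spp

/-! ### The decision -/

/-- The memory after the higher digits have been computed. -/
def dmem₁ (d : Data) : Memory := (mem₅ d).fill 13 0 (high d.1 d.2.2) (dim d.1 * dim d.1)

/-- The memory after the lower digits have been computed. -/
def dmem₂ (d : Data) : Memory := (dmem₁ d).fill 14 0 (low d.1 d.2.2) (dim d.1 * dim d.1)

/-- The memory after the deviations have been computed. -/
def dmem₃ (d : Data) : Memory := (dmem₂ d).fill 15 0 (defect d.1 d.2.2) (dim d.1 * dim d.1)

/-- The memory after the squares of the deviations have been added up. -/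
def dmem₄ (d : Data) : Memory := (dmem₃ d).fill 16 0 (fun _ => bad d.1 d.2.1 d.2.2) 1

/-- The memory after the Gram matrix has been computed. -/
def dmem₅ (d : Data) : Memory := (dmem₄ d).fill 19 0 (gram d.1 d.2.2) (dim d.1 * dim d.1)

/-- The memory after the identity matrix has been written. -/
def dmem₆ (d : Data) : Memory := (dmem₅ d).fill 20 0 (delta (dim d.1)) (dim d.1 * dim d.1)

/-- The list of all powers of the Gram matrix. -/
def powTable (d : Data) (m : ℕ) : ℤ :=
  matPow (dim d.1) (gram d.1 d.2.2) (m / dim d.1 / dim d.1) (m / dim d.1 % dim d.1) (m % dim d.1)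

/-- The memory after the powers of the Gram matrix have been computed. -/
def dmem₇ (d : Data) : Memory := (dmem₆ d).fill 20 (dim d.1 * dim d.1 : ℕ)
  (fun m => powTable d (dim d.1 * dim d.1 + m)) (dim d.1 * (dim d.1 * dim d.1))

/-- The memory after the trace has been computed. -/
def dmem₈ (d : Data) : Memory := (dmem₇ d).fill 21 0 (fun _ => tracePow d.1 d.2.2) 1

/-- The memory after the table of powers of the threshold has been started. -/
def dmem₉ (d : Data) : Memory := (dmem₈ d).write 22 0 1

/-- The memory after the table of powers of the threshold has been filled. -/
def dmem₁₀ (d : Data) : Memory := (dmem₉ d).fill 22 1 (fun x => bound d.1 ^ (x + 1)) (dim d.1)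

/-- The memory after the deviations have been tested. -/
def dmem₁₁ (d : Data) : Memory :=
  (dmem₁₀ d).write 23 0 (if 0 < 1 - bad d.1 d.2.1 d.2.2 then 1 else 0)

/-- The memory after the trace has been tested. -/
def dmem₁₂ (d : Data) : Memory :=
  (dmem₁₁ d).write 0 0 (if 0 < bound d.1 ^ dim d.1 + 1 - tracePow d.1 d.2.2 then
    if 0 < 1 - bad d.1 d.2.1 d.2.2 then 1 else 0 else 0)

/-- The final memory of the decision program. -/
def dmem₁₃ (d : Data) : Memory := (dmem₁₂ d).write 0 (-1) 1

/-- The program that computes the decision. -/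
def decideProg : Prog :=
  .seq setup
  (.seq (tabulate 13 (.reg 4) (.mul (.reg 3) (.reg 3)) (.const 0)
    (.div (.add (.cell 2 (.reg 4)) (.reg 9)) (.mul (.const 2) (.reg 9))) (.const 0))
  (.seq (tabulate 14 (.reg 4) (.mul (.reg 3) (.reg 3)) (.const 0)
    (.sub (.cell 2 (.reg 4)) (.mul (.mul (.const 2) (.reg 9)) (.cell 13 (.reg 4)))) (.const 0))
  (.seq (tabulate 15 (.reg 4) (.mul (.reg 3) (.reg 3)) (.reg 3)
    (.sub (.const 0) (.cell 13 (.reg 4)))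
    (.mul (entryExpr (.add (.mul (.mod (.reg 4) (.reg 3)) (.reg 3)) (.reg 5)))
      (.cell 14 (.add (.mul (.div (.reg 4) (.reg 3)) (.reg 3)) (.reg 5)))))
  (.seq (tabulate 16 (.const 0) (.const 1) (.mul (.reg 3) (.reg 3)) (.const 0)
    (.add (.mul (.cell 15 (.reg 5)) (.cell 15 (.reg 5)))
      (.mul (.mod (.sub (.cell 14 (.reg 5)) (.cell 1 (.mod (.reg 5) (.reg 3)))) (.const 2))
        (.mod (.sub (.cell 14 (.reg 5)) (.cell 1 (.mod (.reg 5) (.reg 3)))) (.const 2)))))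
  (.seq (tabulate 19 (.reg 4) (.mul (.reg 3) (.reg 3)) (.reg 3) (.const 0)
    (.mul (.cell 13 (.add (.mul (.reg 5) (.reg 3)) (.div (.reg 4) (.reg 3))))
      (.cell 13 (.add (.mul (.reg 5) (.reg 3)) (.mod (.reg 4) (.reg 3))))))
  (.seq (tabulate 20 (.reg 4) (.mul (.reg 3) (.reg 3)) (.const 0)
    (.div (.const 1) (.add (.const 1) (.mod (.reg 4) (.add (.reg 3) (.const 1))))) (.const 0))
  (.seq (tabulate 20 (.add (.mul (.reg 3) (.reg 3)) (.reg 4))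
    (.mul (.reg 3) (.mul (.reg 3) (.reg 3))) (.reg 3) (.const 0)
    (.mul (.cell 20 (.add (.mul (.div (.reg 4) (.reg 3)) (.reg 3)) (.reg 5)))
      (.cell 19 (.add (.mul (.reg 5) (.reg 3)) (.mod (.reg 4) (.reg 3))))))
  (.seq (tabulate 21 (.const 0) (.const 1) (.reg 3) (.const 0)
    (.cell 20 (.add (.mul (.mul (.reg 3) (.reg 3)) (.reg 3))
      (.mul (.reg 5) (.add (.reg 3) (.const 1))))))
  (.seq (.assign 22 (.const 0) (.const 1))
  (.seq (tabulate 22 (.add (.const 1) (.reg 4)) (.reg 3) (.const 0)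
    (.mul (.cell 22 (.reg 4)) (.mul (.mul (.mul (.const 10000) (.reg 3))
      (.mul (.cell 0 (.const 0)) (.cell 0 (.const 0))))
      (.mul (.cell 0 (.const 3)) (.cell 0 (.const 3))))) (.const 0))
  (.seq (.ite (.sub (.const 1) (.reg 16)) (.assign 23 (.const 0) (.const 1))
    (.assign 23 (.const 0) (.const 0)))
  (.seq (.ite (.sub (.add (.cell 22 (.reg 3)) (.const 1)) (.reg 21))
    (.assign 0 (.const 0) (.reg 23)) (.assign 0 (.const 0) (.const 0)))
  (.assign 0 (.const (-1)) (.const 1))))))))))))))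

theorem regs_d₁ (d : Data) : (dmem₁ d).regs 0 0 0 = dmem₁ d :=
  Memory.regs_fill (regs₅ d) (by decide) _ _ _
theorem regs_d₂ (d : Data) : (dmem₂ d).regs 0 0 0 = dmem₂ d :=
  Memory.regs_fill (regs_d₁ d) (by decide) _ _ _
theorem regs_d₃ (d : Data) : (dmem₃ d).regs 0 0 0 = dmem₃ d :=
  Memory.regs_fill (regs_d₂ d) (by decide) _ _ _
theorem regs_d₄ (d : Data) : (dmem₄ d).regs 0 0 0 = dmem₄ d :=
  Memory.regs_fill (regs_d₃ d) (by decide) _ _ _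
theorem regs_d₅ (d : Data) : (dmem₅ d).regs 0 0 0 = dmem₅ d :=
  Memory.regs_fill (regs_d₄ d) (by decide) _ _ _
theorem regs_d₆ (d : Data) : (dmem₆ d).regs 0 0 0 = dmem₆ d :=
  Memory.regs_fill (regs_d₅ d) (by decide) _ _ _
theorem regs_d₇ (d : Data) : (dmem₇ d).regs 0 0 0 = dmem₇ d :=
  Memory.regs_fill (regs_d₆ d) (by decide) _ _ _
theorem regs_d₈ (d : Data) : (dmem₈ d).regs 0 0 0 = dmem₈ d :=
  Memory.regs_fill (regs_d₇ d) (by decide) _ _ _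
theorem regs_d₉ (d : Data) : (dmem₉ d).regs 0 0 0 = dmem₉ d :=
  Memory.regs_write (regs_d₈ d) (by decide) _ _

theorem logBdd_powTable :
    LogBdd {p : Data × ℕ | p.1 ∈ domain ∧ p.2 < dim p.1.1 * (dim p.1.1 * dim p.1.1)}
      (fun p => dataSize p.1) fun p => powTable p.1 (dim p.1.1 * dim p.1.1 + p.2) := by
  refine logBdd_matPow hE_prod ?_ _ _
  obtain ⟨T, hT⟩ := sizeBdd_dim
  refine ⟨T + 1, fun p hp => ?_⟩
  have h1 : dim p.1.1 ≤ _ := hT _ hp.1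
  have h2 := hp.2
  have hn := dim_pos hp.1
  dsimp only
  rw [Nat.div_div_eq_div_mul, Nat.add_div_left _ (by positivity), Polynomial.eval_add,
    Polynomial.eval_one]
  have := Nat.div_lt_of_lt_mul (by rwa [mul_assoc] :
    p.2 < dim p.1.1 * dim p.1.1 * dim p.1.1)
  omega

theorem logBdd_boundPow : LogBdd {p : Data × ℕ | p.1 ∈ domain ∧ p.2 < dim p.1.1}
    (fun p => dataSize p.1) fun p => bound p.1.1 ^ (p.2 + 1) := by
  refine (logBdd_bound hE_prod).pow ?_
  obtain ⟨T, hT⟩ := sizeBdd_dim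
  exact ⟨T, fun p hp => by
    have : dim p.1.1 ≤ _ := hT _ hp.1
    have := hp.2
    dsimp only at *
    omega⟩

theorem memBdd_d₁ : MemBdd domain dataSize dmem₁ := memBdd₅.fill 13 _ (logBdd_high hE_prod _)
theorem memBdd_d₂ : MemBdd domain dataSize dmem₂ := memBdd_d₁.fill 14 _ (logBdd_low hE_prod _)
theorem memBdd_d₃ : MemBdd domain dataSize dmem₃ := memBdd_d₂.fill 15 _ (logBdd_defect hE_prod _)
theorem memBdd_d₄ : MemBdd domain dataSize dmem₄ := memBdd_d₃.fill 16 _ (logBdd_bad hE_prod)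
theorem memBdd_d₅ : MemBdd domain dataSize dmem₅ := memBdd_d₄.fill 19 _ (logBdd_gram hE_prod _)
theorem memBdd_d₆ : MemBdd domain dataSize dmem₆ := memBdd_d₅.fill 20 _ (logBdd_delta _ _)
theorem memBdd_d₇ : MemBdd domain dataSize dmem₇ := memBdd_d₆.fill 20 _ logBdd_powTable
theorem memBdd_d₈ : MemBdd domain dataSize dmem₈ := memBdd_d₇.fill 21 _ (logBdd_tracePow hE_prod)
theorem memBdd_d₉ : MemBdd domain dataSize dmem₉ := memBdd_d₈.write 22 _ (.const 1)
theorem memBdd_d₁₀ : MemBdd domain dataSize dmem₁₀ := memBdd_d₉.fill 22 _ logBdd_boundPow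
theorem memBdd_d₁₁ : MemBdd domain dataSize dmem₁₁ :=
  memBdd_d₁₀.write 23 _ ⟨1, fun d _ => by dsimp only; split_ifs <;> simp⟩
theorem memBdd_d₁₂ : MemBdd domain dataSize dmem₁₂ :=
  memBdd_d₁₁.write 0 _ ⟨1, fun d _ => by dsimp only; split_ifs <;> simp⟩

theorem dmem₁_ne (d : Data) {k : ℕ} (h : k < 13) : dmem₁ d k = mem₅ d k := by
  rw [dmem₁, Memory.fill_ne _ (by omega)]
theorem dmem₂_ne (d : Data) {k : ℕ} (h : k < 13) : dmem₂ d k = mem₅ d k := by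
  rw [dmem₂, Memory.fill_ne _ (by omega), dmem₁_ne d h]
theorem dmem₃_ne (d : Data) {k : ℕ} (h : k < 13) : dmem₃ d k = mem₅ d k := by
  rw [dmem₃, Memory.fill_ne _ (by omega), dmem₂_ne d h]
theorem dmem₄_ne (d : Data) {k : ℕ} (h : k < 13) : dmem₄ d k = mem₅ d k := by
  rw [dmem₄, Memory.fill_ne _ (by omega), dmem₃_ne d h]
theorem dmem₅_ne (d : Data) {k : ℕ} (h : k < 13) : dmem₅ d k = mem₅ d k := by
  rw [dmem₅, Memory.fill_ne _ (by omega), dmem₄_ne d h]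
theorem dmem₆_ne (d : Data) {k : ℕ} (h : k < 13) : dmem₆ d k = mem₅ d k := by
  rw [dmem₆, Memory.fill_ne _ (by omega), dmem₅_ne d h]
theorem dmem₇_ne (d : Data) {k : ℕ} (h : k < 13) : dmem₇ d k = mem₅ d k := by
  rw [dmem₇, Memory.fill_ne _ (by omega), dmem₆_ne d h]
theorem dmem₈_ne (d : Data) {k : ℕ} (h : k < 13) : dmem₈ d k = mem₅ d k := by
  rw [dmem₈, Memory.fill_ne _ (by omega), dmem₇_ne d h]
theorem dmem₉_ne (d : Data) {k : ℕ} (h : k < 13) : dmem₉ d k = mem₅ d k := by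
  rw [dmem₉, Memory.write_ne _ (by omega), dmem₈_ne d h]
theorem dmem₁₀_ne (d : Data) {k : ℕ} (h : k < 13) : dmem₁₀ d k = mem₅ d k := by
  rw [dmem₁₀, Memory.fill_ne _ (by omega), dmem₉_ne d h]

/-! ### Contents of the tables of the decision -/

theorem dmem₁_high (d : Data) {m : ℕ} (h : m < dim d.1 * dim d.1) :
    dmem₁ d 13 m = high d.1 d.2.2 m := Memory.fill_cast _ _ _ h
theorem dmem₂_high (d : Data) {m : ℕ} (h : m < dim d.1 * dim d.1) :
    dmem₂ d 13 m = high d.1 d.2.2 m := by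
  rw [dmem₂, Memory.fill_ne _ (by decide), dmem₁_high d h]
theorem dmem₂_low (d : Data) {m : ℕ} (h : m < dim d.1 * dim d.1) :
    dmem₂ d 14 m = low d.1 d.2.2 m := Memory.fill_cast _ _ _ h
theorem dmem₃_low (d : Data) {m : ℕ} (h : m < dim d.1 * dim d.1) :
    dmem₃ d 14 m = low d.1 d.2.2 m := by
  rw [dmem₃, Memory.fill_ne _ (by decide), dmem₂_low d h]
theorem dmem₃_defect (d : Data) {m : ℕ} (h : m < dim d.1 * dim d.1) :
    dmem₃ d 15 m = defect d.1 d.2.2 m := Memory.fill_cast _ _ _ h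
theorem dmem₄_high (d : Data) {m : ℕ} (h : m < dim d.1 * dim d.1) :
    dmem₄ d 13 m = high d.1 d.2.2 m := by
  rw [dmem₄, Memory.fill_ne _ (by decide), dmem₃, Memory.fill_ne _ (by decide), dmem₂_high d h]
theorem dmem₆_gram (d : Data) {m : ℕ} (h : m < dim d.1 * dim d.1) :
    dmem₆ d 19 m = gram d.1 d.2.2 m := by
  rw [dmem₆, Memory.fill_ne _ (by decide)]
  exact Memory.fill_cast _ _ _ h
theorem dmem₁₀_bad (d : Data) : dmem₁₀ d 16 0 = bad d.1 d.2.1 d.2.2 := by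
  rw [dmem₁₀, Memory.fill_ne _ (by decide), dmem₉, Memory.write_ne _ (by decide), dmem₈,
    Memory.fill_ne _ (by decide), dmem₇, Memory.fill_ne _ (by decide), dmem₆,
    Memory.fill_ne _ (by decide), dmem₅, Memory.fill_ne _ (by decide)]
  exact (dmem₃ d).fill_cast 16 (fun _ => bad d.1 d.2.1 d.2.2) (i := 0) (x := 1) one_pos
theorem dmem₁₀_trace (d : Data) : dmem₁₀ d 21 0 = tracePow d.1 d.2.2 := by
  rw [dmem₁₀, Memory.fill_ne _ (by decide), dmem₉, Memory.write_ne _ (by decide)]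
  exact (dmem₇ d).fill_cast 21 (fun _ => tracePow d.1 d.2.2) (i := 0) (x := 1) one_pos
theorem dmem₁₀_bound {d : Data} (hd : d ∈ domain) :
    dmem₁₀ d 22 (dim d.1) = bound d.1 ^ dim d.1 := by
  have hn := dim_pos hd
  have := (dmem₉ d).fill_add 22 1 (fun x => bound d.1 ^ (x + 1)) (i := dim d.1 - 1)
    (x := dim d.1) (by omega)
  rw [Nat.sub_add_cancel hn] at this
  rw [← this, dmem₁₀]
  congr 1; omega

theorem powTable_lt (d : Data) {m : ℕ} (h : m < dim d.1 * dim d.1) :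
    powTable d m = delta (dim d.1) m := by
  have : m / dim d.1 < dim d.1 := Nat.div_lt_of_lt_mul h
  rw [powTable, Nat.div_eq_of_lt this, Nat.mod_eq_of_lt this, matPow, delta]

theorem powTable_fill (d : Data) (x : ℕ) {m : ℕ} (h : m < dim d.1 * dim d.1 + x) :
    (dmem₆ d).fill 20 (dim d.1 * dim d.1 : ℕ) (fun m => powTable d (dim d.1 * dim d.1 + m)) x 20 m
      = powTable d m := by
  rcases lt_or_ge m (dim d.1 * dim d.1) with h' | h'
  · rw [Memory.fill_of_lt _ _ _ _ _ (by exact_mod_cast h'), powTable_lt d h']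
    exact Memory.fill_cast _ _ _ h'
  · obtain ⟨y, rfl⟩ := Nat.exists_eq_add_of_le h'
    have := (dmem₆ d).fill_add 20 (dim d.1 * dim d.1 : ℕ)
      (fun m => powTable d (dim d.1 * dim d.1 + m)) (i := y) (x := x) (by omega)
    exact_mod_cast this

/-- The list contains 1, S, S², … row by row, so moving on by n² places multiplies by S once more.
The right-hand side uses only places of the same row one power earlier, and these are already
filled. -/
theorem powTable_add {d : Data} (hd : d ∈ domain) (m : ℕ) :
    powTable d (dim d.1 * dim d.1 + m) = ∑ l ∈ Finset.range (dim d.1),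
      powTable d (m / dim d.1 * dim d.1 + l) * gram d.1 d.2.2 (l * dim d.1 + m % dim d.1) := by
  have hn := dim_pos hd
  have e1 : (dim d.1 * dim d.1 + m) / dim d.1 = dim d.1 + m / dim d.1 :=
    Nat.mul_add_div hn _ _
  rw [powTable, e1, Nat.add_div_left _ hn, Nat.add_mod_left, Nat.mul_add_mod, matPow]
  refine Finset.sum_congr rfl fun l hl => ?_
  have hl := Finset.mem_range.1 hl
  have e2 : (m / dim d.1 * dim d.1 + l) / dim d.1 = m / dim d.1 := by
    rw [mul_comm, Nat.mul_add_div hn, Nat.div_eq_of_lt hl, add_zero]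
  rw [powTable, e2, mul_comm (m / dim d.1), Nat.mul_add_mod, Nat.mod_eq_of_lt hl]

theorem powTable_diag {d : Data} {j : ℕ} (hj : j < dim d.1) :
    powTable d (dim d.1 * dim d.1 * dim d.1 + j * (dim d.1 + 1)) =
      matPow (dim d.1) (gram d.1 d.2.2) (dim d.1) j j := by
  have hn : 0 < dim d.1 := by omega
  have e : dim d.1 * dim d.1 * dim d.1 + j * (dim d.1 + 1) =
    dim d.1 * (dim d.1 * dim d.1 + j) + j := by ring
  rw [powTable, e, Nat.mul_add_div hn, Nat.mul_add_mod, Nat.div_eq_of_lt hj, Nat.mod_eq_of_lt hj,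
    add_zero, Nat.mul_add_div hn, Nat.mul_add_mod, Nat.div_eq_of_lt hj, Nat.mod_eq_of_lt hj,
    add_zero]

theorem mul_add_lt_sq {n i j : ℕ} (hi : i < n) (hj : j < n) : i * n + j < n * n := by
  nlinarith

theorem decideProg_run : PolyRun domain dataSize mem₀ decideProg dmem₁₃ := by
  have h0 : ∀ d : Data, arrayOfList d.1 0 = d.1.getD 0 0 := fun d => arrayOfList_natCast _ 0
  have h3 : ∀ d : Data, arrayOfList d.1 3 = d.1.getD 3 0 := fun d => arrayOfList_natCast _ 3
  have hnn := sizeBdd_dim.mul sizeBdd_dim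
  have s9 : PolyRun domain dataSize dmem₈ (.assign 22 (.const 0) (.const 1)) dmem₉ :=
    .assign memBdd_d₈ (fun d _ => rfl) fun d _ => rfl
  have s11 : PolyRun domain dataSize dmem₁₀ (.ite (.sub (.const 1) (.reg 16))
      (.assign 23 (.const 0) (.const 1)) (.assign 23 (.const 0) (.const 0))) dmem₁₁ :=
    .ite_assign memBdd_d₁₀ (fun d _ => by simp [dmem₁₀_bad]) (fun d _ => rfl)
      (fun d _ => rfl) fun d _ => rfl
  have s12 : PolyRun domain dataSize dmem₁₁
      (.ite (.sub (.add (.cell 22 (.reg 3)) (.const 1)) (.reg 21))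
        (.assign 0 (.const 0) (.reg 23)) (.assign 0 (.const 0) (.const 0))) dmem₁₂ := by
    refine .ite_assign memBdd_d₁₁ (fun d hd => ?_) (fun d _ => rfl) (fun d _ => ?_) fun d _ => rfl
    · simp [dmem₁₁, Memory.write_ne, dmem₁₀_trace, dmem₁₀_ne, mem₅_three, dmem₁₀_bound hd]
    · simp [dmem₁₁]
  have s13 : PolyRun domain dataSize dmem₁₂ (.assign 0 (.const (-1)) (.const 1)) dmem₁₃ :=
    .assign memBdd_d₁₂ (fun d _ => rfl) fun d _ => rfl
  refine setup_run.seq (PolyRun.seq (B := dmem₁) ?_ (PolyRun.seq (B := dmem₂) ?_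
    (PolyRun.seq (B := dmem₃) ?_ (PolyRun.seq (B := dmem₄) ?_ (PolyRun.seq (B := dmem₅) ?_
    (PolyRun.seq (B := dmem₆) ?_ (PolyRun.seq (B := dmem₇) ?_ (PolyRun.seq (B := dmem₈) ?_
    (s9.seq (PolyRun.seq (B := dmem₁₀) ?_ (s11.seq (s12.seq s13))))))))))))
  · refine .tabulate (ini := fun d x => high d.1 d.2.2 x) (b := fun d x j => 0) (C := fun d => 0)
      memBdd₅ (by decide) (fun d _ => regs₅ d) hnn (.const 0) ?_ ?_ ?_ ?_ ?_ ?_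
      (logBdd_high hE_prod _)
    · intros; simp [Memory.regs_ne, Memory.fill_ne, mem₅_three]
    · intros; simp
    · intros; simp [Memory.regs_ne, Memory.fill_ne, mem₅_two, mem₅_nine, high]
    · intros; simp
    · intros; simp
    · intros; simp
  · refine .tabulate (ini := fun d x => low d.1 d.2.2 x) (b := fun d x j => 0) (C := fun d => 0)
      memBdd_d₁ (by decide) (fun d _ => regs_d₁ d) hnn (.const 0) ?_ ?_ ?_ ?_ ?_ ?_
      (logBdd_low hE_prod _)
    · intros; simp [Memory.regs_ne, Memory.fill_ne, dmem₁_ne, mem₅_three]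
    · intros; simp
    · intro d hd x hx
      simp [Memory.regs_ne, Memory.fill_ne, dmem₁_ne, mem₅_two, mem₅_nine, low, dmem₁_high d hx]
    · intros; simp
    · intros; simp
    · intros; simp
  · refine .tabulate (ini := fun d x => - high d.1 d.2.2 x)
      (b := fun d x j => entry d.1 (x % dim d.1 * dim d.1 + j) *
        low d.1 d.2.2 (x / dim d.1 * dim d.1 + j)) (C := fun d => dim d.1)
      memBdd_d₂ (by decide) (fun d _ => regs_d₂ d) hnn sizeBdd_dim ?_ ?_ ?_ ?_ ?_ ?_
      (logBdd_defect hE_prod _)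
    · intros; simp [Memory.regs_ne, Memory.fill_ne, dmem₂_ne, mem₅_three]
    · intros; simp
    · intro d hd x hx
      simp [Memory.regs_ne, Memory.fill_ne, dmem₂_high d hx]
    · intros; simp [Memory.regs_ne, Memory.fill_ne, dmem₂_ne, mem₅_three]
    · intro d hd x hx j hj acc
      have e1 := arrayOfList_entry d.1 (i := (x : ℤ) % dim d.1 * dim d.1 + j)
        (m := x % dim d.1 * dim d.1 + j) (by push_cast; rfl)
      have e2 := dmem₂_low d (mul_add_lt_sq (Nat.div_lt_of_lt_mul hx) hj)
      push_cast at e2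
      simp [Memory.regs_ne, Memory.fill_ne, dmem₂_ne, mem₅_three, entryExpr, mem₅_zero, e1, e2]
    · intros; rfl
  · refine .tabulate (ini := fun d x => 0)
      (b := fun d x i => defect d.1 d.2.2 i * defect d.1 d.2.2 i +
        (low d.1 d.2.2 i - d.2.1.getD (i % dim d.1) 0) % 2 *
          ((low d.1 d.2.2 i - d.2.1.getD (i % dim d.1) 0) % 2))
      (C := fun d => dim d.1 * dim d.1)
      memBdd_d₃ (by decide) (fun d _ => regs_d₃ d) (.const 1) hnn ?_ ?_ ?_ ?_ ?_ ?_
      (logBdd_bad hE_prod)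
    · intros; simp
    · intros; simp; omega
    · intros; simp
    · intros; simp [Memory.regs_ne, Memory.fill_ne, dmem₃_ne, mem₅_three]
    · intro d hd x hx j hj acc
      have e1 := arrayOfList_of_eq d.2.1 (i := (j : ℤ) % dim d.1)
        (m := j % dim d.1) (by push_cast; rfl)
      simp [Memory.regs_ne, Memory.fill_ne, dmem₃_ne, mem₅_three, mem₅_one, e1, dmem₃_low d hj,
        dmem₃_defect d hj]
    · intros; simp [bad]
  · refine .tabulate (ini := fun d x => 0)
      (b := fun d x r => high d.1 d.2.2 (r * dim d.1 + x / dim d.1) *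
        high d.1 d.2.2 (r * dim d.1 + x % dim d.1)) (C := fun d => dim d.1)
      memBdd_d₄ (by decide) (fun d _ => regs_d₄ d) hnn sizeBdd_dim ?_ ?_ ?_ ?_ ?_ ?_
      (logBdd_gram hE_prod _)
    · intros; simp [Memory.regs_ne, Memory.fill_ne, dmem₄_ne, mem₅_three]
    · intros; simp
    · intros; simp
    · intros; simp [Memory.regs_ne, Memory.fill_ne, dmem₄_ne, mem₅_three]
    · intro d hd x hx j hj acc
      have e1 := dmem₄_high d (mul_add_lt_sq hj (Nat.div_lt_of_lt_mul hx))
      have e2 := dmem₄_high d (mul_add_lt_sq hj (Nat.mod_lt x (dim_pos hd)))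
      push_cast at e1 e2
      simp [Memory.regs_ne, Memory.fill_ne, dmem₄_ne, mem₅_three, e1, e2]
    · intros; simp [gram]
  · refine .tabulate (ini := fun d x => delta (dim d.1) x)
      (b := fun d x r => 0) (C := fun d => 0)
      memBdd_d₅ (by decide) (fun d _ => regs_d₅ d) hnn (.const 0) ?_ ?_ ?_ ?_ ?_ ?_
      (logBdd_delta _ _)
    · intros; simp [Memory.regs_ne, Memory.fill_ne, dmem₅_ne, mem₅_three]
    · intros; simp
    · intro d hd x hx
      simp [Memory.regs_ne, Memory.fill_ne, dmem₅_ne, mem₅_three, delta_eq hx]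
    · intros; simp
    · intros; simp
    · intros; simp
  · refine .tabulate (ini := fun d x => 0)
      (b := fun d m l => powTable d (m / dim d.1 * dim d.1 + l) *
        gram d.1 d.2.2 (l * dim d.1 + m % dim d.1)) (C := fun d => dim d.1)
      memBdd_d₆ (by decide) (fun d _ => regs_d₆ d) (sizeBdd_dim.mul hnn) sizeBdd_dim
      ?_ ?_ ?_ ?_ ?_ ?_ logBdd_powTable
    · intros; simp [Memory.regs_ne, Memory.fill_ne, dmem₆_ne, mem₅_three]
    · intros; simp [Memory.regs_ne, Memory.fill_ne, dmem₆_ne, mem₅_three]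
    · intros; simp
    · intros; simp [Memory.regs_ne, Memory.fill_ne, dmem₆_ne, mem₅_three]
    · intro d hd x hx j hj acc
      have hn := dim_pos hd
      have e1 := powTable_fill d x (m := x / dim d.1 * dim d.1 + j) (by
        have := Nat.div_mul_le_self x (dim d.1)
        have := Nat.le_mul_of_pos_left (dim d.1) hn
        omega)
      have e2 := dmem₆_gram d (mul_add_lt_sq hj (Nat.mod_lt x (dim_pos hd)))
      push_cast at e1 e2
      simp [Memory.regs_ne, Memory.fill_ne, dmem₆_ne, mem₅_three, e1, e2]
    · intro d hd x hx
      rw [zero_add]; exact powTable_add hd x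
  · refine .tabulate (ini := fun d x => 0)
      (b := fun d x j => matPow (dim d.1) (gram d.1 d.2.2) (dim d.1) j j) (C := fun d => dim d.1)
      memBdd_d₇ (by decide) (fun d _ => regs_d₇ d) (.const 1) sizeBdd_dim
      ?_ ?_ ?_ ?_ ?_ ?_ (logBdd_tracePow hE_prod)
    · intros; simp
    · intros; simp; omega
    · intros; simp
    · intros; simp [Memory.regs_ne, Memory.fill_ne, dmem₇_ne, mem₅_three]
    · intro d hd x hx j hj acc
      have hn := dim_pos hd
      -- The block of the n-th power begins at n³, and its diagonal is spaced by n + 1.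
      have e1 := powTable_fill d (dim d.1 * (dim d.1 * dim d.1))
        (m := dim d.1 * dim d.1 * dim d.1 + j * (dim d.1 + 1)) (by
        have := mul_add_lt_sq hj hj
        rw [mul_assoc, mul_add, mul_one]; omega)
      rw [powTable_diag hj, ← dmem₇] at e1
      push_cast at e1
      simp [Memory.regs_ne, Memory.fill_ne, dmem₇_ne, mem₅_three, e1]
    · intros; simp [tracePow]
  · refine .tabulate (ini := fun d x => bound d.1 ^ (x + 1))
      (b := fun d x j => 0) (C := fun d => 0)
      memBdd_d₉ (by decide) (fun d _ => regs_d₉ d) sizeBdd_dim (.const 0)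
      ?_ ?_ ?_ ?_ ?_ ?_ logBdd_boundPow
    · intros; simp [Memory.regs_ne, Memory.fill_ne, dmem₉_ne, mem₅_three]
    · intros; simp
    · intro d hd x hx
      have h8 : ((dmem₉ d).fill 22 1 (fun x => bound d.1 ^ (x + 1)) x) 22 x = bound d.1 ^ x := by
        cases x with
        | zero => rw [Memory.fill_of_lt _ _ _ _ _ (by norm_num)]; simp [dmem₉]
        | succ x =>
          have := (dmem₉ d).fill_add 22 1 (fun x => bound d.1 ^ (x + 1)) (Nat.lt_succ_self x)
          rw [← this]; congr 1; push_cast; ring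
      have hne : ∀ k < 13, k ≠ 4 ∧ k ≠ 5 ∧ k ≠ 6 → ((dmem₉ d).fill 22 1
          (fun x => bound d.1 ^ (x + 1)) x).regs x 0 0 k = mem₅ d k := by
        intro k hk h
        rw [Memory.regs_ne _ _ _ _ h, Memory.fill_ne _ (by omega), dmem₉_ne d hk]
      simp only [Expr.val_mul, Expr.val_cell, Expr.val_reg, Expr.val_const, Memory.regs_four]
      rw [Memory.regs_ne _ _ _ _ (by decide : (22 : ℕ) ≠ 4 ∧ 22 ≠ 5 ∧ 22 ≠ 6), h8,
        hne 3 (by decide) (by decide), hne 0 (by decide) (by decide), mem₅_zero, mem₅_three, h0, h3,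
        pow_succ, bound]
    · intros; simp
    · intros; simp
    · intros; simp

theorem listOfArray_dmem₁₃ (d : Data) :
    listOfArray (dmem₁₃ d 0) = if accepts d.1 d.2.1 d.2.2 then [1] else [0] := by
  have h1 : dmem₁₃ d 0 (-1) = 1 := by rw [dmem₁₃, Memory.write_same]
  have h2 : dmem₁₃ d 0 0 = if accepts d.1 d.2.1 d.2.2 then 1 else 0 := by
    rw [dmem₁₃, Memory.write_same_ne _ _ (by decide), dmem₁₂, Memory.write_same]
    simp only [accepts, decide_eq_true_eq]
    split_ifs <;> first | rfl | omega
  rw [listOfArray, h1]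
  have : List.range (Int.toNat 1) = [0] := rfl
  rw [this, List.map_singleton, Nat.cast_zero, h2]
  split_ifs <;> rfl

theorem polyTime_decide {D : Set (List (List ℤ))} {f : List (List ℤ) → List ℤ}
    (hD : ∀ l ∈ D, ∃ d ∈ domain, l = [d.1, d.2.1, d.2.2] ∧
      f l = if accepts d.1 d.2.1 d.2.2 then [1] else [0]) :
    PolyTimeComputableOn D f := by
  obtain ⟨T, hT⟩ := decideProg_run
  refine ⟨decideProg, T + 2, fun l hl => ?_⟩
  obtain ⟨d, hd, rfl, hf⟩ := hD l hl
  have hsz : ([d.1, d.2.1, d.2.2].map bitSize).sum = dataSize d := by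
    simp [dataSize, add_assoc]
  obtain ⟨t, ht, hr⟩ := hT d hd
  refine ⟨t, _, hr, (listOfArray_dmem₁₃ d).trans hf.symm, ?_⟩
  rw [hf, hsz, Polynomial.eval_add, Polynomial.eval_ofNat]
  refine add_le_add ht ?_
  split_ifs <;> simp [bitSize, bitLen]

end Spp

/-! ### Concentration of subgaussian samples -/

section Concentration

variable {A : Type} {n : ℕ}

theorem tsum_bind_mul {A B : Type} (p : PMF A) (q : A → PMF B) (f : B → ℝ≥0∞) :
    ∑' y, p.bind q y * f y = ∑' x, p x * ∑' y, q x y * f y := by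
  simp_rw [PMF.bind_apply, ← ENNReal.tsum_mul_right, ← ENNReal.tsum_mul_left]
  rw [ENNReal.tsum_comm]
  simp_rw [mul_assoc]

theorem tsum_map_mul {A B : Type} (p : PMF A) (g : A → B) (f : B → ℝ≥0∞) :
    ∑' y, p.map g y * f y = ∑' x, p x * f (g x) := by
  rw [PMF.map, tsum_bind_mul]
  simp

/-- Independence: the expectation of a product over the samples is a power of a single expectation.
-/
theorem tsum_iidSamples_mul (ν : PMF A) (f : A → ℝ≥0∞) (m : ℕ) :
    ∑' l, iidSamples ν m l * (l.map f).prod = (∑' x, ν x * f x) ^ m := by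
  induction m with
  | zero => simp [iidSamples]
  | succ m ih =>
    rw [iidSamples, tsum_bind_mul, pow_succ']
    simp_rw [tsum_map_mul, List.map_cons, List.prod_cons, mul_left_comm _ (f _) _,
      ENNReal.tsum_mul_left, ih, ← ENNReal.tsum_mul_right, mul_assoc]

theorem support_iidSamples (ν : PMF A) (m : ℕ) (l : List A) (hl : l ∈ (iidSamples ν m).support) :
    l.length = m ∧ ∀ x ∈ l, x ∈ ν.support := by
  induction m generalizing l with
  | zero => simp_all [iidSamples]
  | succ m ih =>
    rw [iidSamples, PMF.mem_support_bind_iff] at hl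
    obtain ⟨x, hx, hl⟩ := hl
    rw [PMF.mem_support_map_iff] at hl
    obtain ⟨l', hl', rfl⟩ := hl
    obtain ⟨h1, h2⟩ := ih l' hl'
    simp only [List.length_cons, h1, List.mem_cons, forall_eq_or_imp, true_and]
    exact ⟨hx, h2⟩

/-- A geometric series of ratio e^(-1/4). It arises when E exp(⟨X, θ⟩² / 4s²) is bounded through the
tails at the levels s √k; the value 16 is a convenient round bound. -/
theorem exp_quarter_series :
    ∑' k : ℕ, ENNReal.ofReal (Real.exp (((k : ℝ) + 1) / 4) * (2 * Real.exp (-(k : ℝ) / 2))) ≤ 16 := by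
  have e : ∀ k : ℕ, Real.exp (((k : ℝ) + 1) / 4) * (2 * Real.exp (-(k : ℝ) / 2)) =
      2 * Real.exp (1 / 4) * (Real.exp (-(1 / 4))) ^ k := by
    intro k
    rw [← Real.exp_nat_mul, mul_left_comm, ← Real.exp_add, mul_assoc, ← Real.exp_add]
    ring_nf
  have hr : Real.exp (-(1 / 4)) < 1 := by rw [Real.exp_lt_one_iff]; norm_num
  have hs := (hasSum_geometric_of_lt_one (Real.exp_pos _).le hr).mul_left (2 * Real.exp (1 / 4))
  simp_rw [e]
  rw [← ENNReal.ofReal_tsum_of_nonneg (fun k => by positivity) hs.summable, hs.tsum_eq]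
  have h1 : (5 / 4 : ℝ) ≤ Real.exp (1 / 4) := by
    have := Real.add_one_le_exp (1 / 4 : ℝ); linarith
  have h2 : Real.exp (1 / 4) ≤ 3 := by
    have : Real.exp (1 / 4) ≤ Real.exp 1 := Real.exp_le_exp.2 (by norm_num)
    linarith [Real.exp_one_lt_d9]
  rw [Real.exp_neg] at hr ⊢
  set u := Real.exp (1 / 4)
  have : 2 * u * (1 - u⁻¹)⁻¹ ≤ 16 := by
    rw [← div_eq_mul_inv, div_le_iff₀ (by linarith)]
    have hu : u * u⁻¹ = 1 := mul_inv_cancel₀ (by positivity)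
    have : u⁻¹ ≤ 4 / 5 := by
      rw [inv_le_comm₀ (by positivity) (by norm_num)]; linarith
    nlinarith
  calc _ ≤ ENNReal.ofReal 16 := ENNReal.ofReal_le_ofReal this
    _ = 16 := by simp

/-- With z = ⟨X, θ⟩² / s², the value e^(z/4) is at most e^((k+1)/4) for k = ⌊z⌋, and z ≥ k has
probability at most 2 e^(-k/2) by the subgaussian tail. -/
theorem tsum_exp_sq_le_of_norm_eq_one {ν : PMF A} {g : A → RSpace n} {s : ℝ} (hs : 0 < s)
    (hν : IsSubgaussian (ν.map g) s) {θ : RSpace n} (hθ : ‖θ‖ = 1) :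
    ∑' x, ν x * ENNReal.ofReal (Real.exp ((inner ℝ (g x) θ) ^ 2 / (4 * s ^ 2))) ≤ 16 := by
  classical
  set S : ℕ → Set (RSpace n) := fun k => {y | s * Real.sqrt k ≤ |inner ℝ y θ|}
  have h1 : ∀ x, ENNReal.ofReal (Real.exp ((inner ℝ (g x) θ) ^ 2 / (4 * s ^ 2))) ≤
      ∑' k : ℕ, ENNReal.ofReal (Real.exp (((k : ℝ) + 1) / 4)) *
        (g ⁻¹' S k).indicator (fun _ => 1) x := by
    intro x
    set z := (inner ℝ (g x) θ) ^ 2 / s ^ 2 with hz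
    have hz0 : 0 ≤ z := by positivity
    refine le_trans ?_ (ENNReal.le_tsum ⌊z⌋₊)
    have hmem : x ∈ g ⁻¹' S ⌊z⌋₊ := by
      simp only [S, Set.mem_preimage, Set.mem_ofPred_eq]
      rw [← Real.sqrt_sq hs.le, ← Real.sqrt_mul (sq_nonneg s), ← Real.sqrt_sq_eq_abs]
      apply Real.sqrt_le_sqrt
      have := Nat.floor_le hz0
      rw [hz, le_div_iff₀ (by positivity)] at this
      linarith
    rw [Set.indicator_of_mem hmem, mul_one]
    refine ENNReal.ofReal_le_ofReal (Real.exp_le_exp.2 ?_)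
    have : (inner ℝ (g x) θ) ^ 2 / (4 * s ^ 2) = z / 4 := by rw [hz]; field_simp
    rw [this]
    have := (Nat.lt_floor_add_one z).le
    linarith
  calc _ ≤ ∑' x, ν x * ∑' k : ℕ, ENNReal.ofReal (Real.exp (((k : ℝ) + 1) / 4)) *
        (g ⁻¹' S k).indicator (fun _ => 1) x := by gcongr; exact h1 _
    _ = ∑' k : ℕ, ENNReal.ofReal (Real.exp (((k : ℝ) + 1) / 4)) *
        (ν.map g).toOuterMeasure (S k) := by
      simp_rw [← ENNReal.tsum_mul_left]
      rw [ENNReal.tsum_comm]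
      refine tsum_congr fun k => ?_
      rw [PMF.toOuterMeasure_map_apply, PMF.toOuterMeasure_apply, ← ENNReal.tsum_mul_left]
      refine tsum_congr fun x => ?_
      by_cases hx : x ∈ g ⁻¹' S k
      · simp [Set.indicator_of_mem hx, mul_comm]
      · simp [Set.indicator_of_notMem hx]
    _ ≤ ∑' k : ℕ, ENNReal.ofReal (Real.exp (((k : ℝ) + 1) / 4) * (2 * Real.exp (-(k : ℝ) / 2))) := by
      refine ENNReal.tsum_le_tsum fun k => ?_
      rw [ENNReal.ofReal_mul (Real.exp_pos _).le]
      gcongr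
      have := hν θ hθ (s * Real.sqrt k) (by positivity)
      rwa [mul_div_cancel_left₀ _ hs.ne', Real.sq_sqrt (Nat.cast_nonneg k)] at this
    _ ≤ 16 := exp_quarter_series

/-- Shortening θ only decreases the exponent. The whole unit ball is needed because the
concentration argument integrates over it. -/
theorem tsum_exp_sq_le {ν : PMF A} {g : A → RSpace n} {s : ℝ} (hs : 0 < s)
    (hν : IsSubgaussian (ν.map g) s) {θ : RSpace n} (hθ : ‖θ‖ ≤ 1) :
    ∑' x, ν x * ENNReal.ofReal (Real.exp ((inner ℝ (g x) θ) ^ 2 / (4 * s ^ 2))) ≤ 16 := by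
  rcases eq_or_ne θ 0 with rfl | h0
  · simp only [inner_zero_right]
    simp [ν.tsum_coe]
  have hpos : 0 < ‖θ‖ := norm_pos_iff.2 h0
  have h1 : ‖(‖θ‖⁻¹ • θ)‖ = 1 := by
    rw [norm_smul, norm_inv, norm_norm, inv_mul_cancel₀ hpos.ne']
  refine le_trans ?_ (tsum_exp_sq_le_of_norm_eq_one hs hν h1)
  refine ENNReal.tsum_le_tsum fun x => ?_
  gcongr ν x * ENNReal.ofReal (Real.exp (?_ / _))
  rw [inner_smul_right, mul_pow]
  refine le_mul_of_one_le_left (sq_nonneg _) (one_le_pow₀ ?_)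
  exact (one_le_inv₀ hpos).2 hθ

/-! ### The empirical quadratic form of the samples -/

/-- The quadratic form `θ ↦ ∑_x ⟨x, θ⟩²`. -/
noncomputable def sumSq (l : List (RSpace n)) (θ : RSpace n) : ℝ :=
  (l.map fun x => (inner ℝ x θ) ^ 2).sum

theorem sumSq_nonneg (l : List (RSpace n)) (θ : RSpace n) : 0 ≤ sumSq l θ :=
  List.sum_nonneg fun x hx => by
    obtain ⟨y, -, rfl⟩ := List.mem_map.1 hx
    positivity

theorem sumSq_smul (l : List (RSpace n)) (c : ℝ) (θ : RSpace n) :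
    sumSq l (c • θ) = c ^ 2 * sumSq l θ := by
  unfold sumSq
  rw [← List.sum_map_mul_left]
  simp [inner_smul_right, mul_pow]

theorem sumSq_add_le (l : List (RSpace n)) (θ θ' : RSpace n) :
    sumSq l (θ + θ') ≤ 2 * sumSq l θ + 2 * sumSq l θ' := by
  unfold sumSq
  rw [← List.sum_map_mul_left, ← List.sum_map_mul_left, ← List.sum_map_add]
  refine List.sum_le_sum fun x _ => ?_
  rw [inner_add_right]
  nlinarith [sq_nonneg (inner ℝ x θ - inner ℝ x θ' : ℝ)]

theorem continuous_sumSq (l : List (RSpace n)) : Continuous (sumSq l) := by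
  unfold sumSq
  induction l with
  | nil => simp only [List.map_nil, List.sum_nil]; exact continuous_const
  | cons x l ih => simp only [List.map_cons, List.sum_cons]; fun_prop

/-- Let u maximize the form Q on the unit sphere, with M = Q(u), and put v = (3/4) u. For w within
1/4 of v, Q(v) ≤ 2 Q(w) + 2 Q(v - w) reads 9M/16 ≤ 2 Q(w) + M/8, hence Q(w) ≥ 7M/32. -/
theorem exists_ball_sumSq_ge {l : List (RSpace n)} {T : ℝ} {θ : RSpace n}
    (h : T * ‖θ‖ ^ 2 < sumSq l θ) :
    ∃ v : RSpace n, Metric.ball v (1 / 4) ⊆ Metric.ball 0 1 ∧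
      ∀ w ∈ Metric.ball v (1 / 4), 7 / 32 * T ≤ sumSq l w := by
  have h0 : θ ≠ 0 := by
    rintro rfl
    simp [sumSq] at h
  have hpos : 0 < ‖θ‖ := norm_pos_iff.2 h0
  have hunit : ‖θ‖⁻¹ • θ ∈ Metric.sphere (0 : RSpace n) 1 := by
    rw [mem_sphere_zero_iff_norm, norm_smul, norm_inv, norm_norm, inv_mul_cancel₀ hpos.ne']
  obtain ⟨u, hu, hmax⟩ := (isCompact_sphere (0 : RSpace n) 1).exists_isMaxOn ⟨_, hunit⟩
    (continuous_sumSq l).continuousOn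
  rw [mem_sphere_zero_iff_norm] at hu
  have hle : ∀ w, sumSq l w ≤ sumSq l u * ‖w‖ ^ 2 := by
    intro w
    rcases eq_or_ne w 0 with rfl | hw
    · simp [sumSq]
    have hw' : 0 < ‖w‖ := norm_pos_iff.2 hw
    have hm : ‖w‖⁻¹ • w ∈ Metric.sphere (0 : RSpace n) 1 := by
      rw [mem_sphere_zero_iff_norm, norm_smul, norm_inv, norm_norm, inv_mul_cancel₀ hw'.ne']
    have := hmax hm
    simp only [Set.mem_ofPred_eq, sumSq_smul] at this
    rw [inv_pow, inv_mul_le_iff₀ (by positivity)] at this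
    linarith
  have hT : T ≤ sumSq l u := by
    have := hle θ
    have h2 : 0 < ‖θ‖ ^ 2 := by positivity
    exact (lt_of_mul_lt_mul_right (h.trans_le this) h2.le).le
  refine ⟨(3 / 4 : ℝ) • u, fun w hw => ?_, fun w hw => ?_⟩
  · rw [mem_ball_iff_norm] at hw
    rw [mem_ball_zero_iff]
    have h1 : ‖(3 / 4 : ℝ) • u‖ = 3 / 4 := by rw [norm_smul, hu]; norm_num
    have := norm_add_le (w - (3 / 4 : ℝ) • u) ((3 / 4 : ℝ) • u)
    rw [sub_add_cancel] at this
    linarith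
  · rw [mem_ball_iff_norm'] at hw
    have h1 := sumSq_add_le l w ((3 / 4 : ℝ) • u - w)
    rw [add_sub_cancel, sumSq_smul] at h1
    have h2 := hle ((3 / 4 : ℝ) • u - w)
    have h3 : ‖(3 / 4 : ℝ) • u - w‖ ^ 2 ≤ (1 / 4) ^ 2 := pow_le_pow_left₀ (norm_nonneg _) hw.le 2
    have h4 := sumSq_nonneg l u
    nlinarith

theorem prod_ofReal_exp (l : List (RSpace n)) (s : ℝ) (θ : RSpace n) :
    (l.map fun x => ENNReal.ofReal (Real.exp ((inner ℝ x θ) ^ 2 / (4 * s ^ 2)))).prod =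
      ENNReal.ofReal (Real.exp (sumSq l θ / (4 * s ^ 2))) := by
  unfold sumSq
  induction l with
  | nil => simp
  | cons x l ih =>
    simp only [List.map_cons, List.prod_cons, List.sum_cons, ih]
    rw [← ENNReal.ofReal_mul (Real.exp_pos _).le, ← Real.exp_add, add_div]

-- Fubini replaces a union bound over a net: the expected integral over the unit ball of exp(Q /
-- 4s²) is at most 16ⁿ times its volume, while each bad list contributes at least e^(7n) on a ball
-- of 4⁻ⁿ times that volume.
open MeasureTheory in
theorem iidSamples_sumSq [Countable A] {ν : PMF A} {g : A → RSpace n} {s : ℝ} (hs : 0 < s)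
    (hν : IsSubgaussian (ν.map g) s) :
    (iidSamples ν n).toOuterMeasure
      {l | ∃ θ, 128 * n * s ^ 2 * ‖θ‖ ^ 2 < sumSq (l.map g) θ} ≤
      ENNReal.ofReal (Real.exp (-(n : ℝ))) := by
  classical
  set p := iidSamples ν n
  set bad : Set (List A) := {l | ∃ θ, 128 * n * s ^ 2 * ‖θ‖ ^ 2 < sumSq (l.map g) θ} with hbad
  set B : Set (RSpace n) := Metric.ball 0 1
  set V : ℝ≥0∞ := volume B
  set F : List A → RSpace n → ℝ≥0∞ := fun l θ =>
    ENNReal.ofReal (Real.exp (sumSq (l.map g) θ / (4 * s ^ 2))) with hF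
  have hV0 : V ≠ 0 := (Metric.measure_ball_pos volume (0 : RSpace n) one_pos).ne'
  have hVt : V ≠ ∞ := measure_ball_lt_top.ne
  have hmeas : ∀ l, Measurable (F l) := fun l => by
    refine ENNReal.measurable_ofReal.comp (Real.measurable_exp.comp ?_)
    exact (continuous_sumSq _).measurable.div_const _
  -- The exponent is (7/32) · 128 n s² / (4 s²) = 7n.
  have h1 : ∀ l ∈ bad, ENNReal.ofReal (Real.exp (7 * n)) * (ENNReal.ofReal ((1 / 4) ^ n) * V) ≤
      ∫⁻ θ in B, F l θ := by
    rintro l ⟨θ, hθ⟩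
    obtain ⟨v, hv, hw⟩ := exists_ball_sumSq_ge hθ
    have hvol : volume (Metric.ball v (1 / 4)) = ENNReal.ofReal ((1 / 4) ^ n) * V := by
      rw [Measure.addHaar_ball_of_pos _ _ (by norm_num), finrank_euclideanSpace_fin]
    calc _ = ∫⁻ _ in Metric.ball v (1 / 4), ENNReal.ofReal (Real.exp (7 * n)) := by
          rw [setLIntegral_const, hvol]
      _ ≤ ∫⁻ θ in Metric.ball v (1 / 4), F l θ := by
          refine setLIntegral_mono (hmeas l) fun w hw' => ?_
          refine ENNReal.ofReal_le_ofReal (Real.exp_le_exp.2 ?_)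
          rw [le_div_iff₀ (by positivity)]
          have := hw w hw'
          linarith
      _ ≤ _ := lintegral_mono_set hv
  have h2 : ∀ θ ∈ B, ∑' l, p l * F l θ ≤ 16 ^ n := by
    intro θ hθ
    have h := tsum_iidSamples_mul ν
      (fun x => ENNReal.ofReal (Real.exp ((inner ℝ (g x) θ) ^ 2 / (4 * s ^ 2)))) n
    have h' : ∀ l : List A, (l.map fun x =>
        ENNReal.ofReal (Real.exp ((inner ℝ (g x) θ) ^ 2 / (4 * s ^ 2)))).prod = F l θ := by
      intro l
      simp only [hF]; rw [← prod_ofReal_exp, List.map_map]; rfl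
    simp_rw [h'] at h
    rw [h]
    exact pow_le_pow_left' (tsum_exp_sq_le hs hν (mem_ball_zero_iff.1 hθ).le) n
  have h3 : p.toOuterMeasure bad *
      (ENNReal.ofReal (Real.exp (7 * n)) * (ENNReal.ofReal ((1 / 4) ^ n) * V)) ≤ 16 ^ n * V := by
    rw [PMF.toOuterMeasure_apply, ← ENNReal.tsum_mul_right]
    calc _ ≤ ∑' l, p l * ∫⁻ θ in B, F l θ := by
          refine ENNReal.tsum_le_tsum fun l => ?_
          by_cases hl : l ∈ bad
          · rw [Set.indicator_of_mem hl]; gcongr; exact h1 l hl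
          · simp [Set.indicator_of_notMem hl]
      _ = ∫⁻ θ in B, ∑' l, p l * F l θ := by
          rw [lintegral_tsum fun l => ((hmeas l).const_mul _).aemeasurable]
          refine tsum_congr fun l => ?_
          rw [lintegral_const_mul _ (hmeas l)]
      _ ≤ ∫⁻ _ in B, 16 ^ n := setLIntegral_mono measurable_const h2
      _ = 16 ^ n * V := by rw [setLIntegral_const]
  rw [← mul_assoc, ← mul_assoc, ENNReal.mul_le_mul_iff_left hV0 hVt,
    mul_assoc, ← ENNReal.ofReal_mul (Real.exp_pos _).le] at h3
  have h4 : (16 : ℝ≥0∞) ^ n = ENNReal.ofReal (16 ^ n) := by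
    rw [ENNReal.ofReal_pow (by norm_num)]; simp
  rw [h4, ← ENNReal.le_div_iff_mul_le (Or.inl (by simp; positivity)) (Or.inl (by simp)),
    ← ENNReal.ofReal_div_of_pos (by positivity)] at h3
  refine h3.trans (ENNReal.ofReal_le_ofReal ?_)
  rw [div_le_iff₀ (by positivity), ← mul_assoc, ← Real.exp_add, one_div, inv_pow,
    ← div_eq_mul_inv, le_div_iff₀ (by positivity), ← mul_pow]
  -- What remains is (16 · 4)ⁿ ≤ e^(6n), true because 64 = 2⁶ and e ≥ 2.
  have : -(n : ℝ) + 7 * n = n * 6 := by ring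
  rw [this, Real.exp_nat_mul]
  refine pow_le_pow_left₀ (by norm_num) ?_ n
  have h6 : (2 : ℝ) ^ 6 ≤ Real.exp 1 ^ 6 :=
    pow_le_pow_left₀ (by norm_num) (by linarith [Real.add_one_le_exp (1 : ℝ)]) 6
  rw [← Real.exp_nat_mul] at h6
  norm_num at h6 ⊢
  exact h6

end Concentration

/-! ### Matrices -/

section Matrices

open Matrix

variable {n : ℕ}

theorem isHermitian_gram (V : Matrix (Fin n) (Fin n) ℝ) : (Vᵀ * V).IsHermitian := by
  have := Matrix.isHermitian_conjTranspose_mul_self V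
  rwa [Matrix.conjTranspose_eq_transpose_of_trivial] at this

theorem Matrix.IsHermitian.trace_pow {S : Matrix (Fin n) (Fin n) ℝ} (hS : S.IsHermitian) (k : ℕ) :
    (S ^ k).trace = ∑ i, hS.eigenvalues i ^ k := by
  conv_lhs => rw [hS.spectral_theorem, ← map_pow, Unitary.conjStarAlgAut_apply,
    Matrix.trace_mul_cycle, Unitary.coe_star_mul_self, one_mul, Matrix.diagonal_pow,
    Matrix.trace_diagonal]
  rfl

theorem dotProduct_gram (V : Matrix (Fin n) (Fin n) ℝ) (θ : Fin n → ℝ) :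
    θ ⬝ᵥ ((Vᵀ * V) *ᵥ θ) = ∑ r, (V *ᵥ θ) r ^ 2 := by
  rw [← Matrix.mulVec_mulVec, Matrix.dotProduct_mulVec, Matrix.vecMul_transpose]
  simp [dotProduct, sq]

theorem eigenvalues_gram (V : Matrix (Fin n) (Fin n) ℝ) (i : Fin n) :
    ∃ v : Fin n → ℝ, ∑ j, v j ^ 2 = 1 ∧
      (isHermitian_gram V).eigenvalues i = ∑ r, (V *ᵥ v) r ^ 2 := by
  refine ⟨(isHermitian_gram V).eigenvectorBasis i, ?_, ?_⟩
  · have := (isHermitian_gram V).eigenvectorBasis.norm_eq_one i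
    rw [EuclideanSpace.norm_eq, Real.sqrt_eq_one] at this
    simpa using this
  · rw [(isHermitian_gram V).eigenvalues_eq, ← dotProduct_gram]
    simp

/-- The eigenvalues of VᵀV are non-negative, so each n-th power is at most the trace of (VᵀV)ⁿ. Thus
all eigenvalues are at most T and T - VᵀV is positive semidefinite. -/
theorem sum_mulVec_sq_le_of_trace_le {V : Matrix (Fin n) (Fin n) ℝ} {T : ℝ} (hT : 0 ≤ T)
    (hn : n ≠ 0) (h : ((Vᵀ * V) ^ n).trace ≤ T ^ n) (θ : Fin n → ℝ) :
    ∑ r, (V *ᵥ θ) r ^ 2 ≤ T * ∑ j, θ j ^ 2 := by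
  have hS := isHermitian_gram V
  have hnn : ∀ i, 0 ≤ hS.eigenvalues i := fun i => by
    obtain ⟨v, -, hv⟩ := eigenvalues_gram V i
    rw [hv]; positivity
  have hle : ∀ i, hS.eigenvalues i ≤ T := fun i => by
    refine le_of_pow_le_pow_left₀ hn hT ?_
    rw [hS.trace_pow] at h
    exact (Finset.single_le_sum (f := fun i => hS.eigenvalues i ^ n)
      (fun i _ => pow_nonneg (hnn i) n) (Finset.mem_univ i)).trans h
  have hpos : (T • (1 : Matrix (Fin n) (Fin n) ℝ) - Vᵀ * V).PosSemidef := by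
    have hd : (Matrix.diagonal fun i => T - hS.eigenvalues i).PosSemidef :=
      Matrix.PosSemidef.diagonal fun i => sub_nonneg.2 (hle i)
    have h1 := hd.mul_mul_conjTranspose_same
      (hS.eigenvectorUnitary : Matrix (Fin n) (Fin n) ℝ)
    have h2 : (Matrix.diagonal fun i => T - hS.eigenvalues i) =
        T • (1 : Matrix (Fin n) (Fin n) ℝ) - Matrix.diagonal (RCLike.ofReal ∘ hS.eigenvalues) := by
      ext i j
      by_cases hij : i = j
      · subst hij; simp
      · simp [hij]
    have h3 := hS.spectral_theorem
    rw [Unitary.conjStarAlgAut_apply] at h3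
    rw [h2, mul_sub, sub_mul, ← Matrix.star_eq_conjTranspose, ← h3] at h1
    simpa using h1
  have := hpos.dotProduct_mulVec_nonneg θ
  rw [Matrix.sub_mulVec, dotProduct_sub, star_trivial, dotProduct_gram, Matrix.smul_mulVec,
    Matrix.one_mulVec, dotProduct_smul, smul_eq_mul] at this
  simp only [dotProduct, ← sq] at this
  linarith

/-- An approximate converse of the previous bound: n eigenvalues contribute at most n Tⁿ ≤ (2T)ⁿ. -/
theorem trace_gram_pow_le {V : Matrix (Fin n) (Fin n) ℝ} {T : ℝ} (hT : 0 ≤ T)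
    (h : ∀ θ : Fin n → ℝ, ∑ r, (V *ᵥ θ) r ^ 2 ≤ T * ∑ j, θ j ^ 2) :
    ((Vᵀ * V) ^ n).trace ≤ (2 * T) ^ n := by
  have hS := isHermitian_gram V
  rw [hS.trace_pow]
  have hle : ∀ i, hS.eigenvalues i ^ n ≤ T ^ n := fun i => by
    obtain ⟨v, hv1, hv⟩ := eigenvalues_gram V i
    have := h v
    rw [hv1, mul_one] at this
    refine pow_le_pow_left₀ ?_ ?_ n <;> rw [hv]
    · positivity
    · exact this
  calc _ ≤ ∑ _i : Fin n, T ^ n := Finset.sum_le_sum fun i _ => hle i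
    _ = n * T ^ n := by simp
    _ ≤ 2 ^ n * T ^ n := by
      gcongr
      exact_mod_cast (Nat.lt_two_pow_self).le
    _ = _ := (mul_pow _ _ _).symm

/-! ### The inverse of an integer matrix -/

theorem abs_adjugate_le {B : Matrix (Fin n) (Fin n) ℝ} {β : ℝ} (hβ : 1 ≤ β)
    (hB : ∀ i j, |B i j| ≤ β) (i j : Fin n) : |B.adjugate i j| ≤ (n * β) ^ n := by
  rw [Matrix.adjugate_apply]
  have h := Matrix.det_le (abv := AbsoluteValue.abs (S := ℝ)) (A := B.updateRow j (Pi.single i 1))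
    (x := β) (fun k l => by
      rw [AbsoluteValue.abs_apply, Matrix.updateRow_apply]
      split_ifs with hk
      · by_cases hl : l = i
        · subst hl; simpa using hβ
        · simp [hl]; linarith
      · exact hB k l)
  rw [AbsoluteValue.abs_apply, Fintype.card_fin, nsmul_eq_mul] at h
  refine h.trans ?_
  rw [mul_pow]
  have : (n.factorial : ℝ) ≤ (n : ℝ) ^ n := by exact_mod_cast Nat.factorial_le_pow n
  gcongr

/-- Cramer's rule: the inverse is the adjugate divided by a non-zero integer, so the adjugate bounds
it. -/
theorem abs_le_of_mulVec {B : Matrix (Fin n) (Fin n) ℤ} (hdet : B.det ≠ 0) {β : ℝ} (hβ : 1 ≤ β)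
    (hB : ∀ i j, |(B i j : ℝ)| ≤ β) (c : Fin n → ℝ) (i : Fin n) :
    |c i| ≤ (n * β) ^ n * ∑ j, |(B.map (Int.cast : ℤ → ℝ) *ᵥ c) j| := by
  set C : Matrix (Fin n) (Fin n) ℝ := B.map (Int.cast : ℤ → ℝ) with hC
  have hd : C.det = (B.det : ℝ) := by
    rw [hC]; exact (RingHom.map_det (Int.castRingHom ℝ) B).symm
  have h1 : (1 : ℝ) ≤ |C.det| := by
    rw [hd]; exact_mod_cast Int.one_le_abs hdet
  have h2 : C.det • c = C.adjugate *ᵥ (C *ᵥ c) := by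
    rw [Matrix.mulVec_mulVec, Matrix.adjugate_mul, Matrix.smul_mulVec, Matrix.one_mulVec]
  have h3 : C.det * c i = ∑ j, C.adjugate i j * (C *ᵥ c) j := congr_fun h2 i
  calc |c i| ≤ |C.det| * |c i| := le_mul_of_one_le_left (abs_nonneg _) h1
    _ = |∑ j, C.adjugate i j * (C *ᵥ c) j| := by rw [← abs_mul, h3]
    _ ≤ ∑ j, |C.adjugate i j| * |(C *ᵥ c) j| := by
      refine (Finset.abs_sum_le_sum_abs _ _).trans (le_of_eq ?_)
      simp [abs_mul]
    _ ≤ ∑ j, (n * β) ^ n * |(C *ᵥ c) j| := by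
      gcongr with j
      exact abs_adjugate_le hβ (fun k l => by simpa [hC] using hB k l) i j
    _ = _ := by rw [Finset.mul_sum]

end Matrices

/-! ### The lattice of an input -/

section Lattice

open Matrix

namespace LatticeInput

variable (I : LatticeInput)

/-- A column of the basis. -/
noncomputable def col (j : Fin I.n) : RSpace I.n := I.point fun i => I.basis i j

theorem den_ne_zero : (I.den : ℝ) ≠ 0 := by exact_mod_cast I.den_pos.ne'

theorem s_pos : 0 < I.s :=
  div_pos (by exact_mod_cast I.num_pos) (by exact_mod_cast I.den_pos)

theorem sum_smul_col (c : Fin I.n → ℝ) :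
    ∑ j, c j • I.col j = WithLp.toLp 2 fun i =>
      (I.basis.map (Int.cast : ℤ → ℝ) *ᵥ c) i / (I.den : ℝ) := by
  ext i
  simp only [col, point, WithLp.ofLp_sum, WithLp.ofLp_smul, Finset.sum_apply, Pi.smul_apply,
    smul_eq_mul, Matrix.mulVec, dotProduct, Matrix.map_apply, Finset.sum_div]
  exact Finset.sum_congr rfl fun j _ => by ring

theorem linearIndependent_col : LinearIndependent ℝ I.col := by
  rw [Fintype.linearIndependent_iff]
  intro c hc
  have hdet : (I.basis.map (Int.cast : ℤ → ℝ)).det ≠ 0 := by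
    have : (I.basis.map (Int.cast : ℤ → ℝ)).det = (I.basis.det : ℝ) :=
      (RingHom.map_det (Int.castRingHom ℝ) I.basis).symm
    rw [this]; exact_mod_cast I.basis_det
  have h0 : I.basis.map (Int.cast : ℤ → ℝ) *ᵥ c = 0 := by
    rw [sum_smul_col] at hc
    ext i
    have := congr_fun (congr_arg WithLp.ofLp hc) i
    simpa [I.den_ne_zero] using this
  exact fun i => congr_fun (Matrix.eq_zero_of_mulVec_eq_zero hdet h0) i

/-- The columns as a basis of the space. -/
noncomputable def colBasis : Module.Basis (Fin I.n) ℝ (RSpace I.n) :=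
  haveI : Nonempty (Fin I.n) := ⟨⟨0, I.n_pos⟩⟩
  basisOfLinearIndependentOfCardEqFinrank I.linearIndependent_col (by simp)

theorem colBasis_apply (j : Fin I.n) : I.colBasis j = I.col j := by
  simp [colBasis]

theorem lattice_eq : I.lattice = Submodule.span ℤ (Set.range I.colBasis) := by
  unfold lattice
  congr 2
  funext j
  rw [colBasis_apply]; rfl

instance discreteTopology_lattice : DiscreteTopology I.lattice := by
  rw [lattice_eq]; infer_instance

instance isZLattice_lattice : IsZLattice ℝ I.lattice := by
  refine ⟨?_⟩
  rw [lattice_eq]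
  exact (inferInstance : IsZLattice ℝ (Submodule.span ℤ (Set.range I.colBasis))).span_top

theorem span_lattice : Submodule.span ℝ (I.lattice : Set (RSpace I.n)) = ⊤ :=
  IsZLattice.span_top

theorem mem_lattice {v : RSpace I.n} :
    v ∈ I.lattice ↔ ∃ z : Fin I.n → ℤ, v = I.point (I.basis *ᵥ z) := by
  have key : ∀ z : Fin I.n → ℤ, ∑ j, z j • I.col j = I.point (I.basis *ᵥ z) := by
    intro z
    have : ∀ j, z j • I.col j = (z j : ℝ) • I.col j := fun j => (Int.cast_smul_eq_zsmul ℝ _ _).symm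
    simp_rw [this]
    rw [sum_smul_col, point]
    congr 1
    ext i
    simp [Matrix.mulVec, dotProduct]
  unfold lattice
  rw [Submodule.mem_span_range_iff_exists_fun]
  exact ⟨fun ⟨z, hz⟩ => ⟨z, by rw [← hz, ← key]; rfl⟩, fun ⟨z, hz⟩ => ⟨z, by rw [hz, ← key]; rfl⟩⟩

end LatticeInput

/-! ### The smoothing parameter -/

variable {n : ℕ}

/-- The set that consists of the smoothing parameter. -/
def smoothingSet (ε : ℝ) (L : Submodule ℤ (RSpace n)) : Set ℝ := {s : ℝ | 0 < s ∧
  HasSum (fun y : dualLattice L => Real.exp (-Real.pi * ‖s • (y : RSpace n)‖ ^ 2)) (1 + ε)}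

theorem zero_mem_dualLattice (L : Submodule ℤ (RSpace n)) : (0 : RSpace n) ∈ dualLattice L :=
  ⟨Submodule.zero_mem _, fun x _ => ⟨0, by simp⟩⟩

/-- If s' > c s, each Gaussian term of y at s' is at most that of φ y at s, strictly for y ≠ 0. By
injectivity of φ the sum for L' would be below 1 + ε. With φ the identity this is uniqueness of the
smoothing parameter. -/
theorem le_of_mem_smoothingSet {ε : ℝ} (hε : 0 < ε) {L L' : Submodule ℤ (RSpace n)}
    (φ : dualLattice L' → dualLattice L) (hφ : Function.Injective φ) {c : ℝ} (hc : 0 < c)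
    (hle : ∀ y, ‖(φ y : RSpace n)‖ ≤ c * ‖(y : RSpace n)‖) {s s' : ℝ}
    (hs : s ∈ smoothingSet ε L) (hs' : s' ∈ smoothingSet ε L') : s' ≤ c * s := by
  by_contra! hlt
  have hsum := hs.2.summable.comp_injective hφ
  have hle1 : ∑' y, Real.exp (-Real.pi * ‖s • (φ y : RSpace n)‖ ^ 2) ≤ 1 + ε := by
    rw [← hs.2.tsum_eq]
    exact tsum_comp_le_tsum_of_inj hs.2.summable (fun _ => (Real.exp_pos _).le) hφ
  -- A trivial dual lattice would have the sum 1 instead of 1 + ε.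
  have hnz : ∃ y : dualLattice L', (y : RSpace n) ≠ 0 := by
    by_contra! h
    have h1 : ∀ y : dualLattice L', y ≠ ⟨0, zero_mem_dualLattice L'⟩ →
        Real.exp (-Real.pi * ‖s' • (y : RSpace n)‖ ^ 2) = 0 :=
      fun y hy => absurd (Subtype.ext (h y)) hy
    have := (hasSum_single _ h1).unique hs'.2
    simp at this
    linarith
  obtain ⟨y₀, hy₀⟩ := hnz
  have hcmp : ∀ y : dualLattice L', ‖s • (φ y : RSpace n)‖ ≤ (c * s) * ‖(y : RSpace n)‖ := by
    intro y
    rw [norm_smul, Real.norm_of_nonneg hs.1.le]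
    nlinarith [mul_le_mul_of_nonneg_left (hle y) hs.1.le]
  have hnn : 0 ≤ c * s := (mul_pos hc hs.1).le
  have hlt2 := hasSum_lt (i := y₀) (fun y => ?_) ?_ hs'.2 hsum.hasSum
  · exact absurd hlt2 (not_lt.2 hle1)
  · refine Real.exp_le_exp.2 (mul_le_mul_of_nonpos_left ?_ (by linarith [Real.pi_pos]))
    refine pow_le_pow_left₀ (norm_nonneg _) ((hcmp y).trans ?_) 2
    rw [norm_smul, Real.norm_of_nonneg hs'.1.le]
    gcongr
  · refine Real.exp_lt_exp.2 (mul_lt_mul_of_neg_left ?_ (by linarith [Real.pi_pos]))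
    refine pow_lt_pow_left₀ ((hcmp y₀).trans_lt ?_) (norm_nonneg _) two_ne_zero
    rw [norm_smul, Real.norm_of_nonneg hs'.1.le]
    have := norm_pos_iff.2 hy₀
    gcongr

theorem smoothingSet_subsingleton {ε : ℝ} (hε : 0 < ε) {L : Submodule ℤ (RSpace n)} {s s' : ℝ}
    (hs : s ∈ smoothingSet ε L) (hs' : s' ∈ smoothingSet ε L) : s = s' := by
  have h1 := le_of_mem_smoothingSet hε id Function.injective_id one_pos (by simp) hs hs'
  have h2 := le_of_mem_smoothingSet hε id Function.injective_id one_pos (by simp) hs' hs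
  linarith

theorem smoothingParam_eq {ε : ℝ} (hε : 0 < ε) {L : Submodule ℤ (RSpace n)} {s : ℝ}
    (hs : s ∈ smoothingSet ε L) : smoothingParam ε L = s := by
  have : smoothingSet ε L = {s} :=
    Set.eq_singleton_iff_unique_mem.2 ⟨hs, fun t ht => smoothingSet_subsingleton hε ht hs⟩
  change sInf (smoothingSet ε L) = s
  rw [this, csInf_singleton]

theorem smoothingParam_le {ε : ℝ} (hε : 0 < ε) {L L' : Submodule ℤ (RSpace n)}
    (φ : dualLattice L' → dualLattice L) (hφ : Function.Injective φ) {c : ℝ} (hc : 0 < c)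
    (hle : ∀ y, ‖(φ y : RSpace n)‖ ≤ c * ‖(y : RSpace n)‖) {s : ℝ}
    (hs : s ∈ smoothingSet ε L) : smoothingParam ε L' ≤ c * s := by
  -- Existence for L' is not required: the infimum of the empty set is 0, which satisfies the bound.
  rcases (smoothingSet ε L').eq_empty_or_nonempty with h | ⟨s', hs'⟩
  · change sInf (smoothingSet ε L') ≤ _
    rw [h, Real.sInf_empty]
    exact (mul_pos hc hs.1).le
  · rw [smoothingParam_eq hε hs']
    exact le_of_mem_smoothingSet hε φ hφ hc hle hs hs'

/-! ### Existence of the smoothing parameter -/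

theorem summable_exp_neg_mul_sq {a : ℝ} (ha : 0 < a) :
    Summable fun k : ℤ => Real.exp (-a * (k : ℝ) ^ 2) := by
  have h : Summable fun k : ℕ => Real.exp (-a * (k : ℝ) ^ 2) := by
    refine Summable.of_nonneg_of_le (fun _ => (Real.exp_pos _).le) (fun k => ?_)
      (Real.summable_exp_nat_mul_iff.2 (neg_lt_zero.2 ha))
    refine Real.exp_le_exp.2 ?_
    have : (k : ℝ) ≤ (k : ℝ) ^ 2 := by exact_mod_cast Nat.le_self_pow two_ne_zero k
    nlinarith
  exact Summable.of_nat_of_neg (by simpa using h) (by simpa using h)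

theorem summable_pi_prod {g : ℤ → ℝ} (h0 : ∀ k, 0 ≤ g k) (hg : Summable g) :
    Summable fun k : Fin n → ℤ => ∏ j, g (k j) := by
  classical
  refine summable_of_sum_le (c := (∑' k, g k) ^ n) (fun k => Finset.prod_nonneg fun j _ => h0 _) ?_
  intro u
  calc ∑ k ∈ u, ∏ j, g (k j) ≤ ∑ k ∈ Fintype.piFinset fun j => u.image fun k => k j,
        ∏ j, g (k j) := by
        refine Finset.sum_le_sum_of_subset_of_nonneg (fun k hk => ?_)
          fun k _ _ => Finset.prod_nonneg fun j _ => h0 _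
        exact Fintype.mem_piFinset.2 fun j => Finset.mem_image_of_mem _ hk
    _ = ∏ j, ∑ m ∈ u.image fun k => k j, g m :=
        (Finset.prod_univ_sum _ fun _ m => g m).symm
    _ ≤ ∏ _j : Fin n, ∑' k, g k := Finset.prod_le_prod
        (fun j _ => Finset.sum_nonneg fun _ _ => h0 _) fun j _ => hg.sum_le_tsum _ fun _ _ => h0 _
    _ = _ := by simp

/-- The pairings with the basis embed the dual lattice into ℤⁿ, and by Cauchy–Schwarz the sum of
their squares is at most a constant times ‖y‖². The series is therefore dominated by a product of
one-dimensional Gaussian series. -/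
theorem summable_dualLattice (b : Module.Basis (Fin n) ℝ (RSpace n)) {L : Submodule ℤ (RSpace n)}
    (hb : ∀ j, b j ∈ L) {s : ℝ} (hs : 0 < s) :
    Summable fun y : dualLattice L => Real.exp (-Real.pi * ‖s • (y : RSpace n)‖ ^ 2) := by
  choose φ hφ using fun (y : dualLattice L) (j : Fin n) => y.2.2 (b j) (hb j)
  have hinj : Function.Injective φ := by
    intro y y' h
    refine Subtype.ext (InnerProductSpace.ext_inner_right_basis b fun j => ?_)
    rw [hφ, hφ, h]
  set C : ℝ := 1 + ∑ j, ‖b j‖ ^ 2 with hC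
  have hCpos : 0 < C := by positivity
  have ha : 0 < Real.pi * s ^ 2 / C := by positivity
  refine Summable.of_nonneg_of_le (fun _ => (Real.exp_pos _).le) (fun y => ?_)
    ((summable_pi_prod (fun _ => (Real.exp_pos _).le)
      (summable_exp_neg_mul_sq ha)).comp_injective hinj)
  rw [Function.comp_apply, ← Real.exp_sum, ← Finset.mul_sum]
  refine Real.exp_le_exp.2 ?_
  have h1 : ∑ j, (φ y j : ℝ) ^ 2 ≤ C * ‖(y : RSpace n)‖ ^ 2 := by
    calc ∑ j, (φ y j : ℝ) ^ 2 ≤ ∑ j, ‖b j‖ ^ 2 * ‖(y : RSpace n)‖ ^ 2 := by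
          refine Finset.sum_le_sum fun j _ => ?_
          rw [← hφ, ← mul_pow, ← sq_abs, mul_comm]
          exact pow_le_pow_left₀ (abs_nonneg _) (abs_real_inner_le_norm _ _) 2
      _ = (∑ j, ‖b j‖ ^ 2) * ‖(y : RSpace n)‖ ^ 2 := by rw [Finset.sum_mul]
      _ ≤ _ := by gcongr; linarith
  have h2 : Real.pi * s ^ 2 / C * ∑ j, (φ y j : ℝ) ^ 2 ≤ Real.pi * s ^ 2 * ‖(y : RSpace n)‖ ^ 2 := by
    rw [div_mul_eq_mul_div, div_le_iff₀ hCpos]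
    have : 0 ≤ Real.pi * s ^ 2 := by positivity
    nlinarith [mul_le_mul_of_nonneg_left h1 this]
  rw [norm_smul, Real.norm_of_nonneg hs.le, mul_pow]
  linarith

theorem exists_dualLattice_ne_zero (b : Module.Basis (Fin n) ℝ (RSpace n)) (hn : 0 < n) :
    ∃ y ∈ dualLattice (Submodule.span ℤ (Set.range b)), y ≠ 0 := by
  obtain ⟨y, hy⟩ := (InnerProductSpace.toDual ℝ (RSpace n)).surjective
    (LinearMap.toContinuousLinearMap (b.coord ⟨0, hn⟩))
  have hy' : ∀ x, inner ℝ y x = b.coord ⟨0, hn⟩ x := fun x => by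
    rw [← InnerProductSpace.toDual_apply_apply (𝕜 := ℝ), hy]; rfl
  refine ⟨y, ⟨?_, fun x hx => ?_⟩, ?_⟩
  · rw [Submodule.span_span_of_tower, b.span_eq]; trivial
  · rw [hy']
    induction hx using Submodule.span_induction with
    | mem x hx =>
      obtain ⟨j, rfl⟩ := hx
      by_cases hj : j = ⟨0, hn⟩
      · exact ⟨1, by simp [hj]⟩
      · exact ⟨0, by simp [hj]⟩
    | zero => exact ⟨0, by simp⟩
    | add x z _ _ hx hz =>
      obtain ⟨k, hk⟩ := hx
      obtain ⟨l, hl⟩ := hz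
      exact ⟨k + l, by rw [map_add, hk, hl]; push_cast; rfl⟩
    | smul m x _ hx =>
      obtain ⟨k, hk⟩ := hx
      exact ⟨m * k, by rw [← Int.cast_smul_eq_zsmul ℝ, map_smul, hk]; push_cast; rfl⟩
  · rintro rfl
    have := hy' (b ⟨0, hn⟩)
    simp at this

/-- Intermediate value theorem for the Gaussian sum: it tends to 1 at infinity by dominated
convergence, and it is at least 3/2 at a small argument because there is a non-zero dual vector. -/
theorem smoothingSet_nonempty (b : Module.Basis (Fin n) ℝ (RSpace n)) (hn : 0 < n) :
    (smoothingSet (1 / 2) (Submodule.span ℤ (Set.range b))).Nonempty := by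
  set L := Submodule.span ℤ (Set.range b) with hL
  have hb : ∀ j, b j ∈ L := fun j => Submodule.subset_span ⟨j, rfl⟩
  set t : ℝ → dualLattice L → ℝ := fun s y => Real.exp (-Real.pi * ‖s • (y : RSpace n)‖ ^ 2) with ht
  set f : ℝ → ℝ := fun s => ∑' y, t s y with hf
  have hsum : ∀ {s : ℝ}, 0 < s → Summable (t s) := fun hs => summable_dualLattice b hb hs
  have hmono : ∀ {s s' : ℝ}, 0 < s → s ≤ s' → ∀ y, t s' y ≤ t s y := by
    intro s s' hs hss y
    refine Real.exp_le_exp.2 (mul_le_mul_of_nonpos_left ?_ (by linarith [Real.pi_pos]))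
    rw [norm_smul, norm_smul, Real.norm_of_nonneg hs.le, Real.norm_of_nonneg (hs.le.trans hss)]
    gcongr
  obtain ⟨y, hy, hy0⟩ := exists_dualLattice_ne_zero b hn
  have hypos : 0 < ‖y‖ := norm_pos_iff.2 hy0
  have hs₁ : 0 < 1 / (3 * ‖y‖) := by positivity
  -- The term of y becomes e^(-π/9) ≥ 1 - π/9 > 1/2.
  set s₁ : ℝ := 1 / (3 * ‖y‖) with hs₁'
  have h1 : 3 / 2 ≤ f s₁ := by
    have hne : (⟨0, zero_mem_dualLattice L⟩ : dualLattice L) ≠ ⟨y, hy⟩ := fun h =>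
      hy0 (congr_arg Subtype.val h).symm
    have := (hsum hs₁).sum_le_tsum {⟨0, zero_mem_dualLattice L⟩, ⟨y, hy⟩}
      fun _ _ => (Real.exp_pos _).le
    rw [Finset.sum_pair hne] at this
    refine le_trans ?_ this
    have e : ‖s₁ • y‖ = 1 / 3 := by
      rw [norm_smul, Real.norm_of_nonneg hs₁.le, hs₁']; field_simp
    simp only [smul_zero, norm_zero, e]
    have := Real.add_one_le_exp (-Real.pi * (1 / 3) ^ 2)
    have hpi := Real.pi_lt_four
    norm_num at this ⊢
    linarith
  have hlim : Filter.Tendsto f Filter.atTop (nhds 1) := by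
    classical
    have h := tendsto_tsum_of_dominated_convergence (f := t) (𝓕 := Filter.atTop)
      (g := fun y => if y = ⟨0, zero_mem_dualLattice L⟩ then 1 else 0) (bound := t 1)
      (hsum one_pos) (fun z => ?_) ?_
    · rwa [tsum_ite_eq] at h
    · by_cases hz : z = ⟨0, zero_mem_dualLattice L⟩
      · simp [hz, ht]
      · rw [if_neg hz]
        have hz0 : (z : RSpace n) ≠ 0 := fun h => hz (Subtype.ext h)
        have hzpos : 0 < ‖(z : RSpace n)‖ := norm_pos_iff.2 hz0
        refine Real.tendsto_exp_atBot.comp ?_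
        have e : ∀ s : ℝ, -Real.pi * ‖s • (z : RSpace n)‖ ^ 2 =
            (-Real.pi * ‖(z : RSpace n)‖ ^ 2) * s ^ 2 := fun s => by
          rw [norm_smul, mul_pow, Real.norm_eq_abs, sq_abs]; ring
        simp_rw [e]
        refine (Filter.tendsto_pow_atTop two_ne_zero).const_mul_atTop_of_neg ?_
        have := Real.pi_pos
        nlinarith [mul_pos this (pow_pos hzpos 2)]
    · filter_upwards [Filter.eventually_ge_atTop 1] with s hs z
      rw [Real.norm_of_nonneg (Real.exp_pos _).le]
      exact hmono one_pos hs z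
  obtain ⟨s₂, h2, hs₂⟩ := ((hlim.eventually_lt_const (by norm_num : (1 : ℝ) < 3 / 2)).and
    (Filter.eventually_ge_atTop s₁)).exists
  have hcont : ContinuousOn f (Set.Icc s₁ s₂) := by
    refine continuousOn_tsum (u := t s₁) (fun y => ?_) (hsum hs₁) fun z s hs => ?_
    · simp only [ht]; fun_prop
    · rw [Real.norm_of_nonneg (Real.exp_pos _).le]
      exact hmono hs₁ hs.1 z
  obtain ⟨s, hs, hfs⟩ := intermediate_value_Icc' hs₂ hcont ⟨h2.le, h1⟩
  have hspos : 0 < s := hs₁.trans_le hs.1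
  refine ⟨s, hspos, ?_⟩
  have := (hsum hspos).hasSum
  change HasSum (t s) (f s) at this
  rw [hfs] at this
  rwa [show (3 / 2 : ℝ) = 1 + 1 / 2 by norm_num] at this

theorem smoothingParam_mem (I : LatticeInput) :
    smoothingParam (1 / 2) I.lattice ∈ smoothingSet (1 / 2) I.lattice := by
  obtain ⟨s, hs⟩ := smoothingSet_nonempty I.colBasis I.n_pos
  rw [← I.lattice_eq] at hs
  rwa [smoothingParam_eq (by norm_num) hs]

/-- A bijective linear map of norm at most `c` increases the smoothing parameter by a factor of
at most `c`. -/
theorem smoothingParam_le_of_map {L L' : Submodule ℤ (RSpace n)}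
    (hL : Submodule.span ℝ (L : Set (RSpace n)) = ⊤) {s : ℝ} (hs : s ∈ smoothingSet (1 / 2) L)
    (A : RSpace n →L[ℝ] RSpace n) (hA : ∀ x ∈ L, A x ∈ L') (hsurj : Function.Surjective A)
    {c : ℝ} (hc : 0 < c) (hnorm : ∀ x, ‖A x‖ ≤ c * ‖x‖) : smoothingParam (1 / 2) L' ≤ c * s := by
  -- The adjoint of A maps the dual of L' to the dual of L; it is injective since A is onto, and it
  -- has the same norm as A.
  have hmem : ∀ y : dualLattice L', ContinuousLinearMap.adjoint A (y : RSpace n) ∈ dualLattice L := by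
    intro y
    refine ⟨by rw [hL]; trivial, fun x hx => ?_⟩
    rw [ContinuousLinearMap.adjoint_inner_left]
    exact y.2.2 _ (hA x hx)
  refine smoothingParam_le (by norm_num) (fun y => ⟨_, hmem y⟩) ?_ hc (fun y => ?_) hs
  · intro y y' h
    refine Subtype.ext (ext_inner_right ℝ fun x => ?_)
    obtain ⟨z, rfl⟩ := hsurj x
    have h' : ContinuousLinearMap.adjoint A (y : RSpace n) =
      ContinuousLinearMap.adjoint A (y' : RSpace n) := congr_arg Subtype.val h
    rw [← ContinuousLinearMap.adjoint_inner_left, h', ContinuousLinearMap.adjoint_inner_left]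
  · refine (ContinuousLinearMap.le_opNorm _ _).trans ?_
    gcongr
    rw [LinearIsometryEquiv.norm_map]
    exact A.opNorm_le_bound hc.le hnorm

/-! ### Covering radii -/

/-- Take a point x of distance more than 8μ/9 from Λ and a lattice vector p within 10μ/9 of 2x. Then
p / 2 is within 5μ/9 of x, hence at distance at least 3μ/9 from Λ. -/
theorem exists_half_far {Λ : Submodule ℤ (RSpace n)} (h : 0 < coveringRadius Λ) :
    ∃ p ∈ Λ, ∀ y ∈ Λ, coveringRadius Λ / 3 ≤ ‖(1 / 2 : ℝ) • p - y‖ := by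
  set μ := coveringRadius Λ with hμ
  set S : Set ℝ := {r : ℝ | 0 ≤ r ∧
    ∀ x ∈ Submodule.span ℝ (Λ : Set (RSpace n)), ∃ y ∈ Λ, ‖x - y‖ ≤ r} with hS
  have hμS : μ = sInf S := rfl
  have hne : S.Nonempty := by
    by_contra hne
    rw [hμS, Set.not_nonempty_iff_eq_empty.1 hne, Real.sInf_empty] at h
    exact lt_irrefl _ h
  obtain ⟨r, hr, hr'⟩ := exists_lt_of_csInf_lt hne (show sInf S < 10 / 9 * μ by
    rw [← hμS]; linarith)
  have hnot : 8 / 9 * μ ∉ S := fun hm => by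
    have := csInf_le ⟨0, fun _ hx => hx.1⟩ hm
    rw [← hμS] at this
    linarith
  simp only [hS, Set.mem_ofPred_eq, not_and, not_forall, not_exists, not_le] at hnot
  obtain ⟨x, hx, hfar⟩ := hnot (by linarith)
  obtain ⟨p, hp, hp'⟩ := hr.2 ((2 : ℝ) • x) (Submodule.smul_mem _ _ hx)
  refine ⟨p, hp, fun y hy => ?_⟩
  have h1 : ‖x - (1 / 2 : ℝ) • p‖ ≤ 5 / 9 * μ := by
    have : x - (1 / 2 : ℝ) • p = (1 / 2 : ℝ) • ((2 : ℝ) • x - p) := by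
      rw [smul_sub, smul_smul]; norm_num
    rw [this, norm_smul, Real.norm_of_nonneg (by norm_num)]
    linarith
  have h2 := hfar y hy
  have h3 := norm_add_le (x - (1 / 2 : ℝ) • p) ((1 / 2 : ℝ) • p - y)
  rw [sub_add_sub_cancel] at h3
  linarith

/-- If no R exceeded κ, every admissible constant would be at least η(L) / κ, so η(L) ≤ κ ·
`weakConst n`, against the hypothesis with κ' > κ. -/
theorem exists_matrix_of_weakConst_mul_le {L : Submodule ℤ (RSpace n)} [DiscreteTopology L]
    [IsZLattice ℝ L] (hη : 0 < smoothingParam (1 / 2) L) {κ κ' : ℝ} (hκ : 0 < κ) (hκ' : κ < κ')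
    (h : ENNReal.ofReal κ' * weakConst n ≤ ENNReal.ofReal (smoothingParam (1 / 2) L)) :
    ∃ R : Matrix (Fin n) (Fin n) ℝ, R.det ≠ 0 ∧
      κ < coveringRadius (imageLattice R L) / Real.sqrt (Rᵀ * R).trace := by
  by_contra! hcon
  have he : etaMuCirc L ≤ ENNReal.ofReal κ :=
    iSup₂_le fun R hR => ENNReal.ofReal_le_ofReal (hcon R hR)
  have hκ0 : ENNReal.ofReal κ ≠ 0 := by simpa using hκ
  have h1 : ENNReal.ofReal (smoothingParam (1 / 2) L) / ENNReal.ofReal κ ≤ weakConst n := by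
    refine le_sInf fun C hC => ?_
    rw [ENNReal.div_le_iff hκ0 ENNReal.ofReal_ne_top]
    exact (hC L).trans (by gcongr)
  rw [ENNReal.div_le_iff hκ0 ENNReal.ofReal_ne_top, mul_comm] at h1
  have hκκ : ENNReal.ofReal κ < ENNReal.ofReal κ' :=
    (ENNReal.ofReal_lt_ofReal_iff (hκ.trans hκ')).2 hκ'
  -- Cancelling the constant requires it to be positive and finite. Zero contradicts η(L) > 0; with
  -- an infinite constant the hypothesis `h` itself fails.
  have hC0 : weakConst n ≠ 0 := by
    intro h0
    rw [h0, mul_zero, nonpos_iff_eq_zero, ENNReal.ofReal_eq_zero] at h1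
    linarith
  have hCt : weakConst n ≠ ∞ := by
    intro ht
    rw [ht, ENNReal.mul_top (by simpa using hκ.trans hκ'), top_le_iff] at h
    exact ENNReal.ofReal_ne_top h
  have := (ENNReal.mul_le_mul_iff_left hC0 hCt).1 (h.trans h1)
  exact absurd hκκ (not_lt.2 this)

end Lattice

/-! ### The words of the instances -/

section Words

theorem Spp.mul_add_div {n : ℕ} (i j : Fin n) : ((i : ℕ) * n + j) / n = i := by
  rw [mul_comm, Nat.mul_add_div i.pos, Nat.div_eq_of_lt j.2, add_zero]

theorem Spp.mul_add_mod {n : ℕ} (i j : Fin n) : ((i : ℕ) * n + j) % n = j := by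
  rw [mul_comm, Nat.mul_add_mod, Nat.mod_eq_of_lt j.2]

theorem flatten_ofFn_eq {n : ℕ} {M : Fin n → Fin n → ℤ} {f : ℕ → ℤ}
    (h : ∀ i j : Fin n, M i j = f (i * n + j)) :
    (List.ofFn fun i => List.ofFn fun j => M i j).flatten = (List.range (n * n)).map f := by
  have e : (List.range (n * n)).map f = List.ofFn fun k : Fin (n * n) => f k :=
    List.ext_getElem (by simp) (by simp)
  rw [e, List.ofFn_mul]
  simp_rw [h]

theorem getD_flatten_ofFn {n : ℕ} (M : Fin n → Fin n → ℤ) (i j : Fin n) :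
    ((List.ofFn fun i => List.ofFn fun j => M i j).flatten).getD (i * n + j) 0 = M i j := by
  have hlt : (i : ℕ) * n + j < n * n := Spp.mul_add_lt_sq i.2 j.2
  rw [flatten_ofFn_eq (f := fun k =>
    if h : k / n < n then M ⟨k / n, h⟩ ⟨k % n, Nat.mod_lt _ i.pos⟩ else 0)]
  · rw [List.getD_eq_getElem _ _ (by simpa using hlt)]
    simp [Spp.mul_add_div, Nat.mod_eq_of_lt j.2]
  · intro i j
    simp [Spp.mul_add_div, Nat.mod_eq_of_lt j.2]

namespace Spp

variable (a : ℕ) (I : LatticeInput)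

theorem entry_paramWords (i j : Fin I.n) : entry (paramWords a I) (i * I.n + j) = I.basis i j := by
  rw [← getD_flatten_ofFn (fun i j => I.basis i j) i j, entry, add_comm 4]
  rfl

theorem getD_zero_paramWords : (paramWords a I).getD 0 0 = a := rfl
theorem getD_two_paramWords : (paramWords a I).getD 2 0 = I.den := rfl
theorem getD_three_paramWords : (paramWords a I).getD 3 0 = I.num := rfl

theorem sum_range_sq_eq {n : ℕ} (f : ℕ → ℤ) :
    ∑ k ∈ Finset.range (n * n), f k = ∑ i : Fin n, ∑ j : Fin n, f (i * n + j) := by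
  rw [Finset.sum_range, ← finProdFinEquiv.sum_comp, Fintype.sum_prod_type]
  refine Finset.sum_congr rfl fun i _ => Finset.sum_congr rfl fun j _ => ?_
  simp [finProdFinEquiv, add_comm, mul_comm]

theorem size_eq : size (paramWords a I) =
    512 + I.n + a + I.num + ∑ i, ∑ j, I.basis i j * I.basis i j := by
  rw [size, dim_paramWords, getD_zero_paramWords, getD_three_paramWords, sum_range_sq_eq]
  simp_rw [entry_paramWords]

theorem le_size : 512 + (I.n : ℤ) ≤ size (paramWords a I) ∧ (a : ℤ) ≤ size (paramWords a I) ∧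
    (I.num : ℤ) ≤ size (paramWords a I) ∧ ∀ i j, |I.basis i j| ≤ size (paramWords a I) := by
  have hnn : ∀ i j, 0 ≤ I.basis i j * I.basis i j := fun i j => mul_self_nonneg _
  have hs : 0 ≤ ∑ i, ∑ j, I.basis i j * I.basis i j :=
    Finset.sum_nonneg fun i _ => Finset.sum_nonneg fun j _ => hnn i j
  rw [size_eq]
  refine ⟨by omega, by omega, by omega, fun i j => ?_⟩
  have h1 : I.basis i j * I.basis i j ≤ ∑ i, ∑ j, I.basis i j * I.basis i j :=
    (Finset.single_le_sum (f := fun j => I.basis i j * I.basis i j) (fun j _ => hnn i j)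
      (Finset.mem_univ j)).trans (Finset.single_le_sum
        (f := fun i => ∑ j, I.basis i j * I.basis i j)
        (fun i _ => Finset.sum_nonneg fun j _ => hnn i j) (Finset.mem_univ i))
  have h2 : |I.basis i j| ≤ I.basis i j * I.basis i j := by
    rw [← abs_mul_abs_self]
    rcases eq_or_ne (I.basis i j) 0 with h | h
    · simp [h]
    · exact le_mul_of_one_le_left (abs_nonneg _) (Int.one_le_abs h)
  omega

/-! ### Integer vectors under the perturbed matrix -/

theorem half_pos : 0 < half (paramWords a I) := by
  have := (le_size a I).1
  exact pow_pos (by omega) _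

/-- The constant in the bound for the inverse of the basis matrix. -/
noncomputable def invBound : ℝ := (size (paramWords a I) : ℝ) ^ (2 * I.n + 1)

theorem one_le_invBound : 1 ≤ invBound a I := by
  have h : (1 : ℤ) ≤ size (paramWords a I) := by have := (le_size a I).1; omega
  exact one_le_pow₀ (by exact_mod_cast h)

/-- This explains the exponent 8n in `half`: (2n + 1) + 5 ≤ 8n for n ≥ 1. The spare factor `size` ^
5 absorbs the parameters of the sampling problem. -/
theorem invBound_mul_le_half :
    invBound a I * (size (paramWords a I) : ℝ) ^ 5 ≤ half (paramWords a I) := by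
  have h : (1 : ℤ) ≤ size (paramWords a I) := by have := (le_size a I).1; omega
  have hn := I.n_pos
  rw [half, invBound, ← pow_add, dim_paramWords, Int.cast_pow]
  exact pow_le_pow_right₀ (by exact_mod_cast h) (by omega)

open Matrix in
theorem sum_abs_le (c : Fin I.n → ℝ) :
    ∑ i, |c i| ≤ invBound a I * ∑ j, |(I.basis.map (Int.cast : ℤ → ℝ) *ᵥ c) j| := by
  obtain ⟨h1, -, -, h4⟩ := le_size a I
  set G : ℝ := ((size (paramWords a I) : ℤ) : ℝ) with hG
  have hG1 : 512 + (I.n : ℝ) ≤ G := by rw [hG]; exact_mod_cast h1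
  have hn0 : (0 : ℝ) ≤ I.n := Nat.cast_nonneg _
  have hG0 : 0 ≤ G := by linarith
  have hS : 0 ≤ ∑ j, |(I.basis.map (Int.cast : ℤ → ℝ) *ᵥ c) j| :=
    Finset.sum_nonneg fun _ _ => abs_nonneg _
  have hB : ∀ i j, |(I.basis i j : ℝ)| ≤ G := fun i j => by rw [hG]; exact_mod_cast h4 i j
  calc ∑ i, |c i| ≤ ∑ _i : Fin I.n, (I.n * G) ^ I.n *
        ∑ j, |(I.basis.map (Int.cast : ℤ → ℝ) *ᵥ c) j| :=
        Finset.sum_le_sum fun i _ => abs_le_of_mulVec I.basis_det (by linarith) hB c i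
    _ = I.n * (I.n * G) ^ I.n * ∑ j, |(I.basis.map (Int.cast : ℤ → ℝ) *ᵥ c) j| := by
        simp [mul_assoc]
    _ ≤ G * (G * G) ^ I.n * ∑ j, |(I.basis.map (Int.cast : ℤ → ℝ) *ᵥ c) j| := by
        gcongr <;> linarith
    _ = _ := by rw [invBound, ← hG]; ring

open Matrix in
/-- The matrix of the query, up to a factor of two. -/
def pertMatrix : Matrix (Fin I.n) (Fin I.n) ℤ :=
  (2 * half (paramWords a I)) • I.basis + 1

open Matrix in
theorem pertMatrix_mulVec (w : Fin I.n → ℤ) (i : Fin I.n) :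
    (pertMatrix a I *ᵥ w) i = 2 * half (paramWords a I) * (I.basis *ᵥ w) i + w i := by
  rw [pertMatrix, Matrix.add_mulVec, Matrix.smul_mulVec, Matrix.one_mulVec]
  rfl

open Matrix in
/-- An integral vector is small if its image under the perturbed matrix is small. -/
theorem abs_lt_half {w : Fin I.n → ℤ} {Y : ℝ}
    (hY : ∑ i, |((pertMatrix a I *ᵥ w) i : ℝ)| ≤ Y)
    (hYh : 2 * Y ≤ (half (paramWords a I) : ℝ) * (size (paramWords a I) : ℝ) ^ 5) :
    ∑ i, |(w i : ℝ)| ≤ half (paramWords a I) / 2 ∧ (Y = 0 → w = 0) := by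
  have h0 : (0 : ℝ) < half (paramWords a I) := by exact_mod_cast half_pos a I
  have h1 := sum_abs_le a I (fun i => (w i : ℝ))
  have h2 := invBound_mul_le_half a I
  have h3 := one_le_invBound a I
  have h4 : (1 : ℝ) ≤ (size (paramWords a I) : ℝ) ^ 5 := by
    have h : (1 : ℤ) ≤ size (paramWords a I) := by have := (le_size a I).1; omega
    exact one_le_pow₀ (by exact_mod_cast h)
  set h : ℝ := ((half (paramWords a I) : ℤ) : ℝ)
  set P := invBound a I
  set W := ∑ i, |(w i : ℝ)| with hW
  have hW0 : 0 ≤ W := Finset.sum_nonneg fun _ _ => abs_nonneg _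
  set U := ∑ j, |(I.basis.map (Int.cast : ℤ → ℝ) *ᵥ fun i => (w i : ℝ)) j| with hU
  -- The triangle inequality for 2h(Bw) = (2hB + 1)w - w. Since W ≤ `invBound` · U and `invBound` ≤
  -- h, the term W on the right can be absorbed.
  have h5 : 2 * h * U ≤ Y + W := by
    have : ∀ j, 2 * h * |(I.basis.map (Int.cast : ℤ → ℝ) *ᵥ fun i => (w i : ℝ)) j| ≤
        |((pertMatrix a I *ᵥ w) j : ℝ)| + |(w j : ℝ)| := by
      intro j
      have e : (I.basis.map (Int.cast : ℤ → ℝ) *ᵥ fun i => (w i : ℝ)) j = ((I.basis *ᵥ w) j : ℤ) := by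
        simp [Matrix.mulVec, dotProduct]
      rw [e, pertMatrix_mulVec, ← abs_of_pos (show 0 < 2 * h by linarith), ← abs_mul]
      have := abs_sub (2 * h * ((I.basis *ᵥ w) j : ℤ) + (w j : ℝ)) (w j : ℝ)
      rw [add_sub_cancel_right] at this
      push_cast
      exact this
    calc 2 * h * U = ∑ j, 2 * h * |(I.basis.map (Int.cast : ℤ → ℝ) *ᵥ fun i => (w i : ℝ)) j| := by
          rw [hU, Finset.mul_sum]
      _ ≤ ∑ j, (|((pertMatrix a I *ᵥ w) j : ℝ)| + |(w j : ℝ)|) :=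
          Finset.sum_le_sum fun j _ => this j
      _ ≤ _ := by rw [Finset.sum_add_distrib]; linarith
  have hPh : P ≤ h := by nlinarith
  have hP0 : 0 < P := by linarith
  have h6 : 2 * h * W ≤ P * (Y + W) := by
    calc 2 * h * W ≤ 2 * h * (P * U) := by gcongr
      _ = P * (2 * h * U) := by ring
      _ ≤ _ := by gcongr
  have h7 : h * W ≤ P * Y := by nlinarith
  constructor
  · have h8 : h * W ≤ h * (h / 2) := by
      have : P * (2 * Y) ≤ h * h := by
        calc P * (2 * Y) ≤ P * (h * (size (paramWords a I) : ℝ) ^ 5) := by gcongr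
          _ = h * (P * (size (paramWords a I) : ℝ) ^ 5) := by ring
          _ ≤ _ := by gcongr
      linarith
    exact le_of_mul_le_mul_left h8 h0
  · intro hY0
    rw [hY0, mul_zero] at h7
    have hW' : W = 0 := le_antisymm (by nlinarith) hW0
    ext i
    have := (Finset.sum_eq_zero_iff_of_nonneg fun i _ => abs_nonneg ((w i : ℝ))).1 hW' i
      (Finset.mem_univ i)
    simpa using this

open Matrix in
theorem det_pertMatrix : (pertMatrix a I).det ≠ 0 := by
  intro hdet
  obtain ⟨w, hw, hw0⟩ := Matrix.exists_mulVec_eq_zero_iff.2 hdet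
  refine hw ((abs_lt_half a I (w := w) (Y := 0) (by simp [hw0]) ?_).2 rfl)
  have h : (0 : ℤ) ≤ size (paramWords a I) := by have := (le_size a I).1; omega
  have h' : (0 : ℝ) ≤ size (paramWords a I) := by exact_mod_cast h
  have h0 : (0 : ℝ) < half (paramWords a I) := by exact_mod_cast half_pos a I
  rw [mul_zero]
  positivity

/-! ### The instance passed to the oracle -/

open Matrix in
/-- The instance of the sampling problem that is queried. -/
def queryInput (ha : 1 ≤ a) (b : Fin I.n → ℤ) : DSGSInput where
  n := I.n
  n_pos := I.n_pos
  den := (4 * half (paramWords a I) * I.den).toNat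
  den_pos := by
    have h1 := half_pos a I
    have h2 : (0 : ℤ) < I.den := by exact_mod_cast I.den_pos
    have : 0 < 4 * half (paramWords a I) * I.den := by positivity
    omega
  num := (8 * half (paramWords a I) * I.num * a).toNat
  num_pos := by
    have h1 := half_pos a I
    have h2 : (0 : ℤ) < I.num := by exact_mod_cast I.num_pos
    have h3 : (0 : ℤ) < a := by exact_mod_cast ha
    have : 0 < 8 * half (paramWords a I) * I.num * a := by positivity
    omega
  basis := (2 : ℤ) • pertMatrix a I
  basis_det := by
    rw [Matrix.det_smul]
    exact mul_ne_zero (pow_ne_zero _ two_ne_zero) (det_pertMatrix a I)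
  shift := pertMatrix a I *ᵥ b

theorem queryInput_den (ha : 1 ≤ a) (b : Fin I.n → ℤ) :
    ((queryInput a I ha b).den : ℤ) = 4 * half (paramWords a I) * I.den := by
  have h1 := half_pos a I
  exact Int.toNat_of_nonneg (by positivity)

theorem queryInput_num (ha : 1 ≤ a) (b : Fin I.n → ℤ) :
    ((queryInput a I ha b).num : ℤ) = 8 * half (paramWords a I) * I.num * a := by
  have h1 := half_pos a I
  exact Int.toNat_of_nonneg (by positivity)

/-- The factor 2 compensates for the perturbation, which may double the smoothing parameter. -/
theorem queryInput_s (ha : 1 ≤ a) (b : Fin I.n → ℤ) :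
    (queryInput a I ha b).s = 2 * a * I.s := by
  have h0 : (half (paramWords a I) : ℝ) ≠ 0 := by exact_mod_cast (half_pos a I).ne'
  have h1 := I.den_ne_zero
  have e1 : ((queryInput a I ha b).den : ℝ) = 4 * half (paramWords a I) * I.den := by
    exact_mod_cast congr_arg (Int.cast : ℤ → ℝ) (queryInput_den a I ha b)
  have e2 : ((queryInput a I ha b).num : ℝ) = 8 * half (paramWords a I) * I.num * a := by
    exact_mod_cast congr_arg (Int.cast : ℤ → ℝ) (queryInput_num a I ha b)
  rw [LatticeInput.s, LatticeInput.s, e1, e2]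
  field_simp
  ring

open Matrix in
theorem query_eq_words (ha : 1 ≤ a) (b : List ℤ) :
    query (paramWords a I) b = (queryInput a I ha fun i => b.getD i 0).words := by
  rw [DSGSInput.words, LatticeInput.words, queryInput_den, queryInput_num, query, dim_paramWords,
    getD_zero_paramWords, getD_two_paramWords, getD_three_paramWords]
  congr 1
  · congr 1
    refine (flatten_ofFn_eq fun i j => ?_).symm
    rw [queryEntry, dim_paramWords, entry_paramWords, delta]
    rw [mul_add_div, mul_add_mod]
    change ((2 : ℤ) • pertMatrix a I) i j = _
    rw [Matrix.smul_apply, pertMatrix, Matrix.add_apply, Matrix.smul_apply, Matrix.one_apply]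
    simp only [Fin.ext_iff, smul_eq_mul]
    ring
  · refine List.ext_getElem (by simp; rfl) fun i h1 h2 => ?_
    have hi : i < I.n := by simpa using h1
    rw [List.getElem_map, List.getElem_range, List.getElem_ofFn]
    change _ = (pertMatrix a I *ᵥ fun i : Fin I.n => b.getD i 0) ⟨i, hi⟩
    rw [pertMatrix_mulVec, queryShift, dim_paramWords, Finset.sum_range, Matrix.mulVec, dotProduct,
      Finset.mul_sum, add_comm]
    congr 1
    refine Finset.sum_congr rfl fun j _ => ?_
    have := entry_paramWords a I ⟨i, hi⟩ j
    rw [← this]; ring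

end Spp

end Words

/-! ### The test for acceptance -/

namespace Spp

section Accepts

open Matrix

variable (a : ℕ) (I : LatticeInput)

theorem cast_matPow {n : ℕ} {S : ℕ → ℤ} {M : Matrix (Fin n) (Fin n) ℝ}
    (h : ∀ i j : Fin n, (S (i * n + j) : ℝ) = M i j) (k : ℕ) (i j : Fin n) :
    (matPow n S k i j : ℝ) = (M ^ k) i j := by
  induction k generalizing j with
  | zero => simp [matPow, Matrix.one_apply, Fin.ext_iff]
  | succ k ih =>
    rw [matPow, pow_succ, Matrix.mul_apply, Finset.sum_range]
    push_cast
    simp_rw [ih, h]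

/-- The higher digits of the answer as a matrix. -/
def highMatrix (y : List ℤ) : Matrix (Fin I.n) (Fin I.n) ℝ :=
  Matrix.of fun r i => (high (paramWords a I) y (r * I.n + i) : ℝ)

theorem tracePow_eq (y : List ℤ) : (tracePow (paramWords a I) y : ℝ) =
    (((highMatrix a I y)ᵀ * highMatrix a I y) ^ I.n).trace := by
  rw [tracePow, dim_paramWords, Finset.sum_range, Matrix.trace]
  push_cast
  refine Finset.sum_congr rfl fun i _ => cast_matPow (fun i j => ?_) _ _ _
  rw [gram, dim_paramWords, Finset.sum_range, mul_add_div, mul_add_mod, Matrix.mul_apply]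
  push_cast
  rfl

/-- A sum of squares is non-positive only if every term vanishes, so one comparison verifies the
digits and the parities of all samples. -/
theorem bad_nonpos_iff (b y : List ℤ) : bad (paramWords a I) b y ≤ 0 ↔ ∀ r i : Fin I.n,
    high (paramWords a I) y (r * I.n + i) =
      (I.basis *ᵥ fun j => low (paramWords a I) y (r * I.n + j)) i ∧
    (low (paramWords a I) y (r * I.n + i) - b.getD i 0) % 2 = 0 := by
  have h0 : ∀ u v : ℤ, 0 ≤ u * u + v * v := fun u v =>
    add_nonneg (mul_self_nonneg u) (mul_self_nonneg v)
  have h1 : ∀ u v : ℤ, u * u + v * v = 0 ↔ u = 0 ∧ v = 0 := fun u v =>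
    mul_self_add_mul_self_eq_zero
  rw [bad, dim_paramWords, sum_range_sq_eq]
  have hnn : 0 ≤ ∑ r : Fin I.n, ∑ i : Fin I.n, (defect (paramWords a I) y (r * I.n + i) *
      defect (paramWords a I) y (r * I.n + i) +
      (low (paramWords a I) y (r * I.n + i) - b.getD ((r * I.n + i) % I.n) 0) % 2 *
      ((low (paramWords a I) y (r * I.n + i) - b.getD ((r * I.n + i) % I.n) 0) % 2)) :=
    Finset.sum_nonneg fun r _ => Finset.sum_nonneg fun i _ => h0 _ _
  rw [hnn.ge_iff_eq, eq_comm, Finset.sum_eq_zero_iff_of_nonneg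
    fun r _ => Finset.sum_nonneg fun i _ => h0 _ _]
  refine forall_congr' fun r => ?_
  rw [Finset.sum_eq_zero_iff_of_nonneg fun i _ => h0 _ _]
  simp only [Finset.mem_univ, true_imp_iff]
  refine forall_congr' fun i => ?_
  rw [h1, mul_add_mod, defect, dim_paramWords, mul_add_mod, mul_add_div, Finset.sum_range,
    Matrix.mulVec, dotProduct]
  simp_rw [entry_paramWords]
  refine and_congr ?_ Iff.rfl
  constructor <;> intro h <;> linarith

theorem bound_eq : bound (paramWords a I) = 10000 * I.n * (a * a) * (I.num * I.num) := by
  rw [bound, dim_paramWords, getD_zero_paramWords, getD_three_paramWords]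

theorem accepts_iff (b y : List ℤ) : accepts (paramWords a I) b y = true ↔
    bad (paramWords a I) b y ≤ 0 ∧ (((highMatrix a I y)ᵀ * highMatrix a I y) ^ I.n).trace ≤
      (10000 * I.n * a ^ 2 * I.num ^ 2) ^ I.n := by
  rw [accepts, decide_eq_true_iff, dim_paramWords, ← tracePow_eq, bound_eq, ← Int.cast_le (R := ℝ)
    (m := tracePow _ _)]
  push_cast
  simp_rw [← sq]

/-- Division by 2h after adding h rounds to the nearest integer, so low digits of either sign are
recovered. -/
theorem high_eq {y : List ℤ} {k : ℕ} {u w : ℤ} (hy : y.getD k 0 = 2 * half (paramWords a I) * u + w)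
    (hw : 2 * |w| ≤ half (paramWords a I)) :
    high (paramWords a I) y k = u ∧ low (paramWords a I) y k = w := by
  have h0 := half_pos a I
  have h1 := neg_abs_le w
  have h2 := le_abs_self w
  have : high (paramWords a I) y k = u := by
    rw [high, hy, add_assoc, Int.mul_add_ediv_left _ _ (by omega),
      Int.ediv_eq_zero_of_lt (by omega) (by omega), add_zero]
  exact ⟨this, by rw [low, this, hy]; ring⟩

/-- The quadratic form bound at the unit vectors limits the entries of the samples, hence w is small
and the digits are decoded correctly. The same bound then passes to the high digits, which differ
from the samples divided by 2h only by w / 2h. -/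
theorem accepts_of_le {w : Fin I.n → Fin I.n → ℤ} {b y : List ℤ} (ha : 1 ≤ a)
    (hy : ∀ r i : Fin I.n, y.getD (r * I.n + i) 0 = (pertMatrix a I *ᵥ w r) i)
    (hb : ∀ r i : Fin I.n, (w r i - b.getD i 0) % 2 = 0)
    (hθ : ∀ θ : Fin I.n → ℝ, ∑ r, (∑ i, ((pertMatrix a I *ᵥ w r) i : ℝ) * θ i) ^ 2 ≤
      128 * I.n * (8 * half (paramWords a I) * I.num * a) ^ 2 * ∑ i, θ i ^ 2) :
    accepts (paramWords a I) b y = true := by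
  obtain ⟨g1, g2, g3, -⟩ := le_size a I
  set G : ℝ := ((size (paramWords a I) : ℤ) : ℝ) with hG
  replace g1 : 512 + (I.n : ℝ) ≤ G := by rw [hG]; exact_mod_cast g1
  replace g2 : (a : ℝ) ≤ G := by rw [hG]; exact_mod_cast g2
  replace g3 : (I.num : ℝ) ≤ G := by rw [hG]; exact_mod_cast g3
  have hn0 : (1 : ℝ) ≤ I.n := by exact_mod_cast I.n_pos
  have ha1 : (1 : ℝ) ≤ a := by exact_mod_cast ha
  have hm1 : (1 : ℝ) ≤ I.num := by exact_mod_cast I.num_pos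
  have hh0 : (0 : ℝ) < ((half (paramWords a I) : ℤ) : ℝ) := by exact_mod_cast half_pos a I
  have hG0 : 0 ≤ G := by linarith
  set h : ℝ := ((half (paramWords a I) : ℤ) : ℝ) with hh
  -- The summand 512 in `size` gives 128 n ≤ G² here and 16 ≤ G in the application of `abs_lt_half`.
  have hY : ∀ r i, |((pertMatrix a I *ᵥ w r) i : ℝ)| ≤ 8 * h * G ^ 3 := by
    intro r i
    have h1 := hθ (Pi.single i 1)
    have e1 : ∀ r, ∑ j, ((pertMatrix a I *ᵥ w r) j : ℝ) * (Pi.single i 1 : Fin I.n → ℝ) j =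
        ((pertMatrix a I *ᵥ w r) i : ℝ) := fun r => by simp [Pi.single_apply]
    have e2 : ∑ j, (Pi.single i 1 : Fin I.n → ℝ) j ^ 2 = 1 := by simp [Pi.single_apply]
    simp_rw [e1] at h1
    rw [e2, mul_one] at h1
    refine abs_le_of_sq_le_sq ?_ (by positivity)
    calc ((pertMatrix a I *ᵥ w r) i : ℝ) ^ 2 ≤ ∑ r, ((pertMatrix a I *ᵥ w r) i : ℝ) ^ 2 :=
          Finset.single_le_sum (f := fun r => ((pertMatrix a I *ᵥ w r) i : ℝ) ^ 2)
            (fun _ _ => sq_nonneg _) (Finset.mem_univ r)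
      _ ≤ _ := h1
      _ = (8 * h) ^ 2 * ((128 * I.n) * I.num ^ 2 * a ^ 2) := by ring
      _ ≤ (8 * h) ^ 2 * (G ^ 2 * G ^ 2 * G ^ 2) := by
          have : 128 * (I.n : ℝ) ≤ G ^ 2 := by nlinarith
          gcongr
      _ = _ := by ring
  have hw : ∀ r, ∑ i, |(w r i : ℝ)| ≤ h / 2 := by
    intro r
    refine (abs_lt_half a I (Y := 8 * h * G ^ 4) ?_ ?_).1
    · calc _ ≤ ∑ _i : Fin I.n, 8 * h * G ^ 3 := Finset.sum_le_sum fun i _ => hY r i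
        _ = I.n * (8 * h * G ^ 3) := by simp
        _ ≤ G * (8 * h * G ^ 3) := by gcongr; linarith
        _ = _ := by ring
    · calc 2 * (8 * h * G ^ 4) = h * (16 * G ^ 4) := by ring
        _ ≤ h * (G * G ^ 4) := by gcongr; linarith
        _ = _ := by ring
  have hw' : ∀ r i, 2 * |w r i| ≤ half (paramWords a I) := by
    intro r i
    have := (Finset.single_le_sum (f := fun i => |(w r i : ℝ)|) (fun _ _ => abs_nonneg _)
      (Finset.mem_univ i)).trans (hw r)
    have h2 : 2 * |(w r i : ℝ)| ≤ h := by linarith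
    rw [hh] at h2
    exact_mod_cast h2
  have key := fun r i => high_eq a I ((hy r i).trans (pertMatrix_mulVec a I (w r) i)) (hw' r i)
  rw [accepts_iff]
  refine ⟨(bad_nonpos_iff a I b y).2 fun r i => ?_, ?_⟩
  · rw [(key r i).1, (key r i).2]
    refine ⟨?_, hb r i⟩
    congr 2
    funext j
    exact (key r j).2.symm
  -- The factor 2 is the loss of the trace test. The 5000 covers 2 · 128 · 8² / 4 = 4096 from the
  -- samples and 1/8 from the low digits.
  · have e : (10000 * I.n * a ^ 2 * I.num ^ 2 : ℝ) = 2 * (5000 * I.n * a ^ 2 * I.num ^ 2) := by ring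
    rw [e]
    refine trace_gram_pow_le (by positivity) fun θ => ?_
    have hV : ∀ r, 2 * h * (highMatrix a I y *ᵥ θ) r =
        ∑ i, ((pertMatrix a I *ᵥ w r) i : ℝ) * θ i - ∑ i, (w r i : ℝ) * θ i := by
      intro r
      rw [Matrix.mulVec, dotProduct, Finset.mul_sum, ← Finset.sum_sub_distrib]
      refine Finset.sum_congr rfl fun i _ => ?_
      rw [highMatrix, Matrix.of_apply, (key r i).1, pertMatrix_mulVec]
      push_cast
      ring
    set N := ∑ i, θ i ^ 2 with hN
    have hN0 : 0 ≤ N := Finset.sum_nonneg fun _ _ => sq_nonneg _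
    have hwθ : ∀ r, (∑ i, (w r i : ℝ) * θ i) ^ 2 ≤ (h / 2) ^ 2 * N := by
      intro r
      refine (Finset.sum_mul_sq_le_sq_mul_sq _ _ _).trans ?_
      gcongr
      calc ∑ i, (w r i : ℝ) ^ 2 = ∑ i, |(w r i : ℝ)| ^ 2 := by simp
        _ ≤ (∑ i, |(w r i : ℝ)|) ^ 2 := Finset.sum_sq_le_sq_sum_of_nonneg fun _ _ => abs_nonneg _
        _ ≤ _ := by
          have : 0 ≤ ∑ i, |(w r i : ℝ)| := Finset.sum_nonneg fun _ _ => abs_nonneg _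
          gcongr
          exact hw r
    have hfin : (2 * h) ^ 2 * ∑ r, (highMatrix a I y *ᵥ θ) r ^ 2 ≤
        (2 * h) ^ 2 * (5000 * I.n * a ^ 2 * I.num ^ 2 * N) := by
      calc (2 * h) ^ 2 * ∑ r, (highMatrix a I y *ᵥ θ) r ^ 2
          = ∑ r, (∑ i, ((pertMatrix a I *ᵥ w r) i : ℝ) * θ i - ∑ i, (w r i : ℝ) * θ i) ^ 2 := by
            rw [Finset.mul_sum]
            exact Finset.sum_congr rfl fun r _ => by rw [← hV]; ring
        _ ≤ ∑ r, (2 * (∑ i, ((pertMatrix a I *ᵥ w r) i : ℝ) * θ i) ^ 2 +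
            2 * ((h / 2) ^ 2 * N)) := by
            refine Finset.sum_le_sum fun r _ => ?_
            have h1 := hwθ r
            have h2 := sq_nonneg (∑ i, ((pertMatrix a I *ᵥ w r) i : ℝ) * θ i +
              ∑ i, (w r i : ℝ) * θ i)
            linarith
        _ = 2 * ∑ r, (∑ i, ((pertMatrix a I *ᵥ w r) i : ℝ) * θ i) ^ 2 +
            I.n * (2 * ((h / 2) ^ 2 * N)) := by
            rw [Finset.sum_add_distrib, ← Finset.mul_sum]; simp
        _ ≤ 2 * (128 * I.n * (8 * h * I.num * a) ^ 2 * N) + I.n * (2 * ((h / 2) ^ 2 * N)) := by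
            linarith [hθ θ]
        _ = (2 * h) ^ 2 * (I.n * N) * (4096 * (a ^ 2 * I.num ^ 2) + 1 / 8) := by ring
        _ ≤ (2 * h) ^ 2 * (I.n * N) * (5000 * (a ^ 2 * I.num ^ 2)) := by
            have : (1 : ℝ) ≤ a ^ 2 * I.num ^ 2 :=
              one_le_mul_of_one_le_of_one_le (one_le_pow₀ ha1) (one_le_pow₀ hm1)
            gcongr
            linarith
        _ = _ := by ring
    exact le_of_mul_le_mul_left hfin (by positivity)

end Accepts

end Spp

/-! ### Close lattices are accepted -/

namespace Spp

section Yes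

open Matrix

variable (a : ℕ) (I : LatticeInput)

theorem norm_toLp_le {n : ℕ} (v : Fin n → ℝ) : ‖(WithLp.toLp 2 v : RSpace n)‖ ≤ ∑ i, |v i| := by
  rw [EuclideanSpace.norm_eq]
  refine Real.sqrt_le_iff.2 ⟨Finset.sum_nonneg fun _ _ => abs_nonneg _, ?_⟩
  exact Finset.sum_sq_le_sq_sum_of_nonneg fun _ _ => abs_nonneg _

theorem queryInput_col (ha : 1 ≤ a) (b : Fin I.n → ℤ) (j : Fin I.n) :
    (queryInput a I ha b).col j = I.col j +
      WithLp.toLp 2 (Pi.single j (1 / (2 * half (paramWords a I) * I.den) : ℝ)) := by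
  have h0 : ((half (paramWords a I) : ℤ) : ℝ) ≠ 0 := by exact_mod_cast (half_pos a I).ne'
  have h1 := I.den_ne_zero
  have e1 : ((queryInput a I ha b).den : ℝ) = 4 * half (paramWords a I) * I.den := by
    exact_mod_cast congr_arg (Int.cast : ℤ → ℝ) (queryInput_den a I ha b)
  refine PiLp.ext fun i : Fin I.n => ?_
  change (((2 : ℤ) • pertMatrix a I) i j : ℝ) / ((queryInput a I ha b).den : ℝ) =
    (I.basis i j : ℝ) / I.den + (Pi.single j _ : Fin I.n → ℝ) i
  rw [e1, Matrix.smul_apply, pertMatrix, Matrix.add_apply, Matrix.smul_apply, Matrix.one_apply,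
    Pi.single_apply]
  split_ifs
  · push_cast [smul_eq_mul]; field_simp; ring
  · push_cast [smul_eq_mul]; field_simp; ring

/-- The map between the two bases sends x to x + γ / (2h · den), with γ the coordinates of x. As h ≥
n · `invBound`, the displacement is at most ‖x‖, so the map has norm at most 2. -/
theorem smoothingParam_queryInput_le (ha : 1 ≤ a) (b : Fin I.n → ℤ) :
    smoothingParam (1 / 2) (queryInput a I ha b).lattice ≤
      2 * smoothingParam (1 / 2) I.lattice := by
  have hh0 : (0 : ℝ) < ((half (paramWords a I) : ℤ) : ℝ) := by exact_mod_cast half_pos a I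
  have hd0 : (0 : ℝ) < I.den := by exact_mod_cast I.den_pos
  set q := queryInput a I ha b with hq
  set c : Module.Basis (Fin I.n) ℝ (RSpace I.n) := q.colBasis with hc
  have hcj : ∀ j, c j = I.col j +
      WithLp.toLp 2 (Pi.single j (1 / (2 * half (paramWords a I) * I.den) : ℝ)) := fun j =>
    (q.colBasis_apply j).trans (queryInput_col a I ha b j)
  set A := (I.colBasis.equiv c (Equiv.refl _)).toContinuousLinearEquiv with hA
  have hAj : ∀ j, A (I.colBasis j) = c j := fun j => by simp [hA]
  refine smoothingParam_le_of_map I.span_lattice (smoothingParam_mem I)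
    (A : RSpace I.n →L[ℝ] RSpace I.n) (fun x hx => ?_) A.surjective two_pos fun x => ?_
  · rw [I.lattice_eq] at hx
    have hle : Submodule.span ℤ (Set.range I.colBasis) ≤
        Submodule.comap ((A : RSpace I.n →ₗ[ℝ] RSpace I.n).restrictScalars ℤ) q.lattice := by
      rw [Submodule.span_le]
      rintro _ ⟨j, rfl⟩
      change A (I.colBasis j) ∈ q.lattice
      rw [hAj, q.lattice_eq]
      exact Submodule.subset_span ⟨j, rfl⟩
    exact hle hx
  · change ‖A x‖ ≤ _
    set γ : Fin I.n → ℝ := fun j => I.colBasis.repr x j with hγ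
    have hx : ∑ j, γ j • I.colBasis j = x := I.colBasis.sum_repr x
    have hx' : x = WithLp.toLp 2 fun i =>
        (I.basis.map (Int.cast : ℤ → ℝ) *ᵥ γ) i / (I.den : ℝ) := by
      rw [← I.sum_smul_col, ← hx]
      exact Finset.sum_congr rfl fun j _ => by rw [I.colBasis_apply]
    have hAx : A x = x + WithLp.toLp 2 fun i => γ i / (2 * half (paramWords a I) * I.den) := by
      conv_lhs => rw [← hx, map_sum]
      have e : ∀ j, A (γ j • I.colBasis j) = γ j • I.colBasis j +
          γ j • WithLp.toLp 2 (Pi.single j (1 / (2 * half (paramWords a I) * I.den) : ℝ)) := fun j => by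
        rw [map_smul, hAj, hcj, smul_add, I.colBasis_apply]
      simp_rw [e]
      rw [Finset.sum_add_distrib, hx]
      congr 1
      ext i
      simp [Pi.single_apply, div_eq_mul_inv]
    have h1 := sum_abs_le a I γ
    have h2 : ∑ j, |(I.basis.map (Int.cast : ℤ → ℝ) *ᵥ γ) j| ≤ I.n * (I.den * ‖x‖) := by
      calc _ ≤ ∑ _j : Fin I.n, I.den * ‖x‖ := by
            refine Finset.sum_le_sum fun j _ => ?_
            have e : (I.basis.map (Int.cast : ℤ → ℝ) *ᵥ γ) j = I.den * x j := by
              rw [hx']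
              change _ = (I.den : ℝ) * ((I.basis.map (Int.cast : ℤ → ℝ) *ᵥ γ) j / (I.den : ℝ))
              field_simp
            rw [e, abs_mul, abs_of_pos hd0]
            gcongr
            exact PiLp.norm_apply_le x j
        _ = _ := by simp
    have h3 : invBound a I * I.n ≤ half (paramWords a I) := by
      refine le_trans ?_ (invBound_mul_le_half a I)
      have h0 := one_le_invBound a I
      obtain ⟨g, -⟩ := le_size a I
      have g1 : 512 + (I.n : ℝ) ≤ ((size (paramWords a I) : ℤ) : ℝ) := by exact_mod_cast g
      have hn0 : (0 : ℝ) ≤ I.n := Nat.cast_nonneg _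
      gcongr
      exact (show (I.n : ℝ) ≤ ((size (paramWords a I) : ℤ) : ℝ) by linarith).trans
        (le_self_pow₀ (by linarith) (by norm_num))
    have h4 : ∑ i, |γ i| ≤ half (paramWords a I) * (I.den * ‖x‖) := by
      have h0 := one_le_invBound a I
      calc _ ≤ invBound a I * (I.n * (I.den * ‖x‖)) := h1.trans (by gcongr)
        _ = invBound a I * I.n * (I.den * ‖x‖) := by ring
        _ ≤ _ := by gcongr
    have h5 : ‖(WithLp.toLp 2 fun i => γ i / (2 * half (paramWords a I) * I.den) : RSpace I.n)‖ ≤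
        ‖x‖ := by
      refine (norm_toLp_le _).trans ?_
      have e : ∀ i, |γ i / (2 * half (paramWords a I) * I.den)| =
          |γ i| / (2 * half (paramWords a I) * I.den) := fun i => by
        rw [abs_div, abs_of_pos (show (0 : ℝ) < 2 * half (paramWords a I) * I.den by positivity)]
      simp_rw [e]
      rw [← Finset.sum_div, div_le_iff₀ (by positivity)]
      have : 0 ≤ (half (paramWords a I) : ℝ) * (I.den * ‖x‖) := by positivity
      linarith
    rw [hAx]
    linarith [norm_add_le x (WithLp.toLp 2 fun i => γ i / (2 * half (paramWords a I) * I.den))]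

/-! ### From samples to acceptance -/

theorem _root_.LatticeInput.point_injective : Function.Injective I.point := fun y y' h => by
  ext i
  have := congr_fun (congr_arg WithLp.ofLp h) i
  simpa [LatticeInput.point, div_left_inj' I.den_ne_zero] using this

theorem _root_.LatticeInput.point_add (y y' : Fin I.n → ℤ) :
    I.point (y + y') = I.point y + I.point y' := by
  ext i
  simp [LatticeInput.point, add_div]

theorem _root_.LatticeInput.inner_point (y : Fin I.n → ℤ) (θ : RSpace I.n) :
    inner ℝ (I.point y) θ = (∑ i, (y i : ℝ) * θ i) / I.den := by
  rw [PiLp.inner_apply, Finset.sum_div]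
  refine Finset.sum_congr rfl fun i _ => ?_
  simp [LatticeInput.point]
  ring

theorem sumSq_ofFn_point {m : ℕ} (Y : Fin m → Fin I.n → ℤ) (θ : RSpace I.n) :
    sumSq ((List.ofFn Y).map I.point) θ =
      (∑ r, (∑ i, (Y r i : ℝ) * θ i) ^ 2) / (I.den : ℝ) ^ 2 := by
  rw [sumSq, List.map_map, List.map_ofFn, List.sum_ofFn, Finset.sum_div]
  refine Finset.sum_congr rfl fun r _ => ?_
  rw [Function.comp_apply, Function.comp_apply, I.inner_point, div_pow]

theorem accepts_of_sumSq_le (ha : 1 ≤ a) (b : List ℤ) {l : List (Fin I.n → ℤ)}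
    (hlen : l.length = I.n)
    (hl : ∀ y ∈ l, (queryInput a I ha fun i => b.getD i 0).point y -
      (queryInput a I ha fun i => b.getD i 0).point (queryInput a I ha fun i => b.getD i 0).shift ∈
      (queryInput a I ha fun i => b.getD i 0).lattice)
    (hθ : ∀ θ, sumSq (l.map (queryInput a I ha fun i => b.getD i 0).point) θ ≤
      128 * I.n * (queryInput a I ha fun i => b.getD i 0).s ^ 2 * ‖θ‖ ^ 2) :
    accepts (paramWords a I) b (l.flatMap List.ofFn) = true := by
  obtain ⟨Y, rfl⟩ : ∃ Y : Fin I.n → Fin I.n → ℤ, l = List.ofFn Y :=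
    ⟨fun r => l[r]'(by rw [hlen]; exact r.2), List.ext_getElem (by simp [hlen]) (by simp)⟩
  have hnum : ((queryInput a I ha fun i => b.getD i 0).num : ℝ) =
      8 * half (paramWords a I) * I.num * a := by
    exact_mod_cast congr_arg (Int.cast : ℤ → ℝ) (queryInput_num a I ha _)
  set q := queryInput a I ha fun i => b.getD i 0 with hq
  -- The query basis is twice `pertMatrix` and the shift is its image of b, so the samples are the
  -- images of the integer vectors b + 2z.
  have hw : ∀ r, ∃ z : Fin I.n → ℤ,
      Y r = pertMatrix a I *ᵥ fun i : Fin I.n => b.getD i 0 + 2 * z i := by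
    intro r
    obtain ⟨z, hz⟩ := q.mem_lattice.1 (hl (Y r) (List.mem_ofFn.2 ⟨r, rfl⟩))
    rw [sub_eq_iff_eq_add] at hz
    have e : ∀ z' c : Fin I.n → ℤ, ((2 : ℤ) • pertMatrix a I) *ᵥ z' + pertMatrix a I *ᵥ c =
        pertMatrix a I *ᵥ fun i => c i + 2 * z' i := by
      intro z' c
      rw [Matrix.smul_mulVec, ← Matrix.mulVec_smul, ← Matrix.mulVec_add]
      congr 1
      funext i
      simp [add_comm]
    exact ⟨z, (q.point_injective (hz.trans (q.point_add _ _).symm)).trans (e z _)⟩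
  choose z hz using hw
  refine accepts_of_le a I (w := fun r i => b.getD i 0 + 2 * z r i) ha (fun r i => ?_)
    (fun r i => by omega) fun θ => ?_
  · rw [← hz r]
    have := getD_flatten_ofFn Y r i
    rwa [List.flatMap_def, List.map_ofFn]
  · have hd := q.den_ne_zero
    have h : (∑ r, (∑ i, (Y r i : ℝ) * θ i) ^ 2) / (q.den : ℝ) ^ 2 ≤
        128 * I.n * ((q.num : ℝ) / q.den) ^ 2 * ∑ i, θ i ^ 2 := by
      have e := EuclideanSpace.real_norm_sq_eq (WithLp.toLp 2 θ : RSpace I.n)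
      rw [← e]
      exact (sumSq_ofFn_point q.toLatticeInput Y (WithLp.toLp 2 θ)).symm.trans_le (hθ _)
    simp only [hz] at h
    rw [div_pow, hnum, div_le_iff₀ (by positivity)] at h
    refine h.trans_eq ?_
    field_simp

theorem ofReal_le_map_accepts (ha : 1 ≤ a) (b : List ℤ)
    {ν : PMF (Fin I.n → ℤ)}
    (hν : ∀ y ∈ ν.support, (queryInput a I ha fun i => b.getD i 0).point y -
      (queryInput a I ha fun i => b.getD i 0).point (queryInput a I ha fun i => b.getD i 0).shift ∈
      (queryInput a I ha fun i => b.getD i 0).lattice)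
    (hsub : IsSubgaussian (ν.map (queryInput a I ha fun i => b.getD i 0).point)
      (queryInput a I ha fun i => b.getD i 0).s) :
    ENNReal.ofReal (1 - Real.exp (-(I.n : ℝ))) ≤
      (((iidSamples ν I.n).map fun l => l.flatMap List.ofFn).map
        (accepts (paramWords a I) b)) true := by
  set q := queryInput a I ha fun i => b.getD i 0 with hq
  set p := iidSamples ν I.n with hp
  have hbad := iidSamples_sumSq (n := I.n) q.s_pos hsub
  set bad : Set (List (Fin I.n → ℤ)) :=
    {l | ∃ θ, 128 * I.n * q.s ^ 2 * ‖θ‖ ^ 2 < sumSq (l.map q.point) θ} with hB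
  have h1 : 1 ≤ p.toOuterMeasure bad + p.toOuterMeasure badᶜ := by
    rw [← (p.toOuterMeasure_apply_eq_one_iff Set.univ).2 (Set.subset_univ _),
      ← Set.union_compl_self bad]
    exact MeasureTheory.measure_union_le _ _
  have h2 : p.toOuterMeasure badᶜ ≤ p.toOuterMeasure
      ((fun l => accepts (paramWords a I) b (l.flatMap List.ofFn)) ⁻¹' {true}) := by
    refine PMF.toOuterMeasure_mono _ fun l hl => ?_
    obtain ⟨hlen, hmem⟩ := support_iidSamples ν I.n l hl.2
    refine accepts_of_sumSq_le a I ha b hlen (fun y hy => hν y (hmem y hy)) fun θ => ?_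
    by_contra! hcon
    exact hl.1 ⟨θ, hcon⟩
  rw [PMF.map_comp, ← PMF.toOuterMeasure_apply_singleton, PMF.toOuterMeasure_map_apply]
  refine le_trans ?_ h2
  rw [ENNReal.ofReal_sub _ (Real.exp_pos _).le, ENNReal.ofReal_one]
  refine tsub_le_iff_left.2 (h1.trans ?_)
  gcongr
  exact hbad

end Yes

end Spp

/-! ### Far lattices are rejected -/

theorem PMF.le_bind_apply {A B : Type} (p : PMF A) {f : A → PMF B} {x : B} {c : ℝ≥0∞}
    (h : ∀ a, c ≤ f a x) : c ≤ p.bind f x := by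
  rw [PMF.bind_apply]
  calc c = ∑' a, p a * c := by rw [ENNReal.tsum_mul_right, p.tsum_coe, one_mul]
    _ ≤ _ := ENNReal.tsum_le_tsum fun a => by gcongr; exact h a

/-- An involution preserves the uniform distribution; twice the probability is therefore the mean of
f a x + f (τ a) x. -/
theorem PMF.half_le_bind_uniform {A B : Type} [Fintype A] [Nonempty A] {f : A → PMF B} {x : B}
    {τ : A → A} (hτ : Function.Involutive τ) (h : ∀ a, 1 ≤ f a x + f (τ a) x) :
    1 / 2 ≤ (PMF.uniformOfFintype A).bind f x := by
  rw [PMF.bind_apply, tsum_fintype]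
  set S := ∑ a, PMF.uniformOfFintype A a * f a x with hS
  have h1 : S = ∑ a, PMF.uniformOfFintype A a * f (τ a) x := by
    rw [hS, ← Equiv.sum_comp (hτ.toPerm τ)]
    simp [PMF.uniformOfFintype_apply]
  have h2 : 1 ≤ S + S := by
    calc 1 = ∑ a, PMF.uniformOfFintype A a := by
          rw [← (PMF.uniformOfFintype A).tsum_coe, tsum_fintype]
      _ ≤ ∑ a, PMF.uniformOfFintype A a * (f a x + f (τ a) x) :=
          Finset.sum_le_sum fun a _ => le_mul_of_one_le_right' (h a)
      _ = S + ∑ a, PMF.uniformOfFintype A a * f (τ a) x := by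
          simp_rw [mul_add, Finset.sum_add_distrib, hS]
      _ = S + S := by rw [← h1]
  rw [← mul_two] at h2
  exact ENNReal.div_le_of_le_mul h2

namespace Spp

section No

open Matrix

variable (a : ℕ) (I : LatticeInput)

theorem norm_sq_toEuclideanLin_point (R : Matrix (Fin I.n) (Fin I.n) ℝ) (y : Fin I.n → ℤ) :
    ‖Matrix.toEuclideanLin R (I.point y)‖ ^ 2 =
      ∑ k, (∑ i, (y i : ℝ) * R k i) ^ 2 / (I.den : ℝ) ^ 2 := by
  rw [EuclideanSpace.real_norm_sq_eq]
  refine Finset.sum_congr rfl fun k _ => ?_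
  rw [← div_pow, Finset.sum_div]
  congr 1
  change (R *ᵥ fun i => (y i : ℝ) / (I.den : ℝ)) k = _
  rw [Matrix.mulVec, dotProduct]
  exact Finset.sum_congr rfl fun i _ => by ring

theorem trace_transpose_mul_self {n : ℕ} (R : Matrix (Fin n) (Fin n) ℝ) :
    (Rᵀ * R).trace = ∑ k, ∑ i, R k i ^ 2 := by
  rw [Finset.sum_comm, Matrix.trace]
  refine Finset.sum_congr rfl fun i _ => ?_
  rw [Matrix.diag_apply, Matrix.mul_apply]
  exact Finset.sum_congr rfl fun k _ => by rw [Matrix.transpose_apply, sq]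

/-- An accepted answer carries n vectors Bw of the class, whatever its origin. Their images under R
have total square at most T · tr(RᵀR) / den², by the spectral bound for each row of R, and at least
n m². -/
theorem le_of_accepts {b y : List ℤ} (h : accepts (paramWords a I) b y = true)
    (R : Matrix (Fin I.n) (Fin I.n) ℝ) {m : ℝ}
    (hm : ∀ w : Fin I.n → ℤ, (∀ i : Fin I.n, (w i - b.getD i 0) % 2 = 0) →
      m ≤ ‖Matrix.toEuclideanLin R (I.point (I.basis *ᵥ w))‖) :
    m ≤ 100 * a * I.s * Real.sqrt (Rᵀ * R).trace := by
  obtain ⟨h1, h2⟩ := (accepts_iff a I b y).1 h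
  rw [bad_nonpos_iff] at h1
  have hn0 : (0 : ℝ) < I.n := by exact_mod_cast I.n_pos
  have hd0 : (0 : ℝ) < I.den := by exact_mod_cast I.den_pos
  have ht : 0 ≤ (Rᵀ * R).trace := by
    rw [trace_transpose_mul_self]; positivity
  have hrhs : 0 ≤ 100 * a * I.s * Real.sqrt (Rᵀ * R).trace := by
    have := I.s_pos
    positivity
  rcases le_total m 0 with hm0 | hm0
  · exact hm0.trans hrhs
  set V := highMatrix a I y with hV
  set T : ℝ := 10000 * I.n * a ^ 2 * I.num ^ 2 with hT
  have h3 := sum_mulVec_sq_le_of_trace_le (show 0 ≤ T by positivity) I.n_pos.ne' h2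
  have h4 : ∀ r : Fin I.n, m ^ 2 ≤ ∑ k, (V *ᵥ R k) r ^ 2 / (I.den : ℝ) ^ 2 := by
    intro r
    have := hm (fun j => low (paramWords a I) y (r * I.n + j)) fun i => (h1 r i).2
    calc m ^ 2 ≤ _ := pow_le_pow_left₀ hm0 this 2
      _ = _ := by
        rw [norm_sq_toEuclideanLin_point]
        refine Finset.sum_congr rfl fun k _ => ?_
        rw [Matrix.mulVec, dotProduct]
        simp_rw [← (h1 r _).1]
        rfl
  have h5 : I.n * m ^ 2 ≤ T * (Rᵀ * R).trace / (I.den : ℝ) ^ 2 := by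
    calc I.n * m ^ 2 = ∑ _r : Fin I.n, m ^ 2 := by simp
      _ ≤ ∑ r, ∑ k, (V *ᵥ R k) r ^ 2 / (I.den : ℝ) ^ 2 := Finset.sum_le_sum fun r _ => h4 r
      _ = (∑ k, ∑ r, (V *ᵥ R k) r ^ 2) / (I.den : ℝ) ^ 2 := by
        rw [Finset.sum_comm, Finset.sum_div]
        exact Finset.sum_congr rfl fun k _ => (Finset.sum_div _ _ _).symm
      _ ≤ (∑ k, T * ∑ i, R k i ^ 2) / (I.den : ℝ) ^ 2 := by
        gcongr with k
        exact h3 (R k)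
      _ = _ := by rw [← Finset.mul_sum, trace_transpose_mul_self]
  refine abs_le_of_sq_le_sq' (a := m) ?_ hrhs |>.2
  rw [mul_pow, Real.sq_sqrt ht]
  refine le_of_mul_le_mul_left (h5.trans_eq ?_) hn0
  rw [hT, LatticeInput.s]
  field_simp
  ring

theorem toEuclideanLin_point_mem (R : Matrix (Fin I.n) (Fin I.n) ℝ) (z : Fin I.n → ℤ) :
    Matrix.toEuclideanLin R (I.point (I.basis *ᵥ z)) ∈ imageLattice R I.lattice :=
  ⟨_, I.mem_lattice.2 ⟨z, rfl⟩, rfl⟩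

/-- One of two complementary parity classes is far from the origin. -/
theorem parity_far {R : Matrix (Fin I.n) (Fin I.n) ℝ} {u : Fin I.n → ℤ} {m : ℝ}
    (hu : ∀ y ∈ imageLattice R I.lattice,
      m ≤ ‖(1 / 2 : ℝ) • Matrix.toEuclideanLin R (I.point (I.basis *ᵥ u)) - y‖)
    {b b' : Fin I.n → ℤ} (hb : ∀ i, (b i + b' i - u i) % 2 = 0) :
    (∀ w : Fin I.n → ℤ, (∀ i, (w i - b i) % 2 = 0) →
      m ≤ ‖Matrix.toEuclideanLin R (I.point (I.basis *ᵥ w))‖) ∨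
    (∀ w : Fin I.n → ℤ, (∀ i, (w i - b' i) % 2 = 0) →
      m ≤ ‖Matrix.toEuclideanLin R (I.point (I.basis *ᵥ w))‖) := by
  by_contra! hcon
  obtain ⟨⟨w, hw, hw'⟩, v, hv, hv'⟩ := hcon
  -- The parities of w and v add up to that of u, so u / 2 - z is the midpoint of w and v.
  have hz : ∃ z : Fin I.n → ℤ, u = w + v + (z + z) := by
    refine ⟨fun i => (u i - w i - v i) / 2, funext fun i => ?_⟩
    have h1 := hb i
    have h2 := hw i
    have h3 := hv i
    simp only [Pi.add_apply]
    omega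
  obtain ⟨z, hz⟩ := hz
  have h1 := hu _ (toEuclideanLin_point_mem I R z)
  rw [hz] at h1
  simp only [Matrix.mulVec_add, I.point_add, map_add] at h1
  set W := Matrix.toEuclideanLin R (I.point (I.basis *ᵥ w))
  set V := Matrix.toEuclideanLin R (I.point (I.basis *ᵥ v))
  set Z := Matrix.toEuclideanLin R (I.point (I.basis *ᵥ z))
  have e : (1 / 2 : ℝ) • (W + V + (Z + Z)) - Z = (1 / 2 : ℝ) • W + (1 / 2 : ℝ) • V := by
    module
  rw [e] at h1
  have h2 := norm_add_le ((1 / 2 : ℝ) • W) ((1 / 2 : ℝ) • V)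
  rw [norm_smul, norm_smul, Real.norm_of_nonneg (by norm_num)] at h2
  linarith

theorem getD_coinWords {k : ℕ} (b : Fin k → Bool) {i : ℕ} (hi : i < k) :
    (coinWords b).getD i 0 = if b ⟨i, hi⟩ then 1 else 0 := by
  rw [coinWords, List.getD_eq_getElem _ _ (by simpa using hi), List.getElem_ofFn]

/-- The coins that complement given coins to the parities of a vector. -/
def complement {n k : ℕ} (u : Fin n → ℤ) (b : Fin k → Bool) : Fin k → Bool :=
  fun i => xor (b i) (if h : (i : ℕ) < n then decide (u ⟨i, h⟩ % 2 = 1) else false)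

theorem complement_involutive {n k : ℕ} (u : Fin n → ℤ) :
    Function.Involutive (complement u : (Fin k → Bool) → Fin k → Bool) := fun b => by
  funext i
  simp [complement]

theorem getD_add_getD_complement {n k : ℕ} (hk : n ≤ k) (u : Fin n → ℤ) (b : Fin k → Bool)
    (i : Fin n) :
    ((coinWords b).getD i 0 + (coinWords (complement u b)).getD i 0 - u i) % 2 = 0 := by
  have hi : (i : ℕ) < k := i.2.trans_le hk
  rw [getD_coinWords _ hi, getD_coinWords _ hi, complement]
  simp only [i.2, dite_true]
  by_cases hu : u i % 2 = 1 <;> cases b ⟨i, hi⟩ <;> simp [hu] <;> omega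

theorem map_accepts_false_eq_one {b : List ℤ} (h : ∀ y, accepts (paramWords a I) b y = false)
    (p : PMF (List ℤ)) : (p.map (accepts (paramWords a I) b)) false = 1 := by
  have : accepts (paramWords a I) b = Function.const _ false := funext h
  rw [this, PMF.map_const]
  simp

end No

/-! ### The reduction -/

/-- The reduction. -/
noncomputable def reduction : Reduction := ⟨.X, query, accepts⟩

theorem polyTime_reduction :
    reduction.PolyTime {x | ∃ (a : ℕ) (I : LatticeInput), 1 ≤ a ∧ x = paramWords a I} := by
  refine ⟨polyTime_query ?_, polyTime_decide ?_⟩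
  · rintro _ ⟨x, hx, b, rfl⟩
    exact ⟨(x, coinWords b, []), hx, rfl, rfl, rfl⟩
  · rintro _ ⟨x, hx, b, y, rfl⟩
    exact ⟨(x, coinWords b, y), hx, rfl, rfl⟩

theorem le_coins (a : ℕ) (I : LatticeInput) :
    I.n ≤ reduction.coins.eval (bitSize (paramWords a I)) := by
  have h1 := length_le_bitSize (paramWords a I)
  rw [length_paramWords] at h1
  have h2 : I.n ≤ I.n * I.n := Nat.le_mul_self _
  have h3 : reduction.coins.eval (bitSize (paramWords a I)) = bitSize (paramWords a I) := by
    simp [reduction]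
  omega

/-- The bound holds for each outcome of the coins: the query is always legitimate, since α η(L') ≤ 2
α η(L) ≤ 2 ⌈α⌉ s. -/
theorem le_outcome_true {α : ℕ → ℝ} (hα : ∀ n, 1 ≤ α n) {O : Oracle}
    (hO : SolvesDSGS (fun n => 1 * n) (fun n L => α n * smoothingParam (1 / 2) L) O)
    (I : LatticeInput) (h : GapSPPYes (1 / 2) I) :
    ENNReal.ofReal (1 - Real.exp (-(I.n : ℝ))) ≤
      reduction.outcome O (paramWords ⌈α I.n⌉₊ I) true := by
  have ha : 1 ≤ ⌈α I.n⌉₊ := Nat.one_le_ceil_iff.2 (by linarith [hα I.n])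
  refine PMF.le_bind_apply _ fun b => ?_
  change _ ≤ ((O (query (paramWords ⌈α I.n⌉₊ I) (coinWords b))).map
    (accepts (paramWords ⌈α I.n⌉₊ I) (coinWords b))) true
  obtain ⟨ν, hν, hsub, hν'⟩ := hO (queryInput ⌈α I.n⌉₊ I ha fun i => (coinWords b).getD i 0) (by
    rw [queryInput_s]
    have h1 := smoothingParam_queryInput_le ⌈α I.n⌉₊ I ha fun i => (coinWords b).getD i 0
    have h2 := hα I.n
    have h3 := Nat.le_ceil (α I.n)
    have h4 := (smoothingParam_mem I).1
    have h5 : smoothingParam (1 / 2) I.lattice < I.s := h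
    calc α I.n * smoothingParam (1 / 2) _ ≤ α I.n * (2 * smoothingParam (1 / 2) I.lattice) := by
          gcongr
      _ ≤ ⌈α I.n⌉₊ * (2 * I.s) := by gcongr
      _ = _ := by ring)
  have e : (fun n => 1 * n : ℕ → ℕ) = id := funext one_mul
  rw [query_eq_words _ _ ha, hν', e]
  exact ofReal_le_map_accepts _ _ ha _ hν hsub

open Matrix in
theorem le_outcome_false {α : ℕ → ℝ} (hα : ∀ n, 1 ≤ α n) (O : Oracle) (I : LatticeInput)
    (h : GapSPPNo (fun n => ENNReal.ofReal (1000 * α n) * weakConst n) (1 / 2) I) :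
    1 / 2 ≤ reduction.outcome O (paramWords ⌈α I.n⌉₊ I) false := by
  have hα1 := hα I.n
  have hs := I.s_pos
  have ha2 : (⌈α I.n⌉₊ : ℝ) ≤ 2 * α I.n := by
    have := Nat.ceil_lt_add_one (show 0 ≤ α I.n by linarith)
    linarith
  set a := ⌈α I.n⌉₊
  -- Acceptance would give μ / 3 ≤ 100 ⌈α⌉ s t ≤ 200 α s t, which is excluded by μ > 600 α s t. The
  -- gap to 1000 only provides the strict inequality needed to pick a single R from the supremum.
  obtain ⟨R, -, hR⟩ := exists_matrix_of_weakConst_mul_le (L := I.lattice) (smoothingParam_mem I).1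
    (κ := 600 * α I.n * I.s) (κ' := 1000 * α I.n * I.s) (by positivity) (by
      have : 0 < α I.n * I.s := by positivity
      nlinarith) (by
      rw [ENNReal.ofReal_mul (by positivity), mul_right_comm]
      exact h)
  set μ := coveringRadius (imageLattice R I.lattice)
  set t := Real.sqrt (Rᵀ * R).trace with ht
  have hκ : 0 < 600 * α I.n * I.s := by positivity
  have ht0 : 0 < t := by
    refine (Real.sqrt_nonneg _).lt_of_ne fun h0 => ?_
    rw [ht, ← h0, div_zero] at hR
    linarith
  rw [lt_div_iff₀ ht0] at hR
  have hμ : 0 < μ := lt_trans (by positivity) hR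
  obtain ⟨p, hp, hfar⟩ := exists_half_far hμ
  obtain ⟨v, hv, rfl⟩ := hp
  obtain ⟨u, rfl⟩ := I.mem_lattice.1 hv
  refine PMF.half_le_bind_uniform (complement_involutive u) fun b => ?_
  have hrej : ∀ b : List ℤ, (∀ w : Fin I.n → ℤ, (∀ i : Fin I.n, (w i - b.getD i 0) % 2 = 0) →
      μ / 3 ≤ ‖Matrix.toEuclideanLin R (I.point (I.basis *ᵥ w))‖) →
      ((O (query (paramWords a I) b)).map (accepts (paramWords a I) b)) false = 1 := by
    refine fun b hb => map_accepts_false_eq_one a I (fun y => ?_) _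
    by_contra hacc
    have h1 := le_of_accepts a I (by simpa using hacc) R hb
    have h2 : 100 * a * I.s * t ≤ 100 * (2 * α I.n) * I.s * t := by gcongr
    rw [← ht] at h1
    linarith
  rcases parity_far I hfar (b := fun i => (coinWords b).getD i 0)
    (b' := fun i => (coinWords (complement u b)).getD i 0)
    (getD_add_getD_complement (le_coins a I) u b) with hb | hb
  · exact (hrej _ hb).ge.trans le_self_add
  · exact (hrej _ hb).ge.trans le_add_self

end Spp

theorem mainTheorem9 :
    ∃ (K : ℝ) (c : ℕ) (R : Reduction), 0 < K ∧
      R.PolyTime {x | ∃ (a : ℕ) (I : LatticeInput), 1 ≤ a ∧ x = paramWords a I} ∧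
      ∀ α : ℕ → ℝ, (∀ n, 1 ≤ α n) →
        ∀ O : Oracle,
          SolvesDSGS (fun n => c * n) (fun n L => α n * smoothingParam (1 / 2) L) O →
          ∀ I : LatticeInput,
            (GapSPPYes (1 / 2) I →
              ENNReal.ofReal (1 - Real.exp (-(I.n : ℝ))) ≤
                R.outcome O (paramWords ⌈α I.n⌉₊ I) true) ∧
            (GapSPPNo (fun n => ENNReal.ofReal (K * α n) * weakConst n) (1 / 2) I →
              1 / 2 ≤ R.outcome O (paramWords ⌈α I.n⌉₊ I) false) :=
  ⟨1000, 1, Spp.reduction, by norm_num, Spp.polyTime_reduction, fun _ hα O hO I =>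
    ⟨Spp.le_outcome_true hα hO I, Spp.le_outcome_false hα O I⟩⟩
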